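/- **Theorem 2 (OED capacity scaling).** Fix a power $P>0$ and a subcarrier bandwidth $\Delta f>0$. Consider the non-coherent i.i.d. Rayleigh block-fading wideband SIMO channel with $N$ receive antennas, $B$ subcarriers and coherence block length $L$, $$\mathbf Y[b]=\mathbf h[b]\,\mathbf x[b]^H+\mathbf Z[b]\in\mathbb C^{N\times L},\qquad b=0,\dots,B-1,$$ where all entries of all $\mathbf h[b]\in\mathbb C^N$ and $\mathbf Z[b]\in\mathbb C^{N\times L}$ are i.i.d. $\mathcal{CN}(0,1)$, independent of the inputs $\mathbf x[b]\in\mathbb C^L$, unknown to transmitter and receiver, and the inputs satisfy $\mathbb E\big[\tfrac1L\sum_{b}\|\mathbf x[b]\|^2\big]\le P$. The non-coherent capacity is $$C_n(B,N,L)=\sup\ \frac{I(\{\mathbf x[b]\}_b;\{\mathbf Y[b]\}_b)}{L/\Delta f},$$ the supremum being over all joint laws of $\{\mathbf x[b]\}_b$ satisfying the power constraint. An Only Energy Detection (OED) input is one of the form $\mathbf x[b]=\sqrt{a[b]}\,\mathbf u[b]$ with $a[b]\ge 0$ and $\|\mathbf u[b]\|=1$, the energies $\{a[b]\}_b$ being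 independent of the shapes $\{\mathbf u[b]\}_b$ (so $a[b]=\|\mathbf x[b]\|^2$ and only the energies carry information; a constant $\mathbf u[b]$ is energy modulation). The OED capacity is $$C_E(B,N,L)=\sup\ \frac{I(\{a[b]\}_b;\{\mathbf Y[b]\}_b)}{L/\Delta f},$$ the supremum being over all OED inputs satisfying the power constraint. Mutual information is measured in bits. Say that $f(N)$ *scales with exponent* $e$, written $f=\Theta(N^e)$ in the sense of exponents, if $0<f(N)<\infty$ for all large $N$ and $\lim_{N\to\infty}\log f(N)/\log N=e$. Let $\varepsilon,\tau\ge 0$ and let $B=B(N)$ and $L=L(N)$ scale with exponents $\varepsilon$ and $\tau$ respectively. Then $C_E(B,N,L)$ scales with exponent $$\min\left(\varepsilon-\tau,\tfrac12\right).$$ Consequently, if $\tau>0$, no OED scheme attains the scaling of the non-coherent capacity: there is $\delta>0$ such that $N^{\delta}\,C_E(B,N,L)\le C_n(B,N,L)$ for all sufficiently large $N$. -/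

import Mathlib

open MeasureTheory ProbabilityTheory Filter Topology
open scoped ENNReal NNReal

noncomputable section

namespace WidebandSIMO

/-- The circularly symmetric complex Gaussian law `𝒞𝒩(0,1)`: independent real and imaginary
parts, each real Gaussian with mean `0` and variance `1/2`. -/
def stdComplexGaussian : Measure ℂ :=
  ((gaussianReal 0 (1 / 2)).prod (gaussianReal 0 (1 / 2))).map fun p => (⟨p.1, p.2⟩ : ℂ)

/-- Channel inputs: for each of the `B` subcarriers, a vector `x[b] ∈ ℂ^L`. -/
abbrev Input (B L : ℕ) : Type := Fin B → EuclideanSpace ℂ (Fin L)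

/-- Fading coefficients: `h[b] ∈ ℂ^N` for each subcarrier. -/
abbrev Fading (B N : ℕ) : Type := Fin B → Fin N → ℂ

/-- Noise realizations and channel outputs: an `N × L` complex array for each subcarrier. -/
abbrev Output (B N L : ℕ) : Type := Fin B → Fin N → Fin L → ℂ

/-- I.i.d. Rayleigh fading: all coefficients `h_n[b]` are independent `𝒞𝒩(0,1)`. -/
def fadingLaw (B N : ℕ) : Measure (Fading B N) :=
  Measure.pi fun _ => Measure.pi fun _ => stdComplexGaussian

/-- White noise: all coefficients `z_{n,ℓ}[b]` are independent `𝒞𝒩(0,1)`. -/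
def noiseLaw (B N L : ℕ) : Measure (Output B N L) :=
  Measure.pi fun _ => Measure.pi fun _ => Measure.pi fun _ => stdComplexGaussian

/-- The block fading channel `Y[b] = h[b] x[b]ᴴ + Z[b]`. -/
def channelOutput {B N L : ℕ} (x : Input B L) (h : Fading B N) (z : Output B N L) :
    Output B N L :=
  fun b n l => h b n * star (x b l) + z b n l

/-- Average transmitted power `E[(1/L) ∑_b ∑_ℓ |x_ℓ[b]|²]` of an input law. -/
def avgPower {B L : ℕ} (p : Measure (Input B L)) : ℝ≥0∞ :=
  ∫⁻ x, (∑ b, ∑ l, ‖x b l‖ₑ ^ 2) / (L : ℝ≥0∞) ∂p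

/-- Mutual information, in bits, of a pair of random variables with joint law `ρ`: the
Kullback–Leibler divergence of `ρ` from the product of its marginals, divided by `log 2`. -/
def mutualInfo {α β : Type*} [MeasurableSpace α] [MeasurableSpace β]
    (ρ : Measure (α × β)) : ℝ≥0∞ :=
  InformationTheory.klDiv ρ (ρ.fst.prod ρ.snd) / ENNReal.ofReal (Real.log 2)

/-- Admissible inputs of the non-coherent channel: all probability laws of `{x[b]}_b` that
satisfy the average power constraint. -/
structure IsInput {B L : ℕ} (P : ℝ) (p : Measure (Input B L)) : Prop where
  isProbabilityMeasure : IsProbabilityMeasure p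
  power : avgPower p ≤ ENNReal.ofReal P

/-- Joint law of `({x[b]}_b, {Y[b]}_b)`; neither side knows the fading, so it is averaged out. -/
def inputOutputLaw {B L : ℕ} (N : ℕ) (p : Measure (Input B L)) :
    Measure (Input B L × Output B N L) :=
  (p.prod ((fadingLaw B N).prod (noiseLaw B N L))).map
    fun ω => (ω.1, channelOutput ω.1 ω.2.1 ω.2.2)

/-- The non-coherent ergodic capacity `C_n`, in bits per second. -/
def nonCoherentCapacity (P Δf : ℝ) (B N L : ℕ) : ℝ≥0∞ :=
  ⨆ (p : Measure (Input B L)) (_ : IsInput P p),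
    mutualInfo (inputOutputLaw N p) / ((L : ℝ≥0∞) / ENNReal.ofReal Δf)

/-- Energy–shape composition: `x[b] = √a[b] · u[b]`. -/
def energyShape {B L : ℕ} (a : Fin B → ℝ) (u : Input B L) : Input B L :=
  fun b => ((√(a b) : ℝ) : ℂ) • u b

/-- Only-energy-detection (OED) inputs: `x[b] = √a[b] · u[b]` with nonnegative block energies
`{a[b]}_b` of joint law `pa` and unit-norm shapes `{u[b]}_b` of joint law `pu`, the energies
being independent of the shapes (the law of the pair is `pa.prod pu`). Energy modulation is the
case of a constant `u[b]`; the isotropic unit vector is another. -/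
structure IsOEDInput {B L : ℕ} (P : ℝ) (pa : Measure (Fin B → ℝ)) (pu : Measure (Input B L)) :
    Prop where
  isProbabilityMeasure_energy : IsProbabilityMeasure pa
  isProbabilityMeasure_shape : IsProbabilityMeasure pu
  energy_nonneg : ∀ᵐ a ∂pa, ∀ b, 0 ≤ a b
  shape_unit : ∀ᵐ u ∂pu, ∀ b, ‖u b‖ = 1
  power : avgPower ((pa.prod pu).map fun ω => energyShape ω.1 ω.2) ≤ ENNReal.ofReal P

/-- Joint law of `({a[b]}_b, {Y[b]}_b)` for an OED input; shapes and fading are unknown to the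
receiver, so they are averaged out. -/
def energyOutputLaw {B L : ℕ} (N : ℕ) (pa : Measure (Fin B → ℝ)) (pu : Measure (Input B L)) :
    Measure ((Fin B → ℝ) × Output B N L) :=
  ((pa.prod pu).prod ((fadingLaw B N).prod (noiseLaw B N L))).map
    fun ω => (ω.1.1, channelOutput (energyShape ω.1.1 ω.1.2) ω.2.1 ω.2.2)

/-- The OED capacity `C_E`, in bits per second. -/
def oedCapacity (P Δf : ℝ) (B N L : ℕ) : ℝ≥0∞ :=
  ⨆ (pa : Measure (Fin B → ℝ)) (pu : Measure (Input B L)) (_ : IsOEDInput P pa pu),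
    mutualInfo (energyOutputLaw N pa pu) / ((L : ℝ≥0∞) / ENNReal.ofReal Δf)

/-- `f` scales with exponent `e`: for large `N` it is positive and finite, and
`log f(N) / log N → e`. -/
def HasScalingExponent (f : ℕ → ℝ≥0∞) (e : ℝ) : Prop :=
  (∀ᶠ N in atTop, f N ≠ 0 ∧ f N ≠ ∞) ∧
    Tendsto (fun N => Real.log (f N).toReal / Real.log N) atTop (𝓝 e)

end WidebandSIMO

end

noncomputable section

namespace WidebandSIMO

open InformationTheory

/-! Upper bound on `oedCapacity`. With the fading averaged out, the output density for `x[b] = √a[b]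
u[b]` depends on the output only through the energies received along `u[b]`, each a sum over `N`
antennas with mean `N (1 + a[b])`. Even a receiver that is told the shapes therefore resolves an
energy only to precision of order `1/√N`. By `klDiv_prod_marginals_le` the true output marginal may
be replaced by any reference law; the one chosen drives the channel with independent energies on the
grid `k/√N`, with mass `B/(B + 1)` at zero and a heavy tail. Rounding an energy down to the grid
costs at most one nat, and naming the grid point costs minus the logarithm of its weight
(`klDiv_energyOutputLaw_le`).

This cost per subcarrier has two bounds (`quantCost_le_linear`). One is `1/B` plus a multiple of `√N
a`, with a logarithmic factor; since the energies have total mean at most `P L`, the information is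
at most about `√N L`. The other is logarithmic in the energy; summed over the subcarriers it gives
about `B`. Dividing by `L` yields the exponents `1/2` and `ε - τ`.

Lower bound on `oedCapacity`. On–off signalling with energy of order `1/√N` is detected with error
at most `1/4` by Chebyshev's inequality. The power constraint allows about `min B (L √N)` active
subcarriers on average, and `le_klDiv_of_bits` turns each of them into a constant amount of
information. That lemma combines the Donsker–Varadhan inequality with the independence of the input
bits, so the decisions on different bits may be dependent.

Separation. One pilot of energy `A` serves all data symbols of a block, and the sign of a symbol of
energy `r` is detectable as soon as `N A r` exceeds a constant. For `N ^ σ ≤ L` one can take `A` of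
order `N ^ (-(1 - σ)/2)` and `r` of order `N ^ (-(1 + σ)/2)`; the power then suffices for about `N ^
((1 + σ)/2)` subcarriers, each carrying a constant number of bits per symbol. The exponent `min ε
((1 + σ)/2)` exceeds `min (ε - τ) (1/2)` once `σ` and `τ` are positive. -/

/-! ### Bounds on divergence and mutual information -/

/-- Replacing the true output marginal by any other probability measure can only increase the
divergence of a joint law from a product. -/
lemma klDiv_prod_marginals_le {α β : Type*} [MeasurableSpace α] [MeasurableSpace β]
    [StandardBorelSpace α] [Nonempty α] (ρ : Measure (α × β)) [IsProbabilityMeasure ρ]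
    (Q : Measure β) [IsProbabilityMeasure Q] :
    klDiv ρ (ρ.fst.prod ρ.snd) ≤ klDiv ρ (ρ.fst.prod Q) := by
  set σ := ρ.map Prod.swap with hσ
  have : IsProbabilityMeasure σ := Measure.isProbabilityMeasure_map measurable_swap.aemeasurable
  have hσfst : σ.fst = ρ.snd := Measure.fst_map_swap
  have hswap : σ.map Prod.swap = ρ := by
    rw [hσ, Measure.map_map measurable_swap measurable_swap]; simp
  have h1 : klDiv ρ (ρ.fst.prod ρ.snd) ≤ klDiv σ (ρ.snd.prod ρ.fst) := by
    have := klDiv_map_le σ (ρ.snd.prod ρ.fst) (g := Prod.swap) measurable_swap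
    rwa [hswap, Measure.prod_swap] at this
  have h2 : klDiv σ (Q.prod ρ.fst) ≤ klDiv ρ (ρ.fst.prod Q) := by
    have := klDiv_map_le ρ (ρ.fst.prod Q) (g := Prod.swap) measurable_swap
    rwa [← hσ, Measure.prod_swap] at this
  refine h1.trans (le_trans ?_ h2)
  -- The swap puts the output first, so that the chain rule disintegrates over it: the divergence
  -- from `Q.prod ρ.fst` is `klDiv ρ.snd Q` plus the divergence from the product of the marginals.
  have hd : ρ.snd ⊗ₘ σ.condKernel = σ := by
    rw [← hσfst]; exact σ.disintegrate σ.condKernel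
  have := klDiv_compProd_eq_add ρ.snd Q σ.condKernel (Kernel.const β ρ.fst)
  rw [hd, Measure.compProd_const, Measure.compProd_const] at this
  rw [this]
  exact le_add_self

/-- An upper bound on the likelihood ratio bounds the divergence. -/
lemma klDiv_le_of_le_withDensity_exp {α : Type*} [MeasurableSpace α] (μ ν : Measure α)
    [IsProbabilityMeasure μ] [IsProbabilityMeasure ν] {g : α → ℝ}
    (h_int : Integrable g μ) (hle : μ ≤ ν.withDensity fun x => ENNReal.ofReal (Real.exp (g x))) :
    klDiv μ ν ≤ ENNReal.ofReal (∫ x, g x ∂μ) := by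
  have hac : μ ≪ ν := (Measure.absolutelyContinuous_of_le hle).trans
    (withDensity_absolutelyContinuous _ _)
  have hr : μ.rnDeriv ν ≤ᵐ[ν] fun x => ENNReal.ofReal (Real.exp (g x)) := by
    refine ae_le_of_forall_setLIntegral_le_of_sigmaFinite (Measure.measurable_rnDeriv _ _) ?_
    intro s hs _
    rw [Measure.setLIntegral_rnDeriv hac, ← withDensity_apply _ hs]
    exact hle s
  have hrg : Integrable (fun x => (μ.rnDeriv ν x).toReal * g x) ν := by
    have := (integrable_rnDeriv_smul_iff (f := g) hac).2 h_int
    simpa [smul_eq_mul] using this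
  have hr1 : Integrable (fun x => (μ.rnDeriv ν x).toReal) ν := Measure.integrable_toReal_rnDeriv
  have hh : Integrable (fun x => (μ.rnDeriv ν x).toReal * g x - (μ.rnDeriv ν x).toReal + 1) ν :=
    (hrg.sub hr1).add (integrable_const _)
  -- With `r` the density, `r ≤ exp g` gives `r log r ≤ r g`. The remaining terms `1 - r` of `klFun`
  -- integrate to zero because both measures are probabilities.
  have hkl : ∀ᵐ x ∂ν, klFun (μ.rnDeriv ν x).toReal ≤
      (μ.rnDeriv ν x).toReal * g x - (μ.rnDeriv ν x).toReal + 1 := by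
    filter_upwards [hr] with x hx
    set r := (μ.rnDeriv ν x).toReal with hrdef
    have hr0 : 0 ≤ r := ENNReal.toReal_nonneg
    have hrle : r ≤ Real.exp (g x) := ENNReal.toReal_le_of_le_ofReal (Real.exp_pos _).le hx
    have : r * Real.log r ≤ r * g x := by
      rcases hr0.eq_or_lt with h | h
      · simp [← h]
      · exact mul_le_mul_of_nonneg_left ((Real.log_le_iff_le_exp h).2 hrle) hr0
    rw [klFun_apply]; linarith
  have hInt : ∫ x, ((μ.rnDeriv ν x).toReal * g x - (μ.rnDeriv ν x).toReal + 1) ∂ν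
      = ∫ x, g x ∂μ := by
    have hd : Integrable (fun x => (μ.rnDeriv ν x).toReal * g x - (μ.rnDeriv ν x).toReal) ν :=
      hrg.sub hr1
    rw [integral_add hd (integrable_const _), integral_sub hrg hr1,
      Measure.integral_toReal_rnDeriv hac]
    have := integral_rnDeriv_smul (f := g) hac
    simp only [smul_eq_mul] at this
    rw [this]; simp
  rw [klDiv_eq_lintegral_klFun_of_ac hac, ← hInt, ofReal_integral_eq_lintegral_ofReal hh]
  · exact lintegral_mono_ae (hkl.mono fun x hx => ENNReal.ofReal_le_ofReal hx)
  · filter_upwards [hkl] with x hx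
    exact (klFun_nonneg ENNReal.toReal_nonneg).trans hx

/-- The Donsker–Varadhan lower bound for the divergence. -/
lemma donsker_varadhan_le {α : Type*} [MeasurableSpace α] (μ ν : Measure α)
    [IsProbabilityMeasure μ] [IsProbabilityMeasure ν] {g : α → ℝ} (hgμ : Integrable g μ)
    (hgν : Integrable (fun x => Real.exp (g x)) ν) :
    ENNReal.ofReal (∫ x, g x ∂μ - Real.log (∫ x, Real.exp (g x) ∂ν)) ≤ klDiv μ ν := by
  by_cases hfin : klDiv μ ν = ∞
  · simp [hfin]
  obtain ⟨hac, h_int⟩ := klDiv_ne_top_iff.1 hfin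
  -- The inequality is the nonnegativity of the divergence of `μ` from `ν` tilted by `g`.
  have := isProbabilityMeasure_tilted hgν
  have hac' : μ ≪ ν.tilted g := hac.trans (absolutelyContinuous_tilted hgν)
  have h := integral_llr_add_sub_measure_univ_nonneg hac'
    (integrable_llr_tilted_right hac hgμ h_int hgν)
  rw [integral_llr_tilted_right hac hgμ hgν h_int] at h
  simp only [probReal_univ] at h
  rw [klDiv_of_ac_of_integrable hac h_int]
  apply ENNReal.ofReal_le_ofReal
  simp only [probReal_univ]
  linarith

/-- Correlating centred sub-Gaussian features of the input with bounded features of the output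
bounds the mutual information from below. -/
lemma le_klDiv_of_correlated {α β ι : Type*} [MeasurableSpace α] [MeasurableSpace β] [Fintype ι]
    (ρ : Measure (α × β)) [IsProbabilityMeasure ρ] {ψ : ι → α → ℝ} {φ : ι → β → ℝ}
    (hψ : ∀ i, Measurable (ψ i)) (hφ : ∀ i, Measurable (φ i))
    (hψb : ∀ i x, |ψ i x| ≤ 1) (hφb : ∀ i y, |φ i y| ≤ 1) {v Δ : ℝ}
    (hΔ : 0 ≤ Δ) (hΔ2 : Δ ≤ 2)
    (hexp : ∀ c : ι → ℝ, (∀ i, |c i| ≤ 1) →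
      ∫ x, Real.exp (∑ i, c i * ψ i x) ∂ρ.fst ≤ Real.exp (v * ∑ i, c i ^ 2))
    (hcorr : ∀ i, Δ * v ≤ ∫ z, ψ i z.1 * φ i z.2 ∂ρ) (hv : 0 ≤ v) :
    ENNReal.ofReal (Fintype.card ι * v * Δ ^ 2 / 4) ≤ klDiv ρ (ρ.fst.prod ρ.snd) := by
  -- This value maximizes `t * Δ * v - v * t ^ 2`, the gain per feature. The bound `Δ ≤ 2` keeps the
  -- coefficients within the range of `hexp`.
  set t := Δ / 2 with ht
  have ht0 : 0 ≤ t := by positivity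
  have ht1 : t ≤ 1 := by linarith
  let g : α × β → ℝ := fun z => ∑ i, (t * φ i z.2) * ψ i z.1
  have hgm : Measurable g := by
    refine Finset.measurable_sum _ fun i _ => ?_
    exact ((measurable_const.mul ((hφ i).comp measurable_snd)).mul ((hψ i).comp measurable_fst))
  have hgb : ∀ z, |g z| ≤ Fintype.card ι := by
    intro z
    refine (Finset.abs_sum_le_sum_abs _ _).trans ?_
    have : ∀ i ∈ Finset.univ, |(t * φ i z.2) * ψ i z.1| ≤ 1 := by
      intro i _
      rw [abs_mul, abs_mul, abs_of_nonneg ht0]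
      exact mul_le_one₀ (mul_le_one₀ ht1 (abs_nonneg _) (hφb i _)) (abs_nonneg _) (hψb i _)
    refine (Finset.sum_le_sum this).trans ?_
    simp
  have hgi : ∀ (m : Measure (α × β)) [IsProbabilityMeasure m], Integrable g m := fun m _ =>
    Integrable.of_bound hgm.aestronglyMeasurable (Fintype.card ι) (ae_of_all _ hgb)
  have hgei : ∀ (m : Measure (α × β)) [IsProbabilityMeasure m],
      Integrable (fun z => Real.exp (g z)) m := fun m _ => by
    refine Integrable.of_bound (Real.measurable_exp.comp hgm).aestronglyMeasurable
      (Real.exp (Fintype.card ι)) (ae_of_all _ fun z => ?_)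
    rw [Real.norm_eq_abs, abs_of_pos (Real.exp_pos _)]
    exact Real.exp_le_exp.2 ((le_abs_self _).trans (hgb z))
  have hDV := donsker_varadhan_le ρ (ρ.fst.prod ρ.snd) (hgi ρ) (hgei _)
  refine le_trans (ENNReal.ofReal_le_ofReal ?_) hDV
  have h1 : Fintype.card ι * (t * (Δ * v)) ≤ ∫ z, g z ∂ρ := by
    have hi : ∀ i, Integrable (fun z : α × β => ψ i z.1 * φ i z.2) ρ := fun i => by
      refine Integrable.of_bound (((hψ i).comp measurable_fst).mul
        ((hφ i).comp measurable_snd)).aestronglyMeasurable 1 (ae_of_all _ fun z => ?_)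
      rw [Real.norm_eq_abs, abs_mul]
      exact mul_le_one₀ (hψb i _) (abs_nonneg _) (hφb i _)
    have : ∫ z, g z ∂ρ = ∑ i, t * ∫ z, ψ i z.1 * φ i z.2 ∂ρ := by
      simp_rw [← integral_const_mul]
      rw [← integral_finsetSum _ fun i _ => (hi i).const_mul t]
      refine integral_congr_ae (ae_of_all _ fun z => Finset.sum_congr rfl fun i _ => ?_)
      ring
    rw [this, ← nsmul_eq_mul, ← Finset.card_univ, ← Finset.sum_const]
    exact Finset.sum_le_sum fun i _ => mul_le_mul_of_nonneg_left (hcorr i) ht0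
  have h2 : ∫ z, Real.exp (g z) ∂(ρ.fst.prod ρ.snd) ≤
      Real.exp (v * (Fintype.card ι * t ^ 2)) := by
    rw [integral_prod_symm _ (hgei _)]
    -- Under the product of the marginals the output can be frozen. The values `t * φ i y` are then
    -- constants of modulus at most one, so nothing is needed about the dependence among the `φ i`.
    have hb : ∀ y, ∫ x, Real.exp (g (x, y)) ∂ρ.fst ≤
        Real.exp (v * (Fintype.card ι * t ^ 2)) := by
      intro y
      refine (hexp (fun i => t * φ i y) fun i => ?_).trans (Real.exp_le_exp.2 ?_)
      · rw [abs_mul, abs_of_nonneg ht0]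
        exact mul_le_one₀ ht1 (abs_nonneg _) (hφb i _)
      · refine mul_le_mul_of_nonneg_left ?_ hv
        rw [← nsmul_eq_mul, ← Finset.card_univ, ← Finset.sum_const]
        refine Finset.sum_le_sum fun i _ => ?_
        rw [mul_pow]
        have : φ i y ^ 2 ≤ 1 := by
          rw [sq_le_one_iff_abs_le_one]; exact hφb i y
        nlinarith [sq_nonneg t]
    refine (integral_mono_of_nonneg (ae_of_all _ fun y => integral_nonneg fun x =>
      (Real.exp_pos _).le) (integrable_const _) (ae_of_all _ hb)).trans ?_
    simp
  have h3 : 0 < ∫ z, Real.exp (g z) ∂(ρ.fst.prod ρ.snd) := integral_exp_pos (hgei _)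
  have h4 := (Real.log_le_iff_le_exp h3).2 h2
  have : (Fintype.card ι : ℝ) * v * Δ ^ 2 / 4 =
      Fintype.card ι * (t * (Δ * v)) - v * (Fintype.card ι * t ^ 2) := by
    rw [ht]; ring
  linarith

/-- A centred variable bounded by one with variance at most `v` is sub-Gaussian at bounded scale. -/
lemma integral_exp_mul_le {α : Type*} [MeasurableSpace α] (μ : Measure α) [IsProbabilityMeasure μ]
    {ψ : α → ℝ} (hψ : Measurable ψ) (hb : ∀ x, |ψ x| ≤ 1) (h0 : ∫ x, ψ x ∂μ = 0) {v : ℝ}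
    (hv : ∫ x, ψ x ^ 2 ∂μ ≤ v) {c : ℝ} (hc : |c| ≤ 1) :
    ∫ x, Real.exp (c * ψ x) ∂μ ≤ Real.exp (v * c ^ 2) := by
  have hi : Integrable ψ μ := Integrable.of_bound hψ.aestronglyMeasurable 1 (ae_of_all _ hb)
  have hi2 : Integrable (fun x => ψ x ^ 2) μ := by
    refine Integrable.of_bound (hψ.pow_const 2).aestronglyMeasurable 1 (ae_of_all _ fun x => ?_)
    rw [Real.norm_eq_abs, abs_pow]
    exact pow_le_one₀ (abs_nonneg _) (hb x)
  -- This is `exp s ≤ 1 + s + s ^ 2` for `|s| ≤ 1`.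
  have hpt : ∀ x, Real.exp (c * ψ x) ≤ 1 + c * ψ x + c ^ 2 * ψ x ^ 2 := by
    intro x
    have hx : |c * ψ x| ≤ 1 := by
      rw [abs_mul]; exact mul_le_one₀ hc (abs_nonneg _) (hb x)
    have := (abs_le.1 (Real.abs_exp_sub_one_sub_id_le hx)).2
    nlinarith
  calc ∫ x, Real.exp (c * ψ x) ∂μ ≤ ∫ x, (1 + c * ψ x + c ^ 2 * ψ x ^ 2) ∂μ := by
        refine integral_mono_of_nonneg (ae_of_all _ fun x => (Real.exp_pos _).le) ?_
          (ae_of_all _ hpt)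
        exact ((integrable_const _).add (hi.const_mul c)).add (hi2.const_mul _)
    _ = 1 + c ^ 2 * ∫ x, ψ x ^ 2 ∂μ := by
        have hd : Integrable (fun x => 1 + c * ψ x) μ := (integrable_const _).add (hi.const_mul c)
        rw [integral_add hd (hi2.const_mul _),
          integral_add (integrable_const _) (hi.const_mul c), integral_const_mul,
          integral_const_mul, h0]
        simp
    _ ≤ v * c ^ 2 + 1 := by nlinarith [sq_nonneg c]
    _ ≤ Real.exp (v * c ^ 2) := Real.add_one_le_exp _

/-! ### Products of probability measures and densities -/

lemma lintegral_pi_prod {ι : Type*} [Fintype ι] {Ω : ι → Type*} [∀ i, MeasurableSpace (Ω i)]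
    (μ : ∀ i, Measure (Ω i)) [∀ i, IsProbabilityMeasure (μ i)] {f : ∀ i, Ω i → ℝ≥0∞}
    (hf : ∀ i, Measurable (f i)) :
    ∫⁻ x, ∏ i, f i (x i) ∂Measure.pi μ = ∏ i, ∫⁻ x, f i x ∂μ i := by
  have hind : iIndepFun (fun i (ω : ∀ i, Ω i) => f i (ω i)) (Measure.pi μ) :=
    iIndepFun_pi fun i => (hf i).aemeasurable
  rw [lintegral_prod_eq_prod_lintegral_of_indepFun Finset.univ _ hind
    fun i => (hf i).comp (measurable_pi_apply i)]
  refine Finset.prod_congr rfl fun i _ => ?_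
  rw [← (measurePreserving_eval μ i).map_eq, lintegral_map (hf i) (measurable_pi_apply i)]

/-- Applied three times in a nested way (subcarriers, antennas, time), it lifts the one-coordinate
Gaussian translation to the whole noise array. -/
lemma pi_map_eq_withDensity {ι : Type*} [Fintype ι] {Ω : ι → Type*} [∀ i, MeasurableSpace (Ω i)]
    (μ : ∀ i, Measure (Ω i)) [∀ i, IsProbabilityMeasure (μ i)] {T : ∀ i, Ω i → Ω i}
    {f : ∀ i, Ω i → ℝ≥0∞} (hT : ∀ i, Measurable (T i)) (hf : ∀ i, Measurable (f i))
    (h : ∀ i, (μ i).map (T i) = (μ i).withDensity (f i)) :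
    (Measure.pi μ).map (fun x i => T i (x i)) =
      (Measure.pi μ).withDensity fun x => ∏ i, f i (x i) := by
  have hprob : ∀ i, IsProbabilityMeasure ((μ i).map (T i)) := fun i =>
    Measure.isProbabilityMeasure_map (hT i).aemeasurable
  have hmp := Measure.pi_map_pi (μ := μ) (f := T) fun i => (hT i).aemeasurable
  refine hmp.trans (Measure.pi_eq fun s hs => ?_)
  have hind : ∀ x : ∀ i, Ω i, (Set.univ.pi s).indicator (fun x => ∏ i, f i (x i)) x =
      ∏ i, (s i).indicator (f i) (x i) := by
    intro x
    classical
    by_cases hx : x ∈ Set.univ.pi s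
    · rw [Set.indicator_of_mem hx]
      exact Finset.prod_congr rfl fun i _ => (Set.indicator_of_mem (hx i (Set.mem_univ i)) _).symm
    · rw [Set.indicator_of_notMem hx]
      simp only [Set.mem_univ_pi, not_forall] at hx
      obtain ⟨i, hi⟩ := hx
      exact (Finset.prod_eq_zero (Finset.mem_univ i) (Set.indicator_of_notMem hi _)).symm
  rw [withDensity_apply _ (MeasurableSet.univ_pi hs), ← lintegral_indicator (MeasurableSet.univ_pi hs)]
  simp_rw [hind]
  rw [lintegral_pi_prod μ fun i => (hf i).indicator (hs i)]
  refine Finset.prod_congr rfl fun i _ => ?_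
  rw [h i, withDensity_apply _ (hs i), lintegral_indicator (hs i)]

/-! ### The complex Gaussian law -/

instance : IsProbabilityMeasure stdComplexGaussian :=
  Measure.isProbabilityMeasure_map (by
    exact (Complex.measurableEquivRealProd.symm.measurable).aemeasurable)

instance (B N : ℕ) : IsProbabilityMeasure (fadingLaw B N) := by
  unfold fadingLaw; infer_instance

instance (B N L : ℕ) : IsProbabilityMeasure (noiseLaw B N L) := by
  unfold noiseLaw; infer_instance

lemma measurable_complex_mk : Measurable fun p : ℝ × ℝ => (⟨p.1, p.2⟩ : ℂ) :=
  Complex.measurableEquivRealProd.symm.measurable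

lemma lintegral_stdComplexGaussian {F : ℂ → ℝ≥0∞} (hF : Measurable F) :
    ∫⁻ z, F z ∂stdComplexGaussian =
      ∫⁻ x, ∫⁻ y, F ⟨x, y⟩ ∂gaussianReal 0 (1 / 2) ∂gaussianReal 0 (1 / 2) := by
  rw [stdComplexGaussian, lintegral_map hF measurable_complex_mk,
    lintegral_prod (fun p : ℝ × ℝ => F ⟨p.1, p.2⟩) (hF.comp measurable_complex_mk).aemeasurable]

lemma lintegral_gaussianReal_half {F : ℝ → ℝ≥0∞} (hF : Measurable F) :
    ∫⁻ x, F x ∂gaussianReal 0 (1 / 2) = ∫⁻ x, gaussianPDF 0 (1 / 2) x * F x := by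
  rw [gaussianReal_of_var_ne_zero _ (by norm_num),
    lintegral_withDensity_eq_lintegral_mul _ (measurable_gaussianPDF _ _) hF]
  rfl

/-- At variance `1/2` the Gaussian exponent is `-x ^ 2`, so the factor completes the square `-(x -
c) ^ 2`. -/
lemma gaussianPDF_half_mul_exp (c x : ℝ) :
    gaussianPDF 0 (1 / 2) x * ENNReal.ofReal (Real.exp (2 * c * x - c ^ 2)) =
      gaussianPDF 0 (1 / 2) (x - c) := by
  rw [gaussianPDF, gaussianPDF, ← ENNReal.ofReal_mul (gaussianPDFReal_nonneg _ _ _)]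
  congr 1
  simp only [gaussianPDFReal]
  rw [mul_assoc, ← Real.exp_add]
  congr 2
  push_cast
  ring

lemma lintegral_gaussianReal_half_add {F : ℝ → ℝ≥0∞} (hF : Measurable F) (c : ℝ) :
    ∫⁻ x, F (c + x) ∂gaussianReal 0 (1 / 2) =
      ∫⁻ x, F x * ENNReal.ofReal (Real.exp (2 * c * x - c ^ 2)) ∂gaussianReal 0 (1 / 2) := by
  rw [lintegral_gaussianReal_half (by fun_prop), lintegral_gaussianReal_half (by fun_prop)]
  simp_rw [mul_comm (F _) (ENNReal.ofReal _), ← mul_assoc, gaussianPDF_half_mul_exp]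
  rw [← lintegral_add_left_eq_self (fun x => gaussianPDF 0 (1 / 2) (x - c) * F x) c]
  simp

/-- The Gaussian integral of the exponential of a quadratic polynomial. -/
lemma lintegral_exp_quadratic_gaussianReal_half {s : ℝ} (hs : 0 ≤ s) (t : ℝ) :
    ∫⁻ x, ENNReal.ofReal (Real.exp (2 * t * x - s * x ^ 2)) ∂gaussianReal 0 (1 / 2) =
      ENNReal.ofReal ((√(1 + s))⁻¹ * Real.exp (t ^ 2 / (1 + s))) := by
  have h1 : 0 < 1 + s := by linarith
  -- Completing the square in `-(1 + s) x ^ 2 + 2 t x` leaves a Gaussian density of mean `t / (1 +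
  -- s)` and this variance.
  set v : ℝ≥0 := ⟨1 / (2 * (1 + s)), by positivity⟩ with hv
  have hvr : (v : ℝ) = 1 / (2 * (1 + s)) := rfl
  have hv0 : v ≠ 0 := by
    rw [ne_eq, ← NNReal.coe_eq_zero, hvr]; positivity
  rw [lintegral_gaussianReal_half (by fun_prop)]
  have key : ∀ x, gaussianPDF 0 (1 / 2) x * ENNReal.ofReal (Real.exp (2 * t * x - s * x ^ 2)) =
      ENNReal.ofReal ((√(1 + s))⁻¹ * Real.exp (t ^ 2 / (1 + s))) *
        gaussianPDF (t / (1 + s)) v x := by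
    intro x
    rw [gaussianPDF, gaussianPDF, ← ENNReal.ofReal_mul (gaussianPDFReal_nonneg _ _ _),
      ← ENNReal.ofReal_mul (by positivity)]
    congr 1
    simp only [gaussianPDFReal, hvr]
    have hsq : √(2 * Real.pi * (1 / (2 * (1 + s)))) = √Real.pi * (√(1 + s))⁻¹ := by
      rw [← Real.sqrt_inv, ← Real.sqrt_mul Real.pi_pos.le]
      congr 1; field_simp
    have hsq' : √(2 * Real.pi * ((1 / 2 : ℝ≥0) : ℝ)) = √Real.pi := by
      congr 1; push_cast; ring
    have h2 : √(1 + s) ≠ 0 := (Real.sqrt_pos.2 h1).ne'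
    rw [hsq, hsq', mul_inv, inv_inv, mul_assoc, ← Real.exp_add]
    have : (√(1 + s))⁻¹ * Real.exp (t ^ 2 / (1 + s)) *
        ((√Real.pi)⁻¹ * √(1 + s) * Real.exp (-(x - t / (1 + s)) ^ 2 / (2 * (1 / (2 * (1 + s)))))) =
        (√Real.pi)⁻¹ * (Real.exp (t ^ 2 / (1 + s)) *
          Real.exp (-(x - t / (1 + s)) ^ 2 / (2 * (1 / (2 * (1 + s)))))) := by
      field_simp
    rw [this, ← Real.exp_add]
    congr 2
    push_cast
    field_simp
    ring
  simp_rw [key]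
  rw [lintegral_const_mul _ (measurable_gaussianPDF _ _), lintegral_gaussianPDF_eq_one _ hv0,
    mul_one]

lemma ofReal_exp_add (a b : ℝ) : ENNReal.ofReal (Real.exp (a + b)) =
    ENNReal.ofReal (Real.exp a) * ENNReal.ofReal (Real.exp b) := by
  rw [Real.exp_add, ENNReal.ofReal_mul (Real.exp_pos _).le]

/-- The likelihood ratio of a translated complex Gaussian. -/
lemma stdComplexGaussian_map_add (c : ℂ) :
    stdComplexGaussian.map (fun z => c + z) = stdComplexGaussian.withDensity fun z =>
      ENNReal.ofReal (Real.exp (2 * (star c * z).re - ‖c‖ ^ 2)) := by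
  have hdm : Measurable fun z : ℂ => ENNReal.ofReal (Real.exp (2 * (star c * z).re - ‖c‖ ^ 2)) := by
    fun_prop
  refine Measure.ext_of_lintegral _ fun F hF => ?_
  rw [lintegral_map hF (by fun_prop), lintegral_withDensity_eq_lintegral_mul _ hdm hF,
    lintegral_stdComplexGaussian (by fun_prop), lintegral_stdComplexGaussian (hdm.mul hF)]
  have hin : ∀ x : ℝ, ∫⁻ y, F (c + ⟨x, y⟩) ∂gaussianReal 0 (1 / 2) =
      ∫⁻ y, F ⟨c.re + x, y⟩ * ENNReal.ofReal (Real.exp (2 * c.im * y - c.im ^ 2))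
        ∂gaussianReal 0 (1 / 2) := by
    intro x
    have hm : Measurable fun y : ℝ => F ⟨c.re + x, y⟩ :=
      hF.comp (measurable_complex_mk.comp (measurable_const.prodMk measurable_id))
    rw [← lintegral_gaussianReal_half_add hm]
    rfl
  simp_rw [hin]
  have hm2 : Measurable fun x : ℝ =>
      ∫⁻ y, F ⟨x, y⟩ * ENNReal.ofReal (Real.exp (2 * c.im * y - c.im ^ 2))
        ∂gaussianReal 0 (1 / 2) := by
    refine Measurable.lintegral_prod_right' (f := fun p : ℝ × ℝ =>
      F ⟨p.1, p.2⟩ * ENNReal.ofReal (Real.exp (2 * c.im * p.2 - c.im ^ 2))) ?_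
    exact (hF.comp measurable_complex_mk).mul (by fun_prop)
  rw [lintegral_gaussianReal_half_add hm2]
  refine lintegral_congr fun x => ?_
  have hm : Measurable fun y : ℝ => F ⟨x, y⟩ :=
    hF.comp (measurable_complex_mk.comp (measurable_const.prodMk measurable_id))
  have hme : Measurable fun y : ℝ =>
      F ⟨x, y⟩ * ENNReal.ofReal (Real.exp (2 * c.im * y - c.im ^ 2)) := hm.mul (by fun_prop)
  rw [← lintegral_mul_const _ hme]
  refine lintegral_congr fun y => ?_
  simp only [Pi.mul_apply]
  rw [mul_assoc, ← ofReal_exp_add, mul_comm]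
  congr 3
  rw [← Complex.normSq_eq_norm_sq, Complex.normSq_apply]
  simp
  ring

/-- The complex Gaussian integral of the exponential of a quadratic polynomial. -/
lemma lintegral_exp_quadratic_stdComplexGaussian {s : ℝ} (hs : 0 ≤ s) (w : ℂ) :
    ∫⁻ h, ENNReal.ofReal (Real.exp (2 * (star h * w).re - s * ‖h‖ ^ 2)) ∂stdComplexGaussian =
      ENNReal.ofReal ((1 + s)⁻¹ * Real.exp (‖w‖ ^ 2 / (1 + s))) := by
  have h1 : 0 < 1 + s := by linarith
  rw [lintegral_stdComplexGaussian (by fun_prop)]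
  have hsplit : ∀ x y : ℝ, ENNReal.ofReal (Real.exp (2 * (star (⟨x, y⟩ : ℂ) * w).re
      - s * ‖(⟨x, y⟩ : ℂ)‖ ^ 2)) =
      ENNReal.ofReal (Real.exp (2 * w.re * x - s * x ^ 2)) *
        ENNReal.ofReal (Real.exp (2 * w.im * y - s * y ^ 2)) := by
    intro x y
    rw [← ofReal_exp_add]
    congr 2
    rw [← Complex.normSq_eq_norm_sq, Complex.normSq_apply]
    simp
    ring
  simp_rw [hsplit]
  simp_rw [lintegral_const_mul _ (show Measurable fun y : ℝ =>
    ENNReal.ofReal (Real.exp (2 * w.im * y - s * y ^ 2)) by fun_prop)]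
  rw [lintegral_mul_const _ (by fun_prop), lintegral_exp_quadratic_gaussianReal_half hs,
    lintegral_exp_quadratic_gaussianReal_half hs, ← ENNReal.ofReal_mul (by positivity)]
  congr 1
  have e1 : (1 + s)⁻¹ = (√(1 + s))⁻¹ * (√(1 + s))⁻¹ := by
    rw [← mul_inv, Real.mul_self_sqrt h1.le]
  have e2 : Real.exp (‖w‖ ^ 2 / (1 + s)) =
      Real.exp (w.re ^ 2 / (1 + s)) * Real.exp (w.im ^ 2 / (1 + s)) := by
    rw [← Real.exp_add, ← Complex.normSq_eq_norm_sq, Complex.normSq_apply]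
    congr 1; ring
  rw [e1, e2]; ring

/-! ### The density of the channel -/

/-- The matched-filter output of antenna `n` on subcarrier `b`. -/
def matchedFilter {B N L : ℕ} (x : Input B L) (y : Output B N L) (b : Fin B) (n : Fin N) : ℂ :=
  ∑ l, y b n l * x b l

/-- The density of the channel output, given the input `x`, with respect to the noise law. -/
def channelDensity {B N L : ℕ} (x : Input B L) (y : Output B N L) : ℝ≥0∞ :=
  ∏ b, ∏ n, ENNReal.ofReal ((1 + ∑ l, ‖x b l‖ ^ 2)⁻¹ *
    Real.exp (‖matchedFilter x y b n‖ ^ 2 / (1 + ∑ l, ‖x b l‖ ^ 2)))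

lemma measurable_matchedFilter {Ω : Type*} [MeasurableSpace Ω] {B N L : ℕ} {x : Ω → Input B L}
    {y : Ω → Output B N L} (hx : Measurable x) (hy : Measurable y) (b : Fin B) (n : Fin N) :
    Measurable fun ω => matchedFilter (x ω) (y ω) b n := by
  unfold matchedFilter
  fun_prop

lemma measurable_channelDensity {Ω : Type*} [MeasurableSpace Ω] {B N L : ℕ} {x : Ω → Input B L}
    {y : Ω → Output B N L} (hx : Measurable x) (hy : Measurable y) :
    Measurable fun ω => channelDensity (x ω) (y ω) := by
  unfold channelDensity
  refine Finset.measurable_fun_prod _ fun b _ => Finset.measurable_fun_prod _ fun n _ => ?_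
  have := measurable_matchedFilter hx hy b n
  fun_prop

lemma measurable_channelOutput {Ω : Type*} [MeasurableSpace Ω] {B N L : ℕ} {x : Ω → Input B L}
    {h : Ω → Fading B N} {z : Ω → Output B N L} (hx : Measurable x) (hh : Measurable h)
    (hz : Measurable z) : Measurable fun ω => channelOutput (x ω) (h ω) (z ω) := by
  unfold channelOutput
  refine measurable_pi_lambda _ fun b => measurable_pi_lambda _ fun n =>
    measurable_pi_lambda _ fun l => ?_
  fun_prop

lemma noiseLaw_map_add {B N L : ℕ} (c : Output B N L) :
    (noiseLaw B N L).map (fun z b n l => c b n l + z b n l) =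
      (noiseLaw B N L).withDensity fun z => ∏ b, ∏ n, ∏ l,
        ENNReal.ofReal (Real.exp (2 * (star (c b n l) * z b n l).re - ‖c b n l‖ ^ 2)) := by
  unfold noiseLaw
  refine pi_map_eq_withDensity (T := fun b (z : Fin N → Fin L → ℂ) n l => c b n l + z n l)
    (f := fun b (z : Fin N → Fin L → ℂ) => ∏ n, ∏ l, ENNReal.ofReal
      (Real.exp (2 * (star (c b n l) * z n l).re - ‖c b n l‖ ^ 2))) _ ?_ ?_ fun b => ?_
  · intro b; fun_prop
  · intro b; fun_prop
  refine pi_map_eq_withDensity (T := fun n (z : Fin L → ℂ) l => c b n l + z l)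
    (f := fun n (z : Fin L → ℂ) => ∏ l, ENNReal.ofReal
      (Real.exp (2 * (star (c b n l) * z l).re - ‖c b n l‖ ^ 2))) _ ?_ ?_ fun n => ?_
  · intro b; fun_prop
  · intro b; fun_prop
  refine pi_map_eq_withDensity (T := fun l (z : ℂ) => c b n l + z)
    (f := fun l (z : ℂ) => ENNReal.ofReal
      (Real.exp (2 * (star (c b n l) * z).re - ‖c b n l‖ ^ 2))) _ ?_ ?_ fun l => ?_
  · intro b; fun_prop
  · intro b; fun_prop
  exact stdComplexGaussian_map_add _

/-- Change of variables from fading and noise to the channel output. -/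
lemma lintegral_channelOutput {B N L : ℕ} (x : Input B L) {F : Output B N L → ℝ≥0∞}
    (hF : Measurable F) :
    ∫⁻ p, F (channelOutput x p.1 p.2) ∂((fadingLaw B N).prod (noiseLaw B N L)) =
      ∫⁻ y, F y * channelDensity x y ∂noiseLaw B N L := by
  have hco : Measurable fun p : Fading B N × Output B N L => channelOutput x p.1 p.2 :=
    measurable_channelOutput measurable_const measurable_fst measurable_snd
  rw [lintegral_prod (fun p : Fading B N × Output B N L => F (channelOutput x p.1 p.2))
    (hF.comp hco).aemeasurable]
  let s : Fin B → ℝ := fun b => ∑ l, ‖x b l‖ ^ 2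
  have hs : ∀ b, 0 ≤ s b := fun b => Finset.sum_nonneg fun l _ => by positivity
  -- Likelihood ratio at fixed fading: a pure translation of the noise. Its logarithm is quadratic
  -- in each coefficient separately, so after exchanging the integrals the fading integrates out one
  -- antenna at a time.
  let D : Fading B N → Output B N L → ℝ≥0∞ := fun h y => ∏ b, ∏ n, ENNReal.ofReal (Real.exp
    (2 * (star (h b n) * matchedFilter x y b n).re - s b * ‖h b n‖ ^ 2))
  have hDm : Measurable fun p : Fading B N × Output B N L => D p.1 p.2 := by
    refine Finset.measurable_fun_prod _ fun b _ => Finset.measurable_fun_prod _ fun n _ => ?_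
    have : Measurable fun p : Fading B N × Output B N L => matchedFilter x p.2 b n :=
      measurable_matchedFilter measurable_const measurable_snd b n
    fun_prop
  have hstep : ∀ h : Fading B N, ∫⁻ z, F (channelOutput x h z) ∂noiseLaw B N L =
      ∫⁻ y, F y * D h y ∂noiseLaw B N L := by
    intro h
    have hm : Measurable fun (z : Output B N L) (b : Fin B) (n : Fin N) (l : Fin L) =>
        h b n * star (x b l) + z b n l := by fun_prop
    have := lintegral_map (μ := noiseLaw B N L) hF hm
    rw [noiseLaw_map_add fun b n l => h b n * star (x b l)] at this
    rw [show (fun z => F (channelOutput x h z)) = fun z => F (fun b n l =>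
      h b n * star (x b l) + z b n l) from rfl, ← this,
      lintegral_withDensity_eq_lintegral_mul _ (by fun_prop) hF]
    refine lintegral_congr fun y => ?_
    rw [Pi.mul_apply, mul_comm]
    congr 1
    refine Finset.prod_congr rfl fun b _ => Finset.prod_congr rfl fun n _ => ?_
    rw [← ENNReal.ofReal_prod_of_nonneg fun _ _ => (Real.exp_pos _).le, ← Real.exp_sum]
    congr 2
    rw [Finset.sum_sub_distrib, ← Finset.mul_sum, ← Complex.re_sum, matchedFilter, Finset.mul_sum,
      Finset.sum_mul]
    congr 1
    · congr 2
      refine Finset.sum_congr rfl fun l _ => ?_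
      simp only [star_mul, star_star]
      ring
    · refine Finset.sum_congr rfl fun l _ => ?_
      rw [norm_mul, norm_star, mul_pow, mul_comm]
  simp_rw [hstep]
  rw [lintegral_lintegral_swap]
  swap
  · exact ((hF.comp measurable_snd).mul hDm).aemeasurable
  refine lintegral_congr fun y => ?_
  have hDy : Measurable fun h => D h y := by
    simp only [D]
    fun_prop
  rw [lintegral_const_mul _ hDy]
  congr 1
  unfold fadingLaw
  have hb := lintegral_pi_prod (fun _ : Fin B => Measure.pi fun _ : Fin N => stdComplexGaussian)
    (f := fun b (h : Fin N → ℂ) => ∏ n, ENNReal.ofReal (Real.exp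
      (2 * (star (h n) * matchedFilter x y b n).re - s b * ‖h n‖ ^ 2))) (fun b => by fun_prop)
  rw [hb, channelDensity]
  refine Finset.prod_congr rfl fun b _ => ?_
  have hn := lintegral_pi_prod (fun _ : Fin N => stdComplexGaussian)
    (f := fun n (h : ℂ) => ENNReal.ofReal (Real.exp
      (2 * (star h * matchedFilter x y b n).re - s b * ‖h‖ ^ 2))) (fun b => by fun_prop)
  rw [hn]
  exact Finset.prod_congr rfl fun n _ => lintegral_exp_quadratic_stdComplexGaussian (hs b) _

/-- The joint law of a random parameter and the channel output driven by it. -/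
lemma map_channelOutput_eq_withDensity {Ω : Type*} [MeasurableSpace Ω] {B N L : ℕ}
    (p : Measure Ω) [SFinite p] {enc : Ω → Input B L} (henc : Measurable enc) :
    (p.prod ((fadingLaw B N).prod (noiseLaw B N L))).map
      (fun ω => (ω.1, channelOutput (enc ω.1) ω.2.1 ω.2.2)) =
    (p.prod (noiseLaw B N L)).withDensity fun q => channelDensity (enc q.1) q.2 := by
  have hm : Measurable fun ω : Ω × Fading B N × Output B N L =>
      (ω.1, channelOutput (enc ω.1) ω.2.1 ω.2.2) :=
    measurable_fst.prodMk (measurable_channelOutput (henc.comp measurable_fst)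
      (measurable_fst.comp measurable_snd) (measurable_snd.comp measurable_snd))
  have hd : Measurable fun q : Ω × Output B N L => channelDensity (enc q.1) q.2 :=
    measurable_channelDensity (henc.comp measurable_fst) measurable_snd
  refine Measure.ext_of_lintegral _ fun F hF => ?_
  rw [lintegral_map hF hm, lintegral_withDensity_eq_lintegral_mul _ hd hF,
    lintegral_prod (fun ω : Ω × Fading B N × Output B N L =>
      F (ω.1, channelOutput (enc ω.1) ω.2.1 ω.2.2)) (hF.comp hm).aemeasurable,
    lintegral_prod _ (hd.mul hF).aemeasurable]
  refine lintegral_congr fun ω => ?_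
  dsimp only
  rw [lintegral_channelOutput (enc ω) (F := fun y => F (ω, y))
    (hF.comp measurable_prodMk_left)]
  refine lintegral_congr fun y => ?_
  rw [Pi.mul_apply, mul_comm]

/-! ### Second moments -/

/-- The cross term factors into a product of means, so centring one of the two variables is enough.
-/
lemma integral_sq_add_prod {α β : Type*} [MeasurableSpace α] [MeasurableSpace β] (μ : Measure α)
    (ν : Measure β) [IsProbabilityMeasure μ] [IsProbabilityMeasure ν] {X : α → ℝ} {Y : β → ℝ}
    (hX : MemLp X 2 μ) (hY : MemLp Y 2 ν) (h0 : ∫ x, X x ∂μ = 0) :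
    ∫ p, (X p.1 + Y p.2) ^ 2 ∂μ.prod ν = ∫ x, X x ^ 2 ∂μ + ∫ y, Y y ^ 2 ∂ν := by
  have hX1 : Integrable X μ := hX.integrable one_le_two
  have hY1 : Integrable Y ν := hY.integrable one_le_two
  have e1 : ∫ p, X p.1 ^ 2 ∂μ.prod ν = ∫ x, X x ^ 2 ∂μ := by
    simpa using integral_fun_fst (ν := ν) (μ := μ) fun x => X x ^ 2
  have e2 : ∫ p, Y p.2 ^ 2 ∂μ.prod ν = ∫ y, Y y ^ 2 ∂ν := by
    simpa using integral_fun_snd (ν := ν) (μ := μ) fun y => Y y ^ 2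
  have e3 : ∫ p, X p.1 * Y p.2 ∂μ.prod ν = 0 := by
    rw [integral_prod_mul, h0, zero_mul]
  have i1 : Integrable (fun p : α × β => X p.1 ^ 2) (μ.prod ν) := hX.integrable_sq.comp_fst ν
  have i2 : Integrable (fun p : α × β => Y p.2 ^ 2) (μ.prod ν) := hY.integrable_sq.comp_snd μ
  have i3 : Integrable (fun p : α × β => X p.1 * Y p.2) (μ.prod ν) := hX1.mul_prod hY1
  calc ∫ p, (X p.1 + Y p.2) ^ 2 ∂μ.prod ν
      = ∫ p, (X p.1 ^ 2 + (2 * (X p.1 * Y p.2) + Y p.2 ^ 2)) ∂μ.prod ν := by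
        congr 1; ext p; ring
    _ = _ := by
        have i4 : Integrable (fun p : α × β => 2 * (X p.1 * Y p.2) + Y p.2 ^ 2) (μ.prod ν) :=
          (i3.const_mul 2).add i2
        rw [integral_add i1 i4, integral_add (i3.const_mul 2) i2, integral_const_mul, e1, e2, e3]
        ring

lemma integral_sq_sum_pi {ι Ω : Type*} [Fintype ι] [MeasurableSpace Ω] (μ : Measure Ω)
    [IsProbabilityMeasure μ] {X : ι → Ω → ℝ} (hX : ∀ i, MemLp (X i) 2 μ)
    (h0 : ∀ i, ∫ x, X i x ∂μ = 0) :
    ∫ ω, (∑ i, X i (ω i)) ^ 2 ∂Measure.pi (fun _ : ι => μ) = ∑ i, ∫ x, X i x ^ 2 ∂μ := by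
  have hmp := fun i => measurePreserving_eval (fun _ : ι => μ) i
  have hLp : ∀ i, MemLp (fun ω : ι → Ω => X i (ω i)) 2 (Measure.pi fun _ => μ) := fun i =>
    (hX i).comp_measurePreserving (hmp i)
  have hmean : ∀ i, ∫ ω : ι → Ω, X i (ω i) ∂Measure.pi (fun _ => μ) = 0 := fun i => by
    rw [← h0 i]
    exact integral_comp_eval (hX i).aestronglyMeasurable
  have hv := variance_sum_pi (μ := fun _ : ι => μ) hX
  rw [variance_of_integral_eq_zero] at hv
  · simp only [Finset.sum_apply] at hv
    rw [hv]
    exact Finset.sum_congr rfl fun i _ =>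
      variance_of_integral_eq_zero (hX i).aestronglyMeasurable.aemeasurable (h0 i)
  · exact (memLp_finsetSum' _ fun i _ => hLp i).aestronglyMeasurable.aemeasurable
  · simp only [Finset.sum_apply]
    rw [integral_finsetSum _ fun i _ => (hLp i).integrable one_le_two]
    exact Finset.sum_eq_zero fun i _ => hmean i

lemma measurePreserving_re : MeasurePreserving Complex.re stdComplexGaussian
    (gaussianReal 0 (1 / 2)) := by
  refine ⟨Complex.measurable_re, ?_⟩
  rw [stdComplexGaussian, Measure.map_map Complex.measurable_re measurable_complex_mk]
  exact (measurePreserving_fst (μ := gaussianReal 0 (1 / 2)) (ν := gaussianReal 0 (1 / 2))).map_eq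

lemma measurePreserving_im : MeasurePreserving Complex.im stdComplexGaussian
    (gaussianReal 0 (1 / 2)) := by
  refine ⟨Complex.measurable_im, ?_⟩
  rw [stdComplexGaussian, Measure.map_map Complex.measurable_im measurable_complex_mk]
  exact (measurePreserving_snd (μ := gaussianReal 0 (1 / 2)) (ν := gaussianReal 0 (1 / 2))).map_eq

lemma memLp_re (p : ℝ≥0) : MemLp Complex.re p stdComplexGaussian :=
  (memLp_id_gaussianReal p).comp_measurePreserving measurePreserving_re

lemma memLp_im (p : ℝ≥0) : MemLp Complex.im p stdComplexGaussian :=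
  (memLp_id_gaussianReal p).comp_measurePreserving measurePreserving_im

lemma memLp_stdComplexGaussian (p : ℝ≥0) : MemLp (fun z : ℂ => z) p stdComplexGaussian := by
  refine ((memLp_re p).norm.add (memLp_im p).norm).mono' measurable_id.aestronglyMeasurable
    (ae_of_all _ fun z => ?_)
  exact Complex.norm_le_abs_re_add_abs_im z

lemma memLp_re_mul (α : ℂ) (p : ℝ≥0) :
    MemLp (fun z : ℂ => (α * z).re) p stdComplexGaussian :=
  ((memLp_stdComplexGaussian p).const_mul α).re

lemma integral_re_sq : ∫ z, z.re ^ 2 ∂stdComplexGaussian = 1 / 2 := by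
  have h := variance_fun_id_gaussianReal (μ := 0) (v := 1 / 2)
  rw [variance_of_integral_eq_zero aemeasurable_id' integral_id_gaussianReal] at h
  have := integral_map (μ := stdComplexGaussian) measurePreserving_re.measurable.aemeasurable
    (f := fun x : ℝ => x ^ 2) (by fun_prop)
  rw [measurePreserving_re.map_eq] at this
  rw [← this, h]; norm_num

lemma integral_im_sq : ∫ z, z.im ^ 2 ∂stdComplexGaussian = 1 / 2 := by
  have h := variance_fun_id_gaussianReal (μ := 0) (v := 1 / 2)
  rw [variance_of_integral_eq_zero aemeasurable_id' integral_id_gaussianReal] at h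
  have := integral_map (μ := stdComplexGaussian) measurePreserving_im.measurable.aemeasurable
    (f := fun x : ℝ => x ^ 2) (by fun_prop)
  rw [measurePreserving_im.map_eq] at this
  rw [← this, h]; norm_num

lemma integral_re : ∫ z, z.re ∂stdComplexGaussian = 0 := by
  have := integral_map (μ := stdComplexGaussian) measurePreserving_re.measurable.aemeasurable
    (f := fun x : ℝ => x) (by fun_prop)
  rw [measurePreserving_re.map_eq, integral_id_gaussianReal] at this
  exact this.symm

lemma integral_im : ∫ z, z.im ∂stdComplexGaussian = 0 := by
  have := integral_map (μ := stdComplexGaussian) measurePreserving_im.measurable.aemeasurable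
    (f := fun x : ℝ => x) (by fun_prop)
  rw [measurePreserving_im.map_eq, integral_id_gaussianReal] at this
  exact this.symm

lemma integral_re_mul_im : ∫ z, z.re * z.im ∂stdComplexGaussian = 0 := by
  rw [stdComplexGaussian, integral_map measurable_complex_mk.aemeasurable (by fun_prop)]
  have := integral_prod_mul (μ := gaussianReal 0 (1 / 2)) (ν := gaussianReal 0 (1 / 2))
    (fun x : ℝ => x) (fun x : ℝ => x)
  simpa using this

lemma integral_re_mul (α : ℂ) : ∫ z, (α * z).re ∂stdComplexGaussian = 0 := by
  have h1 : Integrable Complex.re stdComplexGaussian := (memLp_re 1).integrable (by simp)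
  have h2 : Integrable Complex.im stdComplexGaussian := (memLp_im 1).integrable (by simp)
  simp only [Complex.mul_re]
  rw [integral_sub (h1.const_mul _) (h2.const_mul _), integral_const_mul, integral_const_mul,
    integral_re, integral_im]
  simp

lemma integral_re_mul_sq (α : ℂ) :
    ∫ z, (α * z).re ^ 2 ∂stdComplexGaussian = ‖α‖ ^ 2 / 2 := by
  have h1 : Integrable (fun z : ℂ => z.re ^ 2) stdComplexGaussian := (memLp_re 2).integrable_sq
  have h2 : Integrable (fun z : ℂ => z.im ^ 2) stdComplexGaussian := (memLp_im 2).integrable_sq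
  have h3 : Integrable (fun z : ℂ => z.re * z.im) stdComplexGaussian :=
    (show MemLp Complex.re 2 _ from memLp_re 2).integrable_mul
      (show MemLp Complex.im 2 _ from memLp_im 2)
  have e : ∀ z : ℂ, (α * z).re ^ 2 =
      α.re ^ 2 * z.re ^ 2 + (-2 * α.re * α.im * (z.re * z.im) + α.im ^ 2 * z.im ^ 2) := by
    intro z; rw [Complex.mul_re]; ring
  simp_rw [e]
  have h4 : Integrable (fun z : ℂ => -2 * α.re * α.im * (z.re * z.im) + α.im ^ 2 * z.im ^ 2)
    stdComplexGaussian := (h3.const_mul _).add (h2.const_mul _)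
  rw [integral_add (h1.const_mul _) h4, integral_add (h3.const_mul _) (h2.const_mul _),
    integral_const_mul, integral_const_mul, integral_const_mul, integral_re_sq, integral_im_sq,
    integral_re_mul_im, ← Complex.normSq_eq_norm_sq, Complex.normSq_apply]
  ring

/-! ### Moments at a single antenna -/

/-- The law of the fading coefficient and noise of a single antenna. -/
def rowLaw (L : ℕ) : Measure (ℂ × (Fin L → ℂ)) :=
  stdComplexGaussian.prod (Measure.pi fun _ => stdComplexGaussian)

instance (L : ℕ) : IsProbabilityMeasure (rowLaw L) := by unfold rowLaw; infer_instance

lemma memLp_sum_re {L : ℕ} (c : Fin L → ℂ) (p : ℝ≥0) :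
    MemLp (fun z : Fin L → ℂ => ∑ l, (c l * z l).re) p (Measure.pi fun _ => stdComplexGaussian) :=
  memLp_finsetSum _ fun l _ => (memLp_re_mul (c l) p).comp_measurePreserving
    (measurePreserving_eval (fun _ : Fin L => stdComplexGaussian) l)

lemma memLp_rowLaw_re {L : ℕ} (α : ℂ) (c : Fin L → ℂ) (p : ℝ≥0) :
    MemLp (fun r : ℂ × (Fin L → ℂ) => (α * r.1 + ∑ l, c l * r.2 l).re) p (rowLaw L) := by
  have h1 : MemLp (fun r : ℂ × (Fin L → ℂ) => (α * r.1).re) p (rowLaw L) :=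
    (memLp_re_mul α p).comp_measurePreserving measurePreserving_fst
  have h2 : MemLp (fun r : ℂ × (Fin L → ℂ) => ∑ l, (c l * r.2 l).re) p (rowLaw L) :=
    (memLp_sum_re c p).comp_measurePreserving measurePreserving_snd
  refine (h1.add h2).ae_eq (ae_of_all _ fun r => ?_)
  simp only [Pi.add_apply, Complex.add_re, Complex.re_sum]

lemma integral_rowLaw_re_sq {L : ℕ} (α : ℂ) (c : Fin L → ℂ) :
    ∫ r, (α * r.1 + ∑ l, c l * r.2 l).re ^ 2 ∂rowLaw L =
      (‖α‖ ^ 2 + ∑ l, ‖c l‖ ^ 2) / 2 := by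
  have h := integral_sq_add_prod stdComplexGaussian (Measure.pi fun _ : Fin L => stdComplexGaussian)
    (memLp_re_mul α 2) (memLp_sum_re c 2) (integral_re_mul α)
  have h2 := integral_sq_sum_pi stdComplexGaussian (fun l => memLp_re_mul (c l) 2)
    (fun l => integral_re_mul (c l))
  rw [h2] at h
  simp only [integral_re_mul_sq] at h
  simp only [Complex.add_re, Complex.re_sum]
  rw [rowLaw, h, ← Finset.sum_div]
  ring

/-- Writing the imaginary part as the real part of `-i w` reduces complex second moments to those of
real parts of linear forms, with rotated coefficients. -/
lemma norm_sq_eq_re_sq_add (w : ℂ) : ‖w‖ ^ 2 = w.re ^ 2 + (-Complex.I * w).re ^ 2 := by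
  rw [← Complex.normSq_eq_norm_sq, Complex.normSq_apply]
  simp
  ring

lemma integrable_rowLaw_norm_sq {L : ℕ} (α : ℂ) (c : Fin L → ℂ) :
    Integrable (fun r => ‖α * r.1 + ∑ l, c l * r.2 l‖ ^ 2) (rowLaw L) := by
  have h1 := (memLp_rowLaw_re α c 2).integrable_sq
  have h2 := (memLp_rowLaw_re (-Complex.I * α) (fun l => -Complex.I * c l) 2).integrable_sq
  refine (h1.add h2).congr (ae_of_all _ fun r => ?_)
  simp only [Pi.add_apply]
  rw [norm_sq_eq_re_sq_add, mul_add, Finset.mul_sum]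
  simp only [mul_assoc]

lemma integral_rowLaw_norm_sq {L : ℕ} (α : ℂ) (c : Fin L → ℂ) :
    ∫ r, ‖α * r.1 + ∑ l, c l * r.2 l‖ ^ 2 ∂rowLaw L = ‖α‖ ^ 2 + ∑ l, ‖c l‖ ^ 2 := by
  have h1 := (memLp_rowLaw_re α c 2).integrable_sq
  have h2 := (memLp_rowLaw_re (-Complex.I * α) (fun l => -Complex.I * c l) 2).integrable_sq
  have e : ∀ r : ℂ × (Fin L → ℂ), ‖α * r.1 + ∑ l, c l * r.2 l‖ ^ 2 =
      (α * r.1 + ∑ l, c l * r.2 l).re ^ 2 +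
        (-Complex.I * α * r.1 + ∑ l, -Complex.I * c l * r.2 l).re ^ 2 := by
    intro r
    rw [norm_sq_eq_re_sq_add, mul_add, Finset.mul_sum]
    simp only [mul_assoc]
  simp_rw [e]
  rw [integral_add h1 h2, integral_rowLaw_re_sq, integral_rowLaw_re_sq]
  simp

/-- Fading and noise of antenna `n` on subcarrier `b` follow the single-antenna law. -/
lemma measurePreserving_row {B N : ℕ} (L : ℕ) (b : Fin B) (n : Fin N) :
    MeasurePreserving (fun p : Fading B N × Output B N L => (p.1 b n, p.2 b n))
      ((fadingLaw B N).prod (noiseLaw B N L)) (rowLaw L) := by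
  have h1 : MeasurePreserving (fun h : Fading B N => h b n) (fadingLaw B N) stdComplexGaussian :=
    (measurePreserving_eval (fun _ : Fin N => stdComplexGaussian) n).comp
      (measurePreserving_eval
        (fun _ : Fin B => Measure.pi fun _ : Fin N => stdComplexGaussian) b)
  have h2 : MeasurePreserving (fun z : Output B N L => z b n) (noiseLaw B N L)
      (Measure.pi fun _ => stdComplexGaussian) :=
    (measurePreserving_eval
      (fun _ : Fin N => Measure.pi fun _ : Fin L => stdComplexGaussian) n).comp
      (measurePreserving_eval (fun _ : Fin B => Measure.pi fun _ : Fin N =>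
        Measure.pi fun _ : Fin L => stdComplexGaussian) b)
  exact h1.prod h2

/-! ### Upper bound for the information of energy detection -/

/-- The weights of a heavy-tailed prior on `ℕ` with all but `δ` of its mass at zero. -/
def gridWeight (δ : ℝ) : ℕ → ℝ
  | 0 => 1 - δ
  | k + 1 => δ / ((k + 1) * (k + 2))

lemma gridWeight_pos {δ : ℝ} (h0 : 0 < δ) (h1 : δ < 1) (k : ℕ) : 0 < gridWeight δ k := by
  cases k with
  | zero => simp only [gridWeight]; linarith
  | succ k => simp only [gridWeight]; positivity

lemma gridWeight_le_one {δ : ℝ} (h0 : 0 < δ) (h1 : δ < 1) (k : ℕ) : gridWeight δ k ≤ 1 := by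
  cases k with
  | zero => simp only [gridWeight]; linarith
  | succ k =>
    simp only [gridWeight]
    rw [div_le_one (by positivity)]
    have : (0 : ℝ) ≤ k := k.cast_nonneg
    nlinarith

lemma hasSum_gridWeight {δ : ℝ} (h0 : 0 < δ) (h1 : δ < 1) : HasSum (gridWeight δ) 1 := by
  rw [hasSum_iff_tendsto_nat_of_nonneg fun k => (gridWeight_pos h0 h1 k).le]
  -- The tail telescopes: `1 / ((k + 1) (k + 2)) = 1 / (k + 1) - 1 / (k + 2)`.
  have hs : ∀ n : ℕ, ∑ i ∈ Finset.range (n + 1), gridWeight δ i = 1 - δ * (1 / ((n : ℝ) + 1)) := by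
    intro n
    induction n with
    | zero => simp [gridWeight]
    | succ n ih =>
      rw [Finset.sum_range_succ, ih]
      simp only [gridWeight]
      push_cast
      field_simp
      ring
  rw [← tendsto_add_atTop_iff_nat 1]
  simp_rw [hs]
  have := (tendsto_one_div_add_atTop_nhds_zero_nat (𝕜 := ℝ)).const_mul δ
  simpa using this.const_sub 1

/-- The prior with weights `gridWeight δ` on the grid `{k / s}`. -/
def gridPrior (δ s : ℝ) : Measure ℝ :=
  Measure.sum fun k : ℕ => ENNReal.ofReal (gridWeight δ k) • Measure.dirac ((k : ℝ) / s)

lemma isProbabilityMeasure_gridPrior {δ : ℝ} (h0 : 0 < δ) (h1 : δ < 1) (s : ℝ) :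
    IsProbabilityMeasure (gridPrior δ s) := by
  constructor
  rw [gridPrior, Measure.sum_apply _ MeasurableSet.univ]
  simp only [Measure.smul_apply, measure_univ, smul_eq_mul, mul_one]
  rw [← ENNReal.ofReal_tsum_of_nonneg (fun k => (gridWeight_pos h0 h1 k).le)
    (hasSum_gridWeight h0 h1).summable, (hasSum_gridWeight h0 h1).tsum_eq, ENNReal.ofReal_one]

lemma gridWeight_le_gridPrior (δ s : ℝ) (k : ℕ) :
    ENNReal.ofReal (gridWeight δ k) ≤ gridPrior δ s {(k : ℝ) / s} := by
  rw [gridPrior, Measure.sum_apply _ (measurableSet_singleton _)]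
  refine le_trans ?_ (ENNReal.le_tsum k)
  simp

/-- The pointwise bound on the information density, averaged over the channel, when the energy `a`
is compared with its quantization `⌊s a⌋ / s`. -/
def quantCost (δ s : ℝ) (N : ℕ) (a : ℝ) : ℝ :=
  -Real.log (gridWeight δ ⌊s * a⌋₊) + N * Real.log ((1 + (⌊s * a⌋₊ : ℝ) / s) / (1 + a)) +
    N * ((1 + a) / (1 + (⌊s * a⌋₊ : ℝ) / s) - 1)

lemma quant_ratio {s a : ℝ} (hs : 0 < s) (ha : 0 ≤ a) :
    0 ≤ (⌊s * a⌋₊ : ℝ) / s ∧ (⌊s * a⌋₊ : ℝ) / s ≤ a ∧ a - (⌊s * a⌋₊ : ℝ) / s ≤ 1 / s := by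
  refine ⟨by positivity, ?_, ?_⟩
  · rw [div_le_iff₀ hs, mul_comm a]; exact Nat.floor_le (by positivity)
  · have := (Nat.lt_floor_add_one (s * a)).le
    rw [sub_le_iff_le_add, ← add_div, le_div_iff₀ hs]; linarith

/-- The divergence between unit-mean scalings is at most quadratic. -/
lemma log_ratio_add_le {κ a : ℝ} (hκ : 0 ≤ κ) (hκa : κ ≤ a) :
    0 ≤ Real.log ((1 + κ) / (1 + a)) + ((1 + a) / (1 + κ) - 1) ∧
    Real.log ((1 + κ) / (1 + a)) + ((1 + a) / (1 + κ) - 1) ≤ (a - κ) ^ 2 := by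
  have h1 : 0 < 1 + κ := by linarith
  have h2 : 0 < 1 + a := by linarith
  constructor
  · have := Real.one_sub_inv_le_log_of_pos (div_pos h1 h2)
    rw [inv_div] at this
    linarith
  -- After `log x ≤ x - 1` the first-order terms cancel, and `x - 1 + (1/x - 1)` is quadratic in `a
  -- - κ`.
  · have := Real.log_le_sub_one_of_pos (div_pos h1 h2)
    have e : (1 + κ) / (1 + a) - 1 + ((1 + a) / (1 + κ) - 1) =
        (a - κ) ^ 2 / ((1 + κ) * (1 + a)) := by
      field_simp; ring
    have : (a - κ) ^ 2 / ((1 + κ) * (1 + a)) ≤ (a - κ) ^ 2 :=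
      div_le_self (sq_nonneg _) (by nlinarith)
    linarith

lemma quantCost_nonneg {δ s a : ℝ} {N : ℕ} (h0 : 0 < δ) (h1 : δ < 1) (hs : 0 < s) (ha : 0 ≤ a) :
    0 ≤ quantCost δ s N a := by
  obtain ⟨hk0, hka, -⟩ := quant_ratio hs ha
  have h := (log_ratio_add_le hk0 hka).1
  have hw : 0 ≤ -Real.log (gridWeight δ ⌊s * a⌋₊) := neg_nonneg.2
    (Real.log_nonpos (gridWeight_pos h0 h1 _).le (gridWeight_le_one h0 h1 _))
  have hN : (0 : ℝ) ≤ N := N.cast_nonneg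
  rw [quantCost, add_assoc, ← mul_add]
  positivity

/-- Spacing `1/√N` makes the rounding loss `N (a - κ) ^ 2` at most one. With `δ = 1/(B + 1)` the
grid point zero costs `log (1 + 1/B) ≤ 1/B`, so `B` idle subcarriers together cost at most one nat,
while a nonzero grid point costs only about `log B` more than its position does. The first bound is
for sums controlled by power, the second for sums controlled by the number of subcarriers. -/
lemma quantCost_le_linear {a : ℝ} {N B : ℕ} (hN : 0 < N) (hB : 0 < B) (ha : 0 ≤ a) :
    quantCost (1 / (B + 1)) √N N a ≤ 1 / B + (Real.log (B + 1) + 3) * (√N * a) ∧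
    quantCost (1 / (B + 1)) √N N a ≤ Real.log (B + 1) + 2 * Real.log (1 + √N * a) + 2 := by
  have hN' : (0 : ℝ) < N := Nat.cast_pos.2 hN
  have hB' : (1 : ℝ) ≤ B := Nat.one_le_cast.2 hB
  have hs : 0 < √(N : ℝ) := Real.sqrt_pos.2 hN'
  have hss : √(N : ℝ) * √N = N := Real.mul_self_sqrt hN'.le
  obtain ⟨hk0, hka, hk1⟩ := quant_ratio hs ha
  have h := (log_ratio_add_le hk0 hka).2
  have hlogB : 0 ≤ Real.log (B + 1) := Real.log_nonneg (by linarith)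
  have hsa : 0 ≤ √(N : ℝ) * a := by positivity
  have hlog : 0 ≤ Real.log (1 + √N * a) := Real.log_nonneg (by linarith)
  have hcost : quantCost (1 / (B + 1)) √N N a ≤
      -Real.log (gridWeight (1 / (B + 1)) ⌊√N * a⌋₊) + N * (a - (⌊√N * a⌋₊ : ℝ) / √N) ^ 2 := by
    rw [quantCost, add_assoc, ← mul_add]
    gcongr
  have hq1 : N * (a - (⌊√N * a⌋₊ : ℝ) / √N) ^ 2 ≤ 1 := by
    have h2 : (a - (⌊√N * a⌋₊ : ℝ) / √N) ^ 2 ≤ (1 / √N) ^ 2 :=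
      pow_le_pow_left₀ (by linarith) hk1 2
    rw [div_pow, Real.sq_sqrt hN'.le, one_pow] at h2
    calc (N : ℝ) * (a - (⌊√N * a⌋₊ : ℝ) / √N) ^ 2 ≤ N * (1 / N) := by gcongr
      _ = 1 := by field_simp
  rcases Nat.eq_zero_or_pos ⌊√N * a⌋₊ with hk | hk
  · have hlt : √N * a < 1 := Nat.floor_eq_zero.1 hk
    have hw : -Real.log (gridWeight (1 / (B + 1)) ⌊√N * a⌋₊) ≤ 1 / B := by
      rw [hk]
      simp only [gridWeight]
      rw [← Real.log_inv]
      have e : (1 - 1 / ((B : ℝ) + 1))⁻¹ = 1 + 1 / B := by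
        have hB0 : (B : ℝ) ≠ 0 := by positivity
        have hB1 : (B : ℝ) + 1 ≠ 0 := by positivity
        rw [one_sub_div hB1, add_sub_cancel_right, inv_div, add_div, div_self hB0]
      rw [e]
      have := Real.log_le_sub_one_of_pos (show (0 : ℝ) < 1 + 1 / B by positivity)
      linarith
    -- At the grid point zero the loss is `(√N a) ^ 2` with `√N a < 1`, hence below `√N a`.
    have hq2 : N * (a - (⌊√N * a⌋₊ : ℝ) / √N) ^ 2 ≤ √N * a := by
      rw [hk]
      have : (N : ℝ) * (a - ((0 : ℕ) : ℝ) / √N) ^ 2 = (√N * a) * (√N * a) := by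
        push_cast
        rw [zero_div, sub_zero]
        linear_combination (-a ^ 2) * hss
      rw [this]
      nlinarith
    have hB2 : 1 / (B : ℝ) ≤ 1 := by rw [div_le_one (by linarith)]; exact hB'
    constructor
    · nlinarith
    · linarith
  · obtain ⟨k, hk'⟩ := Nat.exists_eq_succ_of_ne_zero hk.ne'
    have hkle : (⌊√N * a⌋₊ : ℝ) ≤ √N * a := Nat.floor_le hsa
    have hkc : (⌊√N * a⌋₊ : ℝ) = k + 1 := by rw [hk']; push_cast; ring
    have hkn : (0 : ℝ) ≤ k := k.cast_nonneg
    have hw : -Real.log (gridWeight (1 / (B + 1)) ⌊√N * a⌋₊) ≤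
        Real.log (B + 1) + 2 * Real.log (1 + √N * a) := by
      rw [hk']
      simp only [gridWeight]
      rw [← Real.log_inv]
      have e : (1 / ((B : ℝ) + 1) / ((k + 1) * (k + 2)))⁻¹ = (B + 1) * ((k + 1) * (k + 2)) := by
        field_simp
      rw [e, Real.log_mul (by positivity) (by positivity),
        Real.log_mul (by positivity) (by positivity)]
      have l1 : Real.log ((k : ℝ) + 1) ≤ Real.log (1 + √N * a) :=
        Real.log_le_log (by positivity) (by linarith)
      have l2 : Real.log ((k : ℝ) + 2) ≤ Real.log (1 + √N * a) :=
        Real.log_le_log (by positivity) (by linarith)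
      linarith
    -- Away from zero every constant can be charged to `√N a`: one unit for the rounding loss and
    -- two for the logarithm `2 * log (1 + √N a)` account for the constant `3`.
    have h1a : 1 ≤ √N * a := by linarith
    constructor
    · have hl : Real.log (1 + √N * a) ≤ √N * a := by
        have := Real.log_le_sub_one_of_pos (show (0 : ℝ) < 1 + √N * a by positivity)
        linarith
      have hB0 : 0 ≤ 1 / (B : ℝ) := by positivity
      nlinarith
    · linarith

/-! ### Received energies and the power constraint -/

/-- The received energy on subcarrier `b` along the shape `u`. -/
def shapeEnergy {B N L : ℕ} (u : Input B L) (y : Output B N L) (b : Fin B) : ℝ :=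
  ∑ n, ‖matchedFilter u y b n‖ ^ 2

lemma measurable_shapeEnergy {Ω : Type*} [MeasurableSpace Ω] {B N L : ℕ} {u : Ω → Input B L}
    {y : Ω → Output B N L} (hu : Measurable u) (hy : Measurable y) (b : Fin B) :
    Measurable fun ω => shapeEnergy (u ω) (y ω) b := by
  unfold shapeEnergy
  have := measurable_matchedFilter hu hy b
  fun_prop

lemma measurable_energyShape {Ω : Type*} [MeasurableSpace Ω] {B L : ℕ} {a : Ω → Fin B → ℝ}
    {u : Ω → Input B L} (ha : Measurable a) (hu : Measurable u) :
    Measurable fun ω => energyShape (a ω) (u ω) := by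
  unfold energyShape
  fun_prop

lemma sum_norm_sq_eq_one {L : ℕ} {v : EuclideanSpace ℂ (Fin L)} (hv : ‖v‖ = 1) :
    ∑ l, ‖v l‖ ^ 2 = 1 := by
  rw [← EuclideanSpace.norm_sq_eq, hv, one_pow]

lemma energyShape_norm_sq {B L : ℕ} {a : Fin B → ℝ} {u : Input B L} {b : Fin B} (ha : 0 ≤ a b)
    (hu : ‖u b‖ = 1) : ∑ l, ‖energyShape a u b l‖ ^ 2 = a b := by
  have : ∀ l, ‖energyShape a u b l‖ ^ 2 = a b * ‖u b l‖ ^ 2 := by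
    intro l
    simp only [energyShape, PiLp.smul_apply, smul_eq_mul, norm_mul, Complex.norm_real, mul_pow,
      Real.norm_eq_abs, sq_abs, Real.sq_sqrt ha]
  simp_rw [this]
  rw [← Finset.mul_sum, sum_norm_sq_eq_one hu, mul_one]

lemma matchedFilter_energyShape {B N L : ℕ} (a : Fin B → ℝ) (u : Input B L) (y : Output B N L)
    (b : Fin B) (n : Fin N) :
    matchedFilter (energyShape a u) y b n = (√(a b) : ℝ) * matchedFilter u y b n := by
  simp only [matchedFilter, energyShape, PiLp.smul_apply, smul_eq_mul, Finset.mul_sum]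
  exact Finset.sum_congr rfl fun l _ => by ring

/-- The channel density for a unit-norm shape depends on the output only through the received
energies. -/
lemma channelDensity_energyShape {B N L : ℕ} {a : Fin B → ℝ} {u : Input B L} (ha : ∀ b, 0 ≤ a b)
    (hu : ∀ b, ‖u b‖ = 1) (y : Output B N L) :
    channelDensity (energyShape a u) y = ENNReal.ofReal (Real.exp
      (∑ b, (-(N * Real.log (1 + a b)) + shapeEnergy u y b * (1 - 1 / (1 + a b))))) := by
  rw [channelDensity, Real.exp_sum, ENNReal.ofReal_prod_of_nonneg fun _ _ => (Real.exp_pos _).le]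
  refine Finset.prod_congr rfl fun b _ => ?_
  have h1 : 0 < 1 + a b := by linarith [ha b]
  rw [← ENNReal.ofReal_prod_of_nonneg fun n _ => by
    rw [energyShape_norm_sq (ha b) (hu b)]; positivity]
  congr 1
  rw [Finset.prod_mul_distrib, ← Real.exp_sum, Real.exp_add, energyShape_norm_sq (ha b) (hu b)]
  congr 1
  · rw [Finset.prod_const, Finset.card_univ, Fintype.card_fin, ← mul_neg, Real.exp_nat_mul,
      Real.exp_neg, Real.exp_log h1]
  · congr 1
    rw [shapeEnergy, Finset.sum_mul]
    refine Finset.sum_congr rfl fun n _ => ?_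
    rw [matchedFilter_energyShape, norm_mul, mul_pow, Complex.norm_real, Real.norm_eq_abs, sq_abs,
      Real.sq_sqrt (ha b)]
    field_simp
    ring

lemma lintegral_channelDensity {B N L : ℕ} (x : Input B L) :
    ∫⁻ y : Output B N L, channelDensity x y ∂noiseLaw B N L = 1 := by
  have := lintegral_channelOutput (N := N) x (F := fun _ => 1) measurable_const
  simpa using this.symm

/-- The mean received energy along a unit-norm shape. -/
lemma lintegral_shapeEnergy {B N L : ℕ} {a : Fin B → ℝ} {u : Input B L} (b : Fin B)
    (ha : 0 ≤ a b) (hu : ‖u b‖ = 1) :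
    ∫⁻ p, ENNReal.ofReal (shapeEnergy u (channelOutput (energyShape a u) p.1 p.2) b)
      ∂((fadingLaw B N).prod (noiseLaw B N L)) = ENNReal.ofReal (N * (1 + a b)) := by
  -- Since `u b` is a unit vector, projecting on it leaves `√a` times the fading plus a
  -- unit-variance noise, of second moment `1 + a`.
  have hmf : ∀ (p : Fading B N × Output B N L) n,
      matchedFilter u (channelOutput (energyShape a u) p.1 p.2) b n =
        (√(a b) : ℝ) * p.1 b n + ∑ l, u b l * p.2 b n l := by
    intro p n
    have h1 : (∑ l, star (u b l) * u b l : ℂ) = 1 := by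
      have := sum_norm_sq_eq_one hu
      have h2 : ∀ l, star (u b l) * u b l = ((‖u b l‖ ^ 2 : ℝ) : ℂ) := fun l => by
        rw [mul_comm]
        push_cast
        exact Complex.mul_conj' _
      simp_rw [h2]
      rw [← Complex.ofReal_sum, this, Complex.ofReal_one]
    simp only [matchedFilter, channelOutput, energyShape, PiLp.smul_apply, smul_eq_mul, star_mul',
      add_mul, Finset.sum_add_distrib]
    congr 1
    · rw [← mul_one ((√(a b) : ℝ) * p.1 b n : ℂ), ← h1, Finset.mul_sum]
      refine Finset.sum_congr rfl fun l _ => ?_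
      have : star ((√(a b) : ℝ) : ℂ) = ((√(a b) : ℝ) : ℂ) := Complex.conj_ofReal _
      rw [this]; ring
    · exact Finset.sum_congr rfl fun l _ => by ring
  simp only [shapeEnergy, hmf]
  have hrow : ∀ n : Fin N, ∫⁻ p : Fading B N × Output B N L, ENNReal.ofReal
      (‖(√(a b) : ℝ) * p.1 b n + ∑ l, u b l * p.2 b n l‖ ^ 2)
      ∂((fadingLaw B N).prod (noiseLaw B N L)) = ENNReal.ofReal (1 + a b) := by
    intro n
    have hm : Measurable fun r : ℂ × (Fin L → ℂ) => ENNReal.ofReal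
        (‖((√(a b) : ℝ) : ℂ) * r.1 + ∑ l, u b l * r.2 l‖ ^ 2) := by fun_prop
    have := (measurePreserving_row L b n).lintegral_comp hm
    rw [this, ← ofReal_integral_eq_lintegral_ofReal (integrable_rowLaw_norm_sq _ _)
      (ae_of_all _ fun r => by positivity), integral_rowLaw_norm_sq, Complex.norm_real,
      Real.norm_eq_abs, sq_abs, Real.sq_sqrt ha, sum_norm_sq_eq_one hu, add_comm]
  simp_rw [ENNReal.ofReal_sum_of_nonneg fun _ _ => sq_nonneg _]
  rw [lintegral_finsetSum]
  · simp_rw [hrow]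
    rw [Finset.sum_const, Finset.card_univ, Fintype.card_fin, nsmul_eq_mul,
      ENNReal.ofReal_mul (Nat.cast_nonneg _), ENNReal.ofReal_natCast]
  · intro n _
    fun_prop

/-- The energies of an admissible input have bounded total mean. -/
lemma IsOEDInput.sum_lintegral_energy_le {B L : ℕ} {P : ℝ} {pa : Measure (Fin B → ℝ)}
    {pu : Measure (Input B L)} (h : IsOEDInput P pa pu) (hL : 0 < L) :
    ∑ b, ∫⁻ a, ENNReal.ofReal (a b) ∂pa ≤ ENNReal.ofReal P * L := by
  have := h.isProbabilityMeasure_energy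
  have := h.isProbabilityMeasure_shape
  have hm : Measurable fun ω : (Fin B → ℝ) × Input B L => energyShape ω.1 ω.2 :=
    measurable_energyShape measurable_fst measurable_snd
  have hL0 : (L : ℝ≥0∞) ≠ 0 := by exact_mod_cast hL.ne'
  have hpow := h.power
  rw [avgPower, lintegral_map (by fun_prop) hm] at hpow
  have hae : ∀ᵐ ω ∂pa.prod pu, (∀ b, 0 ≤ ω.1 b) ∧ ∀ b, ‖ω.2 b‖ = 1 := by
    have h1 : ∀ᵐ ω ∂pa.prod pu, ∀ b, 0 ≤ ω.1 b :=
      Measure.quasiMeasurePreserving_fst.ae h.energy_nonneg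
    have h2 : ∀ᵐ ω ∂pa.prod pu, ∀ b, ‖ω.2 b‖ = 1 :=
      Measure.quasiMeasurePreserving_snd.ae h.shape_unit
    exact h1.and h2
  have hcongr : ∫⁻ ω, (∑ b, ∑ l, ‖energyShape ω.1 ω.2 b l‖ₑ ^ 2) / (L : ℝ≥0∞) ∂pa.prod pu =
      ∫⁻ ω : (Fin B → ℝ) × Input B L, (∑ b, ENNReal.ofReal (ω.1 b)) / (L : ℝ≥0∞) ∂pa.prod pu := by
    refine lintegral_congr_ae ?_
    filter_upwards [hae] with ω hω
    congr 1
    refine Finset.sum_congr rfl fun b _ => ?_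
    rw [← energyShape_norm_sq (hω.1 b) (hω.2 b),
      ENNReal.ofReal_sum_of_nonneg fun _ _ => by positivity]
    refine Finset.sum_congr rfl fun l _ => ?_
    rw [ENNReal.ofReal_pow (norm_nonneg _), ofReal_norm]
  rw [hcongr] at hpow
  simp_rw [div_eq_mul_inv] at hpow
  rw [lintegral_mul_const _ (by fun_prop), ← div_eq_mul_inv,
    ENNReal.div_le_iff hL0 (ENNReal.natCast_ne_top _)] at hpow
  refine le_trans (le_of_eq ?_) hpow
  rw [lintegral_prod _ (by fun_prop), ← lintegral_finsetSum _ fun b _ => by fun_prop]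
  refine lintegral_congr fun a => ?_
  simp

/-! ### The information density and the reference law -/

/-- The part of the information density that depends on the energy alone. -/
def energyCost (δ s : ℝ) (N : ℕ) (a : ℝ) : ℝ :=
  -Real.log (gridWeight δ ⌊s * a⌋₊) + N * Real.log ((1 + (⌊s * a⌋₊ : ℝ) / s) / (1 + a))

/-- The coefficient of the received energy in the information density. -/
def energyCoeff (s a : ℝ) : ℝ := 1 / (1 + (⌊s * a⌋₊ : ℝ) / s) - 1 / (1 + a)

lemma measurable_energyCost (δ s : ℝ) (N : ℕ) : Measurable (energyCost δ s N) := by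
  have h1 : Measurable fun a : ℝ => ⌊s * a⌋₊ := Nat.measurable_floor.comp (measurable_const_mul s)
  have h2 : Measurable fun a : ℝ => gridWeight δ ⌊s * a⌋₊ := (measurable_of_countable (gridWeight δ)).comp h1
  have h3 : Measurable fun a : ℝ => (⌊s * a⌋₊ : ℝ) := (measurable_of_countable _).comp h1
  unfold energyCost
  fun_prop

lemma measurable_energyCoeff (s : ℝ) : Measurable (energyCoeff s) := by
  have h1 : Measurable fun a : ℝ => ⌊s * a⌋₊ := Nat.measurable_floor.comp (measurable_const_mul s)
  have h3 : Measurable fun a : ℝ => (⌊s * a⌋₊ : ℝ) := (measurable_of_countable _).comp h1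
  unfold energyCoeff
  fun_prop

/-- The factor `N * (1 + a)` is the mean received energy, so this evaluates the average over the
channel of one term of `infoDensity`. -/
lemma energyCost_add (δ s : ℝ) (N : ℕ) {a : ℝ} (ha : 0 ≤ a) (hs : 0 < s) :
    energyCost δ s N a + energyCoeff s a * (N * (1 + a)) = quantCost δ s N a := by
  obtain ⟨hk0, -, -⟩ := quant_ratio hs ha
  have h1 : 1 + a ≠ 0 := by positivity
  have h2 : 1 + (⌊s * a⌋₊ : ℝ) / s ≠ 0 := by positivity
  rw [energyCost, energyCoeff, quantCost]
  field_simp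

/-- Rounding down fixes the sign of the coefficient. The uniform bound makes the mean of the
received-energy term integrable with no moment assumption on the energy. -/
lemma energyCoeff_bounds {s a : ℝ} (ha : 0 ≤ a) (hs : 0 < s) :
    0 ≤ energyCoeff s a ∧ energyCoeff s a * (1 + a) ≤ 1 / s := by
  obtain ⟨hk0, hka, hk1⟩ := quant_ratio hs ha
  have h1 : 0 < 1 + a := by positivity
  have h2 : 0 < 1 + (⌊s * a⌋₊ : ℝ) / s := by positivity
  rw [energyCoeff]
  constructor
  · rw [sub_nonneg]
    exact one_div_le_one_div_of_le h2 (by linarith)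
  · have e : (1 / (1 + (⌊s * a⌋₊ : ℝ) / s) - 1 / (1 + a)) * (1 + a) =
        (a - (⌊s * a⌋₊ : ℝ) / s) / (1 + (⌊s * a⌋₊ : ℝ) / s) := by
      generalize (⌊s * a⌋₊ : ℝ) / s = κ at *
      field_simp
      ring
    rw [e]
    exact (div_le_self (by linarith) (by linarith)).trans hk1

/-- The information density relative to the quantized-energy reference. -/
def infoDensity {B N L : ℕ} (δ s : ℝ) (q : ((Fin B → ℝ) × Input B L) × Output B N L) : ℝ :=
  ∑ b, (energyCost δ s N (q.1.1 b) + energyCoeff s (q.1.1 b) * shapeEnergy q.1.2 q.2 b)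

/-- The reference density: the channel density averaged over the grid prior of the energies. -/
def gridDensity {B N L : ℕ} (δ s : ℝ) (u : Input B L) (y : Output B N L) : ℝ≥0∞ :=
  ∫⁻ a, channelDensity (energyShape a u) y ∂Measure.pi fun _ : Fin B => gridPrior δ s

lemma measurable_gridDensity {Ω : Type*} [MeasurableSpace Ω] {B N L : ℕ} {δ s : ℝ}
    (h0 : 0 < δ) (h1 : δ < 1) {u : Ω → Input B L} {y : Ω → Output B N L} (hu : Measurable u)
    (hy : Measurable y) : Measurable fun ω => gridDensity δ s (u ω) (y ω) := by
  have := isProbabilityMeasure_gridPrior h0 h1 s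
  unfold gridDensity
  refine Measurable.lintegral_prod_right' (f := fun p : Ω × (Fin B → ℝ) =>
    channelDensity (energyShape p.2 (u p.1)) (y p.1)) ?_
  exact measurable_channelDensity
    (measurable_energyShape measurable_snd (hu.comp measurable_fst)) (hy.comp measurable_fst)

lemma lintegral_gridDensity {B N L : ℕ} {δ s : ℝ} (h0 : 0 < δ) (h1 : δ < 1) (u : Input B L) :
    ∫⁻ y : Output B N L, gridDensity δ s u y ∂noiseLaw B N L = 1 := by
  have := isProbabilityMeasure_gridPrior h0 h1 s
  unfold gridDensity
  rw [lintegral_lintegral_swap]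
  · simp_rw [lintegral_channelDensity]
    simp
  · exact (measurable_channelDensity (measurable_energyShape measurable_snd measurable_const)
      measurable_fst).aemeasurable

/-- A mixture dominates each of its atoms: keeping only the rounded energies bounds `gridDensity`
below by the weight times the density at that grid point. The ratio of the densities at `a` and at
its rounding is the exponential of an affine function of the received energies. -/
lemma channelDensity_le_gridDensity {B N L : ℕ} {δ s : ℝ} (h0 : 0 < δ) (h1 : δ < 1) (hs : 0 < s)
    {a : Fin B → ℝ} {u : Input B L} (ha : ∀ b, 0 ≤ a b) (hu : ∀ b, ‖u b‖ = 1)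
    (y : Output B N L) :
    channelDensity (energyShape a u) y ≤
      gridDensity δ s u y * ENNReal.ofReal (Real.exp (infoDensity δ s ((a, u), y))) := by
  have := isProbabilityMeasure_gridPrior h0 h1 s
  set κ : Fin B → ℝ := fun b => (⌊s * a b⌋₊ : ℝ) / s with hκ
  have hκ0 : ∀ b, 0 ≤ κ b := fun b => (quant_ratio hs (ha b)).1
  have hlow : (∏ b, ENNReal.ofReal (gridWeight δ ⌊s * a b⌋₊)) * channelDensity (energyShape κ u) y
      ≤ gridDensity δ s u y := by
    have hmeas : Measurable fun a' : Fin B → ℝ => channelDensity (energyShape a' u) y :=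
      measurable_channelDensity (measurable_energyShape measurable_id measurable_const)
        measurable_const
    calc _ ≤ (Measure.pi fun _ : Fin B => gridPrior δ s) {κ} *
          channelDensity (energyShape κ u) y := by
          gcongr
          rw [← Set.univ_pi_singleton, Measure.pi_pi]
          exact Finset.prod_le_prod' fun b _ => gridWeight_le_gridPrior δ s _
      _ = ∫⁻ a' in {κ}, channelDensity (energyShape a' u) y
            ∂Measure.pi fun _ : Fin B => gridPrior δ s := by
          rw [lintegral_singleton, mul_comm]
      _ ≤ _ := setLIntegral_le_lintegral _ _
  refine le_trans (le_of_eq ?_) (mul_le_mul_left hlow _)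
  rw [channelDensity_energyShape ha hu, channelDensity_energyShape hκ0 hu,
    ← ENNReal.ofReal_prod_of_nonneg fun _ _ => (gridWeight_pos h0 h1 _).le,
    ← ENNReal.ofReal_mul (Finset.prod_nonneg fun _ _ => (gridWeight_pos h0 h1 _).le),
    ← ENNReal.ofReal_mul (mul_nonneg (Finset.prod_nonneg fun _ _ => (gridWeight_pos h0 h1 _).le)
      (Real.exp_pos _).le)]
  congr 1
  have hw : ∏ b, gridWeight δ ⌊s * a b⌋₊ =
      Real.exp (∑ b, Real.log (gridWeight δ ⌊s * a b⌋₊)) := by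
    rw [Real.exp_sum]
    exact Finset.prod_congr rfl fun b _ => (Real.exp_log (gridWeight_pos h0 h1 _)).symm
  rw [hw, ← Real.exp_add, ← Real.exp_add, infoDensity]
  congr 1
  rw [← Finset.sum_add_distrib, ← Finset.sum_add_distrib]
  refine Finset.sum_congr rfl fun b _ => ?_
  have e1 : 0 < 1 + a b := by linarith [ha b]
  have e2 : 0 < 1 + κ b := by linarith [hκ0 b]
  rw [energyCost, energyCoeff, show (⌊s * a b⌋₊ : ℝ) / s = κ b from rfl, Real.log_div e2.ne' e1.ne']
  ring

/-- Mutual information of energy detection is bounded by the mean quantization cost. -/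
theorem klDiv_energyOutputLaw_le {B N L : ℕ} {P : ℝ} {pa : Measure (Fin B → ℝ)}
    {pu : Measure (Input B L)} (h : IsOEDInput P pa pu) {δ s : ℝ} (h0 : 0 < δ) (h1 : δ < 1)
    (hs : 0 < s) (h_int : ∀ b, Integrable (fun a => quantCost δ s N (a b)) pa) :
    klDiv (energyOutputLaw N pa pu)
      ((energyOutputLaw N pa pu).fst.prod (energyOutputLaw N pa pu).snd) ≤
      ENNReal.ofReal (∑ b, ∫ a, quantCost δ s N (a b) ∂pa) := by
  have := h.isProbabilityMeasure_energy
  have := h.isProbabilityMeasure_shape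
  set ν := noiseLaw B N L with hν
  set K := (fadingLaw B N).prod ν with hK
  set M := (pa.prod pu).prod ν with hM
  let Φ : ((Fin B → ℝ) × Input B L) × Fading B N × Output B N L →
      ((Fin B → ℝ) × Input B L) × Output B N L :=
    fun ω => (ω.1, channelOutput (energyShape ω.1.1 ω.1.2) ω.2.1 ω.2.2)
  have henc : Measurable fun ω : (Fin B → ℝ) × Input B L => energyShape ω.1 ω.2 :=
    measurable_energyShape measurable_fst measurable_snd
  have hΦ : Measurable Φ := measurable_fst.prodMk (measurable_channelOutput
    (henc.comp measurable_fst) (measurable_fst.comp measurable_snd)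
    (measurable_snd.comp measurable_snd))
  -- The shapes are kept for now: given them the density is explicit, whereas averaging over `pu`
  -- would destroy its form.
  set ρ₁ := ((pa.prod pu).prod K).map Φ with hR1
  have hR1p : IsProbabilityMeasure ρ₁ := Measure.isProbabilityMeasure_map hΦ.aemeasurable
  have hR1d : ρ₁ = M.withDensity fun q => channelDensity (energyShape q.1.1 q.1.2) q.2 :=
    map_channelOutput_eq_withDensity (pa.prod pu) henc
  have hqm : Measurable fun q : ((Fin B → ℝ) × Input B L) × Output B N L =>
      gridDensity δ s q.1.2 q.2 :=
    measurable_gridDensity h0 h1 (measurable_snd.comp measurable_fst) measurable_snd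
  have hqm' : Measurable fun q : Input B L × Output B N L => gridDensity δ s q.1 q.2 :=
    measurable_gridDensity h0 h1 measurable_fst measurable_snd
  -- In this reference law the output depends on the shapes but is independent of the energies, so
  -- forgetting the shapes gives a product measure (`hmap2`).
  set ρ₂ := M.withDensity fun q => gridDensity δ s q.1.2 q.2 with hR2
  have hR2p : IsProbabilityMeasure ρ₂ := by
    constructor
    rw [hR2, withDensity_apply _ MeasurableSet.univ, Measure.restrict_univ, hM,
      lintegral_prod _ hqm.aemeasurable]
    simp only [hν, lintegral_gridDensity h0 h1]
    simp
  set V := (pu.prod ν).withDensity fun q => gridDensity δ s q.1 q.2 with hV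
  have hVp : IsProbabilityMeasure V := by
    constructor
    rw [hV, withDensity_apply _ MeasurableSet.univ, Measure.restrict_univ,
      lintegral_prod _ hqm'.aemeasurable]
    simp only [hν, lintegral_gridDensity h0 h1]
    simp
  let π : ((Fin B → ℝ) × Input B L) × Output B N L → (Fin B → ℝ) × Output B N L :=
    fun q => (q.1.1, q.2)
  have hπ : Measurable π := by fun_prop
  have hmap1 : ρ₁.map π = energyOutputLaw N pa pu := by
    rw [hR1, Measure.map_map hπ hΦ, energyOutputLaw]
    rfl
  have hρp : IsProbabilityMeasure (energyOutputLaw N pa pu) := by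
    rw [← hmap1]; exact Measure.isProbabilityMeasure_map hπ.aemeasurable
  have hfst : (energyOutputLaw N pa pu).fst = pa := by
    rw [← hmap1, hR1, Measure.map_map hπ hΦ, Measure.fst,
      Measure.map_map measurable_fst (hπ.comp hΦ)]
    have hmp : MeasurePreserving (fun ω : ((Fin B → ℝ) × Input B L) × Fading B N × Output B N L =>
        ω.1.1) ((pa.prod pu).prod K) pa :=
      measurePreserving_fst.comp measurePreserving_fst
    exact hmp.map_eq
  have hmap2 : ρ₂.map π = pa.prod V.snd := by
    refine Measure.ext_of_lintegral _ fun F hFm => ?_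
    have hFπ : Measurable fun q => F (π q) := hFm.comp hπ
    rw [lintegral_map hFm hπ, hR2, lintegral_withDensity_eq_lintegral_mul _ hqm hFπ,
      hM, lintegral_prod _ (hqm.mul hFπ).aemeasurable,
      lintegral_prod _ (Measurable.aemeasurable ?_), lintegral_prod _ hFm.aemeasurable]
    · refine lintegral_congr fun a => ?_
      have hFa : Measurable fun y => F (a, y) := hFm.comp measurable_prodMk_left
      have hFs : Measurable fun q : Input B L × Output B N L => F (a, q.2) :=
        hFa.comp measurable_snd
      rw [Measure.snd, lintegral_map hFa measurable_snd, hV,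
        lintegral_withDensity_eq_lintegral_mul _ hqm' hFs,
        lintegral_prod _ (hqm'.mul hFs).aemeasurable]
      rfl
    · exact (hqm.mul hFπ).lintegral_prod_right'
  have hstep1 : klDiv (energyOutputLaw N pa pu)
      ((energyOutputLaw N pa pu).fst.prod (energyOutputLaw N pa pu).snd) ≤ klDiv ρ₁ ρ₂ := by
    refine (klDiv_prod_marginals_le _ V.snd).trans ?_
    -- Data processing for `π`: revealing the shapes can only increase the divergence.
    rw [hfst, ← hmap2, ← hmap1]
    exact klDiv_map_le ρ₁ ρ₂ hπ
  refine hstep1.trans ?_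
  have hae : ∀ᵐ ω ∂pa.prod pu, (∀ b, 0 ≤ ω.1 b) ∧ ∀ b, ‖ω.2 b‖ = 1 := by
    have h1 : ∀ᵐ ω ∂pa.prod pu, ∀ b, 0 ≤ ω.1 b :=
      Measure.quasiMeasurePreserving_fst.ae h.energy_nonneg
    have h2 : ∀ᵐ ω ∂pa.prod pu, ∀ b, ‖ω.2 b‖ = 1 :=
      Measure.quasiMeasurePreserving_snd.ae h.shape_unit
    exact h1.and h2
  have hgm : Measurable (infoDensity δ s : ((Fin B → ℝ) × Input B L) × Output B N L → ℝ) := by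
    unfold infoDensity
    have hA := measurable_energyCost δ s N
    have hC := measurable_energyCoeff s
    have hT : ∀ b, Measurable fun q : ((Fin B → ℝ) × Input B L) × Output B N L =>
        shapeEnergy q.1.2 q.2 b := fun b =>
      measurable_shapeEnergy (measurable_snd.comp measurable_fst) measurable_snd b
    fun_prop
  have hle : ρ₁ ≤ ρ₂.withDensity fun x => ENNReal.ofReal (Real.exp (infoDensity δ s x)) := by
    rw [hR1d, hR2, ← withDensity_mul _ hqm (by fun_prop)]
    refine withDensity_mono ?_
    have hae' : ∀ᵐ q ∂M, (∀ b, 0 ≤ q.1.1 b) ∧ ∀ b, ‖q.1.2 b‖ = 1 :=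
      Measure.quasiMeasurePreserving_fst.ae hae
    filter_upwards [hae'] with q hq
    exact channelDensity_le_gridDensity h0 h1 hs hq.1 hq.2 q.2
  have hT : ∀ b, Measurable fun q : ((Fin B → ℝ) × Input B L) × Output B N L =>
      shapeEnergy q.1.2 q.2 b := fun b =>
    measurable_shapeEnergy (measurable_snd.comp measurable_fst) measurable_snd b
  have hCm := measurable_energyCoeff s
  have hR1a : MeasurePreserving (fun q : ((Fin B → ℝ) × Input B L) × Output B N L => q.1.1)
      ρ₁ pa := by
    refine ⟨by fun_prop, ?_⟩
    rw [← hfst, ← hmap1, Measure.fst, Measure.map_map measurable_fst hπ]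
    rfl
  have hcint : ∀ b, Integrable (fun a => energyCoeff s (a b) * (N * (1 + a b))) pa := by
    intro b
    refine Integrable.of_bound (by fun_prop) (N * (1 / s)) ?_
    filter_upwards [h.energy_nonneg] with a ha
    have hb := energyCoeff_bounds (ha b) hs
    have h1a : 0 ≤ 1 + a b := by linarith [ha b]
    have hN : (0 : ℝ) ≤ N := N.cast_nonneg
    have hnn : 0 ≤ energyCoeff s (a b) * (N * (1 + a b)) :=
      mul_nonneg hb.1 (mul_nonneg hN h1a)
    rw [Real.norm_eq_abs, abs_of_nonneg hnn]
    calc energyCoeff s (a b) * (N * (1 + a b)) = N * (energyCoeff s (a b) * (1 + a b)) := by ring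
      _ ≤ N * (1 / s) := mul_le_mul_of_nonneg_left hb.2 hN
  have hcnn : ∀ b, 0 ≤ᵐ[pa] fun a => energyCoeff s (a b) * (N * (1 + a b)) := by
    intro b
    filter_upwards [h.energy_nonneg] with a ha
    exact mul_nonneg (energyCoeff_bounds (ha b) hs).1
      (mul_nonneg N.cast_nonneg (by linarith [ha b]))
  have hAint : ∀ b, Integrable (fun a => energyCost δ s N (a b)) pa := by
    intro b
    refine ((h_int b).sub (hcint b)).congr ?_
    filter_upwards [h.energy_nonneg] with a ha
    simp only [Pi.sub_apply]
    rw [← energyCost_add δ s N (ha b) hs]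
    ring
  -- Computed first as a Lebesgue integral of a nonnegative function, so that it yields both
  -- integrability (`hcTint`) and the value of the Bochner integral (`hcTval`).
  have hcTl : ∀ b, ∫⁻ q, ENNReal.ofReal (energyCoeff s (q.1.1 b) * shapeEnergy q.1.2 q.2 b) ∂ρ₁ =
      ∫⁻ a, ENNReal.ofReal (energyCoeff s (a b) * (N * (1 + a b))) ∂pa := by
    intro b
    have hm : Measurable fun q : ((Fin B → ℝ) × Input B L) × Output B N L =>
        ENNReal.ofReal (energyCoeff s (q.1.1 b) * shapeEnergy q.1.2 q.2 b) := by
      have := hT b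
      fun_prop
    have hmΦ : Measurable fun ω => ENNReal.ofReal (energyCoeff s ((Φ ω).1.1 b) *
        shapeEnergy (Φ ω).1.2 (Φ ω).2 b) := hm.comp hΦ
    rw [hR1, lintegral_map hm hΦ, lintegral_prod _ hmΦ.aemeasurable]
    have hm2 : Measurable fun a : Fin B → ℝ =>
      ENNReal.ofReal (energyCoeff s (a b) * (N * (1 + a b))) := by fun_prop
    have hmp : MeasurePreserving Prod.fst (pa.prod pu) pa := measurePreserving_fst
    rw [← hmp.lintegral_comp hm2]
    refine lintegral_congr_ae ?_
    filter_upwards [hae] with ω hω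
    simp only [Φ]
    have hc := (energyCoeff_bounds (hω.1 b) hs).1
    have hTm : Measurable fun p : Fading B N × Output B N L => ENNReal.ofReal (shapeEnergy ω.2
        (channelOutput (energyShape ω.1 ω.2) p.1 p.2) b) :=
      (measurable_shapeEnergy measurable_const
        (measurable_channelOutput measurable_const measurable_fst measurable_snd) b).ennreal_ofReal
    simp_rw [ENNReal.ofReal_mul hc]
    rw [lintegral_const_mul _ hTm, lintegral_shapeEnergy b (hω.1 b) (hω.2 b)]
  have hR1nn : ∀ᵐ q ∂ρ₁, ∀ b, 0 ≤ q.1.1 b := hR1a.quasiMeasurePreserving.ae h.energy_nonneg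
  have hcTnn : ∀ b, 0 ≤ᵐ[ρ₁] fun q => energyCoeff s (q.1.1 b) * shapeEnergy q.1.2 q.2 b := by
    intro b
    filter_upwards [hR1nn] with q hq
    exact mul_nonneg (energyCoeff_bounds (hq b) hs).1
      (Finset.sum_nonneg fun n _ => by positivity)
  have hcTm : ∀ b, AEStronglyMeasurable
      (fun q => energyCoeff s (q.1.1 b) * shapeEnergy q.1.2 q.2 b) ρ₁ := fun b => by
    have := hT b
    fun_prop
  have hcTint : ∀ b, Integrable
      (fun q => energyCoeff s (q.1.1 b) * shapeEnergy q.1.2 q.2 b) ρ₁ := fun b => by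
    rw [← lintegral_ofReal_ne_top_iff_integrable (hcTm b) (hcTnn b), hcTl b,
      lintegral_ofReal_ne_top_iff_integrable (hcint b).aestronglyMeasurable (hcnn b)]
    exact hcint b
  have hcTval : ∀ b, ∫ q, energyCoeff s (q.1.1 b) * shapeEnergy q.1.2 q.2 b ∂ρ₁ =
      ∫ a, energyCoeff s (a b) * (N * (1 + a b)) ∂pa := fun b => by
    rw [integral_eq_lintegral_of_nonneg_ae (hcTnn b) (hcTm b), hcTl b,
      integral_eq_lintegral_of_nonneg_ae (hcnn b) (hcint b).aestronglyMeasurable]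
  have hAR : ∀ b, Integrable (fun q : ((Fin B → ℝ) × Input B L) × Output B N L =>
      energyCost δ s N (q.1.1 b)) ρ₁ := fun b =>
    hR1a.integrable_comp_of_integrable (hAint b)
  have hAval : ∀ b, ∫ q, energyCost δ s N (q.1.1 b) ∂ρ₁ = ∫ a, energyCost δ s N (a b) ∂pa :=
    fun b => by
      have := integral_map (μ := ρ₁) hR1a.measurable.aemeasurable
        (f := fun a : Fin B → ℝ => energyCost δ s N (a b))
        (by rw [hR1a.map_eq]; exact (hAint b).aestronglyMeasurable)
      rw [← this, hR1a.map_eq]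
  have hsumint : ∀ b, Integrable (fun q : ((Fin B → ℝ) × Input B L) × Output B N L =>
      energyCost δ s N (q.1.1 b) + energyCoeff s (q.1.1 b) * shapeEnergy q.1.2 q.2 b) ρ₁ :=
    fun b => (hAR b).add (hcTint b)
  have hgint : Integrable (infoDensity δ s) ρ₁ := integrable_finsetSum _ fun b _ => hsumint b
  refine (klDiv_le_of_le_withDensity_exp ρ₁ ρ₂ hgint hle).trans (ENNReal.ofReal_le_ofReal ?_)
  unfold infoDensity
  rw [integral_finsetSum _ fun b _ => hsumint b]
  refine le_of_eq (Finset.sum_congr rfl fun b _ => ?_)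
  rw [integral_add (hAR b) (hcTint b), hAval, hcTval, ← integral_add (hAint b) (hcint b)]
  refine integral_congr_ae ?_
  filter_upwards [h.energy_nonneg] with a ha
  exact energyCost_add δ s N (ha b) hs

/-! ### From the mean cost to bounds on the OED capacity -/

lemma measurable_quantCost (δ s : ℝ) (N : ℕ) : Measurable (quantCost δ s N) := by
  have h1 : Measurable fun a : ℝ => ⌊s * a⌋₊ := Nat.measurable_floor.comp (measurable_const_mul s)
  have h2 : Measurable fun a : ℝ => gridWeight δ ⌊s * a⌋₊ :=
    (measurable_of_countable (gridWeight δ)).comp h1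
  have h3 : Measurable fun a : ℝ => (⌊s * a⌋₊ : ℝ) := (measurable_of_countable _).comp h1
  unfold quantCost
  fun_prop

lemma IsOEDInput.integrable_energy {B L : ℕ} {P : ℝ} {pa : Measure (Fin B → ℝ)}
    {pu : Measure (Input B L)} (h : IsOEDInput P pa pu) (hL : 0 < L) (b : Fin B) :
    Integrable (fun a => a b) pa := by
  have hnn : 0 ≤ᵐ[pa] fun a => a b := h.energy_nonneg.mono fun a ha => ha b
  rw [← lintegral_ofReal_ne_top_iff_integrable (measurable_pi_apply b).aestronglyMeasurable hnn]
  refine ne_top_of_le_ne_top ?_ ((Finset.single_le_sum (f := fun b =>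
    ∫⁻ a, ENNReal.ofReal (a b) ∂pa) (fun _ _ => zero_le) (Finset.mem_univ b)).trans
    (h.sum_lintegral_energy_le hL))
  exact ENNReal.mul_ne_top ENNReal.ofReal_ne_top (ENNReal.natCast_ne_top _)

lemma IsOEDInput.sum_integral_energy_le {B L : ℕ} {P : ℝ} (hP : 0 ≤ P) {pa : Measure (Fin B → ℝ)}
    {pu : Measure (Input B L)} (h : IsOEDInput P pa pu) (hL : 0 < L) :
    ∑ b, ∫ a, a b ∂pa ≤ P * L := by
  have hnn : ∀ b, 0 ≤ᵐ[pa] fun a => a b := fun b => h.energy_nonneg.mono fun a ha => ha b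
  have := h.sum_lintegral_energy_le hL
  simp_rw [← ofReal_integral_eq_lintegral_ofReal (h.integrable_energy hL _) (hnn _)] at this
  rw [← ENNReal.ofReal_sum_of_nonneg fun b _ => integral_nonneg_of_ae (hnn b),
    ← ENNReal.ofReal_natCast, ← ENNReal.ofReal_mul hP,
    ENNReal.ofReal_le_ofReal_iff (by positivity)] at this
  exact this

/-- The power constraint controls exactly the sum of the mean energies, so a bound on the cost that
is affine in the energy can be averaged whatever the law of the energies. -/
lemma IsOEDInput.klDiv_le_of_quantCost_le {B N L : ℕ} {P : ℝ} (hP : 0 ≤ P)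
    {pa : Measure (Fin B → ℝ)} {pu : Measure (Input B L)} (h : IsOEDInput P pa pu) (hB : 0 < B)
    (hN : 0 < N) (hL : 0 < L) {c₀ c₁ : ℝ} (hc₁ : 0 ≤ c₁)
    (hcost : ∀ a : ℝ, 0 ≤ a → quantCost (1 / (B + 1)) √N N a ≤ c₀ + c₁ * a) :
    klDiv (energyOutputLaw N pa pu)
      ((energyOutputLaw N pa pu).fst.prod (energyOutputLaw N pa pu).snd) ≤
      ENNReal.ofReal (B * c₀ + c₁ * (P * L)) := by
  have := h.isProbabilityMeasure_energy
  have hB' : (0 : ℝ) < B := Nat.cast_pos.2 hB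
  have h0 : (0 : ℝ) < 1 / (B + 1) := by positivity
  have h1 : (1 : ℝ) / (B + 1) < 1 := by rw [div_lt_one (by positivity)]; linarith
  have hs : 0 < √(N : ℝ) := Real.sqrt_pos.2 (Nat.cast_pos.2 hN)
  have hbi : ∀ b, Integrable (fun a : Fin B → ℝ => c₀ + c₁ * a b) pa := fun b =>
    (integrable_const _).add ((h.integrable_energy hL b).const_mul _)
  have hqm := measurable_quantCost (1 / (B + 1)) √N N
  have h_int : ∀ b, Integrable (fun a => quantCost (1 / (B + 1)) √N N (a b)) pa := by
    intro b
    refine (hbi b).mono' (hqm.comp (measurable_pi_apply b)).aestronglyMeasurable ?_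
    filter_upwards [h.energy_nonneg] with a ha
    rw [Real.norm_eq_abs, abs_of_nonneg (quantCost_nonneg h0 h1 hs (ha b))]
    exact hcost _ (ha b)
  refine (klDiv_energyOutputLaw_le h h0 h1 hs h_int).trans (ENNReal.ofReal_le_ofReal ?_)
  calc ∑ b, ∫ a, quantCost (1 / (B + 1)) √N N (a b) ∂pa
      ≤ ∑ b, ∫ a, (c₀ + c₁ * a b) ∂pa := by
        refine Finset.sum_le_sum fun b _ => integral_mono_ae (h_int b) (hbi b) ?_
        filter_upwards [h.energy_nonneg] with a ha using hcost _ (ha b)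
    _ = ∑ b : Fin B, (c₀ + c₁ * ∫ a, a b ∂pa) := by
        refine Finset.sum_congr rfl fun b _ => ?_
        rw [integral_add (integrable_const _) ((h.integrable_energy hL b).const_mul _),
          integral_const_mul]
        simp
    _ = B * c₀ + c₁ * ∑ b, ∫ a, a b ∂pa := by
        rw [Finset.sum_add_distrib, ← Finset.mul_sum]
        simp
    _ ≤ B * c₀ + c₁ * (P * L) := by
        have := h.sum_integral_energy_le hP hL
        gcongr

lemma oedCapacity_le_of_quantCost_le {B N L : ℕ} {P Δf : ℝ} (hP : 0 ≤ P) (hΔf : 0 < Δf)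
    (hB : 0 < B) (hN : 0 < N) (hL : 0 < L) {c₀ c₁ : ℝ} (hc₁ : 0 ≤ c₁)
    (hcost : ∀ a : ℝ, 0 ≤ a → quantCost (1 / (B + 1)) √N N a ≤ c₀ + c₁ * a) :
    oedCapacity P Δf B N L ≤
      ENNReal.ofReal ((B * c₀ + c₁ * (P * L)) / Real.log 2 / (L / Δf)) := by
  have hL' : (0 : ℝ) < L := Nat.cast_pos.2 hL
  refine iSup_le fun pa => iSup_le fun pu => iSup_le fun h => ?_
  rw [ENNReal.ofReal_div_of_pos (div_pos hL' hΔf), ENNReal.ofReal_div_of_pos (Real.log_pos one_lt_two),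
    ENNReal.ofReal_div_of_pos hΔf, ENNReal.ofReal_natCast, mutualInfo]
  gcongr
  exact h.klDiv_le_of_quantCost_le hP hB hN hL hc₁ hcost

/-- Energy detection is limited by the received energy. -/
lemma oedCapacity_le_energy {B N L : ℕ} {P Δf : ℝ} (hP : 0 ≤ P) (hΔf : 0 < Δf)
    (hB : 0 < B) (hN : 0 < N) (hL : 0 < L) :
    oedCapacity P Δf B N L ≤ ENNReal.ofReal
      ((1 + (Real.log (B + 1) + 3) * √N * (P * L)) / Real.log 2 / (L / Δf)) := by
  have hB' : (1 : ℝ) ≤ B := Nat.one_le_cast.2 hB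
  have hlogB : 0 ≤ Real.log (B + 1) := Real.log_nonneg (by linarith)
  have := oedCapacity_le_of_quantCost_le (c₀ := 1 / B) (c₁ := (Real.log (B + 1) + 3) * √N)
    hP hΔf hB hN hL (by positivity)
    fun a ha => by
      have := (quantCost_le_linear hN hB ha).1
      linarith
  rwa [mul_one_div_cancel (by positivity)] at this

/-- Energy detection is limited by the number of subcarriers. -/
lemma oedCapacity_le_bandwidth {B N L : ℕ} {P Δf : ℝ} (hP : 0 ≤ P) (hΔf : 0 < Δf)
    (hB : 0 < B) (hN : 0 < N) (hL : 0 < L) :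
    oedCapacity P Δf B N L ≤ ENNReal.ofReal
      ((B * (Real.log (B + 1) + 2 * Real.log (N * L) + 2) + 2 * P) / Real.log 2 / (L / Δf)) := by
  have hB' : (1 : ℝ) ≤ B := Nat.one_le_cast.2 hB
  have hN' : (1 : ℝ) ≤ N := Nat.one_le_cast.2 hN
  have hL' : (1 : ℝ) ≤ L := Nat.one_le_cast.2 hL
  have := oedCapacity_le_of_quantCost_le
    (c₀ := Real.log (B + 1) + 2 * Real.log (N * L) + 2) (c₁ := 2 / L) hP hΔf hB hN hL
    (by positivity) fun a ha => by
      have h1 := (quantCost_le_linear hN hB ha).2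
      have hx : 0 < 1 + √N * a := by positivity
      have hy : (0 : ℝ) < N * L := by positivity
      -- The logarithm is bounded by its tangent at `N * L`, which gives `log (1 + √N a) ≤ log (N L)
      -- + a / L`. The slope of order `1/L` absorbs the factor `L` of the energy budget and leaves
      -- the constant `2 * P`.
      have h2 := Real.log_le_sub_one_of_pos (div_pos hx hy)
      rw [Real.log_div hx.ne' hy.ne'] at h2
      have hsN : √(N : ℝ) ≤ N := by
        rw [Real.sqrt_le_left (by linarith)]; nlinarith
      have h3 : (1 + √N * a) / (N * L) ≤ 1 + a / L := by
        rw [div_le_iff₀ hy]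
        have e : (1 + a / L) * (N * L) = N * L + N * a := by field_simp
        rw [e]
        have : √N * a ≤ N * a := mul_le_mul_of_nonneg_right hsN ha
        nlinarith
      have e : 2 / (L : ℝ) * a = 2 * (a / L) := by ring
      rw [e]
      linarith
  have e : 2 / (L : ℝ) * (P * L) = 2 * P := by field_simp
  rwa [e] at this

/-! ### Binary signalling -/

/-- The law of a bit that equals one with probability `p`. -/
def bitLaw (p : ℝ) : Measure Bool :=
  ENNReal.ofReal p • Measure.dirac true + ENNReal.ofReal (1 - p) • Measure.dirac false

lemma isProbabilityMeasure_bitLaw {p : ℝ} (h0 : 0 ≤ p) (h1 : p ≤ 1) :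
    IsProbabilityMeasure (bitLaw p) := by
  constructor
  simp only [bitLaw, Measure.add_apply, Measure.smul_apply, measure_univ, smul_eq_mul, mul_one]
  rw [← ENNReal.ofReal_add h0 (by linarith)]
  simp

lemma lintegral_bitLaw (p : ℝ) (f : Bool → ℝ≥0∞) :
    ∫⁻ s, f s ∂bitLaw p = ENNReal.ofReal p * f true + ENNReal.ofReal (1 - p) * f false := by
  rw [bitLaw, lintegral_add_measure, lintegral_smul_measure, lintegral_smul_measure,
    lintegral_dirac, lintegral_dirac]
  rfl

lemma integral_bitLaw {p : ℝ} (h0 : 0 ≤ p) (h1 : p ≤ 1) (f : Bool → ℝ) :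
    ∫ s, f s ∂bitLaw p = p * f true + (1 - p) * f false := by
  have hi : ∀ (c : ℝ) (b : Bool), Integrable f (ENNReal.ofReal c • Measure.dirac b) := fun c b =>
    Integrable.smul_measure (Integrable.of_finite) ENNReal.ofReal_ne_top
  rw [bitLaw, integral_add_measure (hi _ _) (hi _ _), integral_smul_measure, integral_smul_measure,
    integral_dirac, integral_dirac, ENNReal.toReal_ofReal h0,
    ENNReal.toReal_ofReal (by linarith)]
  rfl

/-- Information conveyed by independent bits each of which can be detected reliably. -/
lemma le_klDiv_of_bits {ι X κ Y : Type*} [Fintype ι] [MeasurableSpace X] [MeasurableSpace κ]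
    [MeasurableSpace Y] {p : ℝ} (h0 : 0 ≤ p) (h1 : p ≤ 1) (W : Measure κ) [IsProbabilityMeasure W]
    {enc : (ι → Bool) → X} {dec : ι → X → Bool} (hdec : ∀ i, Measurable (dec i))
    (hde : ∀ i s, dec i (enc s) = s i) {out : X → κ → Y}
    (hout : Measurable fun ω : X × κ => out ω.1 ω.2) {S : ι → Set Y}
    (hS : ∀ i, MeasurableSet (S i))
    (htrue : ∀ i s, s i = true → 3 / 4 ≤ W.real {k | out (enc s) k ∈ S i})
    (hfalse : ∀ i s, s i = false → W.real {k | out (enc s) k ∈ S i} ≤ 1 / 4) :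
    ENNReal.ofReal (Fintype.card ι * (p * (1 - p)) / 16) ≤
      klDiv ((((Measure.pi fun _ : ι => bitLaw p).map enc).prod W).map
          fun ω => (ω.1, out ω.1 ω.2))
        (((((Measure.pi fun _ : ι => bitLaw p).map enc).prod W).map
          fun ω => (ω.1, out ω.1 ω.2)).fst.prod
        ((((Measure.pi fun _ : ι => bitLaw p).map enc).prod W).map
          fun ω => (ω.1, out ω.1 ω.2)).snd) := by
  have := isProbabilityMeasure_bitLaw h0 h1
  have henc : Measurable enc := measurable_of_countable _
  set q := (Measure.pi fun _ : ι => bitLaw p).map enc with hq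
  have hqp : IsProbabilityMeasure q := Measure.isProbabilityMeasure_map henc.aemeasurable
  have hm : Measurable fun ω : X × κ => (ω.1, out ω.1 ω.2) := measurable_fst.prodMk hout
  set ρ := (q.prod W).map fun ω => (ω.1, out ω.1 ω.2) with hρ
  have hρp : IsProbabilityMeasure ρ := Measure.isProbabilityMeasure_map hm.aemeasurable
  have hfst : ρ.fst = q := by
    rw [hρ, Measure.fst, Measure.map_map measurable_fst hm]
    exact (measurePreserving_fst (μ := q) (ν := W)).map_eq
  -- The input features are the centred bits, of variance `p * (1 - p)`; the output features are the
  -- indicators of the decision regions.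
  let ξ : Bool → ℝ := fun s => (if s then 1 else 0) - p
  let ψ : ι → X → ℝ := fun i x => ξ (dec i x)
  let φ : ι → Y → ℝ := fun i => (S i).indicator fun _ => 1
  have hξ : Measurable ξ := measurable_of_countable _
  have hξb : ∀ s, |ξ s| ≤ 1 := by
    intro s
    cases s <;> simp only [ξ, abs_le] <;> constructor <;> norm_num <;> linarith
  have hψ : ∀ i, Measurable (ψ i) := fun i => hξ.comp (hdec i)
  have hφ : ∀ i, Measurable (φ i) := fun i => measurable_const.indicator (hS i)
  have hφb : ∀ i y, |φ i y| ≤ 1 := by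
    intro i y
    by_cases hy : y ∈ S i <;> simp [φ, hy]
  have hv : 0 ≤ p * (1 - p) := mul_nonneg h0 (by linarith)
  -- The correlation of a bit with its decision is at least the variance times the gap `3/4 - 1/4`,
  -- so `Δ = 1/2`, and `Δ ^ 2 / 4` gives the constant `1/16`.
  have key := le_klDiv_of_correlated ρ (ψ := ψ) (φ := φ) hψ hφ (fun i x => hξb _) hφb
    (v := p * (1 - p)) (Δ := 1 / 2) (by norm_num) (by norm_num) ?_ ?_ hv
  · refine le_trans (le_of_eq ?_) key
    congr 1; ring
  · intro c hc
    have hem : Measurable fun x => Real.exp (∑ i, c i * ψ i x) := by fun_prop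
    rw [hfst, hq, integral_map henc.aemeasurable hem.aestronglyMeasurable]
    simp only [ψ, hde, Real.exp_sum, Finset.mul_sum]
    rw [integral_fintype_prod_eq_prod (fun i (s : Bool) => Real.exp (c i * ξ s))]
    refine Finset.prod_le_prod (fun i _ => integral_nonneg fun _ => (Real.exp_pos _).le)
      fun i _ => ?_
    refine integral_exp_mul_le (bitLaw p) hξ hξb ?_ ?_ (hc i)
    · rw [integral_bitLaw h0 h1]; simp [ξ]; ring
    · rw [integral_bitLaw h0 h1]; simp [ξ]; apply le_of_eq; ring
  · intro i
    have hfm : Measurable fun z : X × Y => ψ i z.1 * φ i z.2 :=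
      ((hψ i).comp measurable_fst).mul ((hφ i).comp measurable_snd)
    have hbd : ∀ z : X × Y, ‖ψ i z.1 * φ i z.2‖ ≤ 1 := fun z => by
      rw [norm_mul]
      exact mul_le_one₀ (hξb _) (norm_nonneg _) (hφb i _)
    have hfm2 : Measurable fun ω : X × κ => ψ i ω.1 * φ i (out ω.1 ω.2) := hfm.comp hm
    have h_int : Integrable (fun ω : X × κ => ψ i ω.1 * φ i (out ω.1 ω.2)) (q.prod W) :=
      Integrable.of_bound hfm2.aestronglyMeasurable 1 (ae_of_all _ fun ω => hbd (ω.1, out ω.1 ω.2))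
    have hval : ∀ x, ∫ k, ψ i x * φ i (out x k) ∂W = ψ i x * W.real {k | out x k ∈ S i} := by
      intro x
      rw [integral_const_mul]
      congr 1
      have hSx : MeasurableSet {k | out x k ∈ S i} :=
        (hout.comp measurable_prodMk_left) (hS i)
      rw [← integral_indicator_one hSx]
      rfl
    rw [hρ, integral_map hm.aemeasurable hfm.aestronglyMeasurable,
      integral_prod (fun ω : X × κ => ψ i ω.1 * φ i (out ω.1 ω.2)) h_int]
    simp only [hval]
    have hΦm : AEStronglyMeasurable (fun x => ψ i x * W.real {k | out x k ∈ S i}) q := by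
      have := h_int.integral_prod_left.aestronglyMeasurable
      simpa only [hval] using this
    rw [hq, integral_map henc.aemeasurable (by rw [← hq]; exact hΦm)]
    simp only [ψ, hde]
    let low : Bool → ℝ := fun s => if s then (1 - p) * (3 / 4) else -(p * (1 / 4))
    have hlow : ∫ s : ι → Bool, low (s i) ∂(Measure.pi fun _ => bitLaw p) =
        1 / 2 * (p * (1 - p)) := by
      have := integral_comp_eval (μ := fun _ : ι => bitLaw p) (i := i) (f := low)
        (measurable_of_countable low).aestronglyMeasurable
      rw [this, integral_bitLaw h0 h1]
      simp [low]; ring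
    rw [← hlow]
    refine integral_mono Integrable.of_finite Integrable.of_finite fun s => ?_
    cases hsi : s i with
    | true =>
      have := htrue i s hsi
      simp only [low, ξ, if_true]
      exact mul_le_mul_of_nonneg_left this (by linarith)
    | false =>
      have := hfalse i s hsi
      simp only [low, ξ]
      simp
      nlinarith

/-! ### Detection of a block statistic -/

/-- The rows of a subcarrier are independent copies of the single-antenna law. -/
lemma measurePreserving_block {B : ℕ} (N L : ℕ) (b : Fin B) :
    MeasurePreserving (fun (p : Fading B N × Output B N L) n => (p.1 b n, p.2 b n))
      ((fadingLaw B N).prod (noiseLaw B N L)) (Measure.pi fun _ : Fin N => rowLaw L) := by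
  have h1 : MeasurePreserving (fun h : Fading B N => h b) (fadingLaw B N)
      (Measure.pi fun _ => stdComplexGaussian) :=
    measurePreserving_eval (fun _ : Fin B => Measure.pi fun _ : Fin N => stdComplexGaussian) b
  have h2 : MeasurePreserving (fun z : Output B N L => z b) (noiseLaw B N L)
      (Measure.pi fun _ => Measure.pi fun _ => stdComplexGaussian) :=
    measurePreserving_eval (fun _ : Fin B => Measure.pi fun _ : Fin N =>
        Measure.pi fun _ : Fin L => stdComplexGaussian) b
  have h3 := (measurePreserving_arrowProdEquivProdArrow ℂ (Fin L → ℂ) (Fin N)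
    (fun _ => stdComplexGaussian) (fun _ => Measure.pi fun _ => stdComplexGaussian)).symm
  exact h3.comp (h1.prod h2)

/-- Chebyshev's inequality: the variance of the sum is at most `N * M`, against a squared deviation
of `(N * d) ^ 2`. The constant error `1/4` is all that `le_klDiv_of_bits` asks for. -/
lemma measureReal_deviation_le {Ω : Type*} [MeasurableSpace Ω] (μ : Measure Ω)
    [IsProbabilityMeasure μ] (N : ℕ) {X : Ω → ℝ} (hX : MemLp X 2 μ) {M d : ℝ} (hd : 0 < d)
    (hM : ∫ x, X x ^ 2 ∂μ ≤ M) (hN : 0 < N) (hNd : 4 * M ≤ N * d ^ 2) :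
    (Measure.pi fun _ : Fin N => μ).real {ω | N * d ≤ |∑ n, X (ω n) - N * ∫ x, X x ∂μ|} ≤ 1 / 4 := by
  have hN' : (0 : ℝ) < N := Nat.cast_pos.2 hN
  have hLp : ∀ n : Fin N, MemLp (fun ω : Fin N → Ω => X (ω n)) 2 (Measure.pi fun _ => μ) :=
    fun n => hX.comp_measurePreserving (measurePreserving_eval (fun _ : Fin N => μ) n)
  have hsum : MemLp (∑ n, fun ω : Fin N → Ω => X (ω n)) 2 (Measure.pi fun _ => μ) :=
    memLp_finsetSum' _ fun n _ => hLp n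
  have hmean : ∫ ω, (∑ n, fun ω : Fin N → Ω => X (ω n)) ω ∂Measure.pi (fun _ => μ) =
      N * ∫ x, X x ∂μ := by
    simp only [Finset.sum_apply]
    rw [integral_finsetSum _ fun n _ => (hLp n).integrable one_le_two]
    have : ∀ n : Fin N, ∫ ω : Fin N → Ω, X (ω n) ∂Measure.pi (fun _ => μ) = ∫ x, X x ∂μ :=
      fun n => integral_comp_eval (μ := fun _ : Fin N => μ) hX.aestronglyMeasurable
    simp [this]
  have hvar : variance (∑ n, fun ω : Fin N → Ω => X (ω n)) (Measure.pi fun _ => μ) ≤ N * M := by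
    rw [variance_sum_pi (μ := fun _ : Fin N => μ) (X := fun _ => X) fun _ => hX]
    rw [Finset.sum_const, Finset.card_univ, Fintype.card_fin, nsmul_eq_mul]
    gcongr
    exact (variance_le_expectation_sq hX.aestronglyMeasurable).trans hM
  have hch := meas_ge_le_variance_div_sq hsum (c := N * d) (by positivity)
  rw [hmean] at hch
  simp only [Finset.sum_apply] at hch
  rw [measureReal_def]
  refine ENNReal.toReal_le_of_le_ofReal (by norm_num) (hch.trans (ENNReal.ofReal_le_ofReal ?_))
  rw [div_le_iff₀ (by positivity)]
  nlinarith

/-- A statistic whose single-antenna mean exceeds the threshold is detected. -/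
lemma block_detect_ge {B N L : ℕ} (b : Fin B) {X : ℂ × (Fin L → ℂ) → ℝ} (hXm : Measurable X)
    (hX : MemLp X 2 (rowLaw L)) {M d θ : ℝ} (hd : 0 < d) (hM : ∫ x, X x ^ 2 ∂rowLaw L ≤ M)
    (hN : 0 < N) (hNd : 4 * M ≤ N * d ^ 2) (hθ : θ + d ≤ ∫ x, X x ∂rowLaw L) :
    3 / 4 ≤ ((fadingLaw B N).prod (noiseLaw B N L)).real
      {p | N * θ < ∑ n, X (p.1 b n, p.2 b n)} := by
  have hN' : (0 : ℝ) < N := Nat.cast_pos.2 hN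
  have hdev := measureReal_deviation_le (rowLaw L) N hX hd hM hN hNd
  have hmp := measurePreserving_block N L b
  have hms : MeasurableSet {ω : Fin N → ℂ × (Fin L → ℂ) | N * θ < ∑ n, X (ω n)} :=
    measurableSet_lt measurable_const (by fun_prop)
  have hpre := hmp.measureReal_preimage hms.nullMeasurableSet
  have hsub : {ω : Fin N → ℂ × (Fin L → ℂ) | N * θ < ∑ n, X (ω n)}ᶜ ⊆
      {ω | N * d ≤ |∑ n, X (ω n) - N * ∫ x, X x ∂rowLaw L|} := by
    intro ω hω
    simp only [Set.mem_compl_iff, Set.mem_ofPred_eq, not_lt] at hω ⊢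
    have := mul_le_mul_of_nonneg_left hθ hN'.le
    refine le_trans ?_ (neg_le_abs _)
    linarith
  have h1 := (measureReal_mono hsub).trans hdev
  rw [probReal_compl_eq_one_sub hms] at h1
  have h2 : 3 / 4 ≤ (Measure.pi fun _ : Fin N => rowLaw L).real
    {ω : Fin N → ℂ × (Fin L → ℂ) | N * θ < ∑ n, X (ω n)} := by linarith
  rw [← hpre] at h2
  exact h2

/-- A statistic whose single-antenna mean is below the threshold is not detected. -/
lemma block_detect_le {B N L : ℕ} (b : Fin B) {X : ℂ × (Fin L → ℂ) → ℝ} (hXm : Measurable X)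
    (hX : MemLp X 2 (rowLaw L)) {M d θ : ℝ} (hd : 0 < d) (hM : ∫ x, X x ^ 2 ∂rowLaw L ≤ M)
    (hN : 0 < N) (hNd : 4 * M ≤ N * d ^ 2) (hθ : ∫ x, X x ∂rowLaw L ≤ θ - d) :
    ((fadingLaw B N).prod (noiseLaw B N L)).real
      {p | N * θ < ∑ n, X (p.1 b n, p.2 b n)} ≤ 1 / 4 := by
  have hN' : (0 : ℝ) < N := Nat.cast_pos.2 hN
  have hdev := measureReal_deviation_le (rowLaw L) N hX hd hM hN hNd
  have hmp := measurePreserving_block N L b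
  have hms : MeasurableSet {ω : Fin N → ℂ × (Fin L → ℂ) | N * θ < ∑ n, X (ω n)} :=
    measurableSet_lt measurable_const (by fun_prop)
  have hpre := hmp.measureReal_preimage hms.nullMeasurableSet
  have hsub : {ω : Fin N → ℂ × (Fin L → ℂ) | N * θ < ∑ n, X (ω n)} ⊆
      {ω | N * d ≤ |∑ n, X (ω n) - N * ∫ x, X x ∂rowLaw L|} := by
    intro ω hω
    simp only [Set.mem_ofPred_eq] at hω ⊢
    have := mul_le_mul_of_nonneg_left hθ hN'.le
    refine le_trans ?_ (le_abs_self _)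
    linarith
  have h1 := (measureReal_mono hsub).trans hdev
  rw [← hpre] at h1
  exact h1

/-- A bound for the fourth moments of the outputs of a single antenna. -/
def fourthMoment : ℝ := 16 * ∫ z, ‖z‖ ^ 4 ∂stdComplexGaussian + 1

lemma fourthMoment_pos : 0 < fourthMoment := by
  have : 0 ≤ ∫ z : ℂ, ‖z‖ ^ 4 ∂stdComplexGaussian := integral_nonneg fun _ => by positivity
  unfold fourthMoment; linarith

lemma integrable_norm_pow_four : Integrable (fun z : ℂ => ‖z‖ ^ 4) stdComplexGaussian :=
  (memLp_stdComplexGaussian 4).integrable_norm_pow' (p := 4)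

lemma rowLaw_fourth_moment {L : ℕ} {α : ℂ} (hα : ‖α‖ ≤ 1) (l : Fin L) :
    Integrable (fun r : ℂ × (Fin L → ℂ) => ‖α * r.1 + r.2 l‖ ^ 4) (rowLaw L) ∧
    ∫ r, ‖α * r.1 + r.2 l‖ ^ 4 ∂rowLaw L ≤ fourthMoment := by
  -- Convexity gives the factor `8` for each of two equal fourth moments, hence the `16` in
  -- `fourthMoment`; the `1` added there makes it visibly positive.
  have hpt : ∀ r : ℂ × (Fin L → ℂ), ‖α * r.1 + r.2 l‖ ^ 4 ≤ 8 * (‖r.1‖ ^ 4 + ‖r.2 l‖ ^ 4) := by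
    intro r
    have h1 : ‖α * r.1 + r.2 l‖ ≤ ‖r.1‖ + ‖r.2 l‖ := by
      refine (norm_add_le _ _).trans ?_
      rw [norm_mul]
      gcongr
      exact mul_le_of_le_one_left (norm_nonneg _) hα
    refine (pow_le_pow_left₀ (norm_nonneg _) h1 4).trans ?_
    have := add_pow_le (norm_nonneg r.1) (norm_nonneg (r.2 l)) 4
    norm_num at this
    linarith
  have hmp1 : MeasurePreserving (fun r : ℂ × (Fin L → ℂ) => r.1) (rowLaw L) stdComplexGaussian :=
    measurePreserving_fst
  have hmp2 : MeasurePreserving (fun r : ℂ × (Fin L → ℂ) => r.2 l) (rowLaw L)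
      stdComplexGaussian :=
    (measurePreserving_eval (fun _ : Fin L => stdComplexGaussian) l).comp measurePreserving_snd
  have hi1 : Integrable (fun r : ℂ × (Fin L → ℂ) => ‖r.1‖ ^ 4) (rowLaw L) :=
    hmp1.integrable_comp_of_integrable integrable_norm_pow_four
  have hi2 : Integrable (fun r : ℂ × (Fin L → ℂ) => ‖r.2 l‖ ^ 4) (rowLaw L) :=
    hmp2.integrable_comp_of_integrable integrable_norm_pow_four
  have hv1 : ∫ r : ℂ × (Fin L → ℂ), ‖r.1‖ ^ 4 ∂rowLaw L = ∫ z, ‖z‖ ^ 4 ∂stdComplexGaussian := by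
    rw [← hmp1.map_eq, integral_map hmp1.measurable.aemeasurable (by fun_prop)]
  have hv2 : ∫ r : ℂ × (Fin L → ℂ), ‖r.2 l‖ ^ 4 ∂rowLaw L =
      ∫ z, ‖z‖ ^ 4 ∂stdComplexGaussian := by
    conv_rhs => rw [← hmp2.map_eq, integral_map hmp2.measurable.aemeasurable (by fun_prop)]
  have hi : Integrable (fun r : ℂ × (Fin L → ℂ) => 8 * (‖r.1‖ ^ 4 + ‖r.2 l‖ ^ 4)) (rowLaw L) :=
    (hi1.add hi2).const_mul 8
  refine ⟨hi.mono' (by fun_prop) (ae_of_all _ fun r => ?_), ?_⟩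
  · rw [Real.norm_eq_abs, abs_of_nonneg (by positivity)]
    exact hpt r
  · refine (integral_mono_of_nonneg (ae_of_all _ fun r => by positivity) hi
      (ae_of_all _ hpt)).trans ?_
    rw [integral_const_mul, integral_add hi1 hi2, hv1, hv2, fourthMoment]
    linarith

/-! ### Lower bound for the OED capacity: on–off energy modulation -/

/-- Data for Chebyshev's inequality. The second moment is bounded uniformly in the energy, so one
threshold condition serves both values of a bit. -/
lemma rowLaw_energy_moments {L : ℕ} (l : Fin L) {a : ℝ} (ha : 0 ≤ a) (ha1 : a ≤ 1) :
    MemLp (fun r : ℂ × (Fin L → ℂ) => ‖((√a : ℝ) : ℂ) * r.1 + r.2 l‖ ^ 2) 2 (rowLaw L) ∧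
    ∫ r, (‖((√a : ℝ) : ℂ) * r.1 + r.2 l‖ ^ 2) ^ 2 ∂rowLaw L ≤ fourthMoment ∧
    ∫ r, ‖((√a : ℝ) : ℂ) * r.1 + r.2 l‖ ^ 2 ∂rowLaw L = 1 + a := by
  have hα : ‖((√a : ℝ) : ℂ)‖ ≤ 1 := by
    rw [Complex.norm_real, Real.norm_eq_abs, abs_of_nonneg (Real.sqrt_nonneg _)]
    exact Real.sqrt_le_one.2 ha1
  obtain ⟨h1, h2⟩ := rowLaw_fourth_moment hα l
  have e : ∀ r : ℂ × (Fin L → ℂ), (‖((√a : ℝ) : ℂ) * r.1 + r.2 l‖ ^ 2) ^ 2 =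
      ‖((√a : ℝ) : ℂ) * r.1 + r.2 l‖ ^ 4 := fun r => by ring
  refine ⟨?_, ?_, ?_⟩
  · rw [memLp_two_iff_integrable_sq (by fun_prop)]
    simpa only [e] using h1
  · simpa only [e] using h2
  · have := integral_rowLaw_norm_sq ((√a : ℝ) : ℂ) (Pi.single l (1 : ℂ))
    simp only [Pi.single_apply, ite_mul, one_mul, zero_mul, Finset.sum_ite_eq', Finset.mem_univ,
      if_true] at this
    rw [this, Complex.norm_real, Real.norm_eq_abs, sq_abs, Real.sq_sqrt ha, add_comm]
    congr 1
    rw [Finset.sum_eq_single l] <;> simp +contextual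

/-- A deterministic shape brings the law to the form required by `le_klDiv_of_bits`. -/
lemma energyOutputLaw_dirac {B L : ℕ} (N : ℕ) (pa : Measure (Fin B → ℝ)) [IsProbabilityMeasure pa]
    (u : Input B L) :
    energyOutputLaw N pa (Measure.dirac u) =
      (pa.prod ((fadingLaw B N).prod (noiseLaw B N L))).map
        fun ω => (ω.1, channelOutput (energyShape ω.1 u) ω.2.1 ω.2.2) := by
  have h1 : Measurable fun a : Fin B → ℝ => (a, u) := measurable_prodMk_right
  have h2 : Measurable fun ω : ((Fin B → ℝ) × Input B L) × Fading B N × Output B N L =>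
      (ω.1.1, channelOutput (energyShape ω.1.1 ω.1.2) ω.2.1 ω.2.2) :=
    (measurable_fst.comp measurable_fst).prodMk (measurable_channelOutput
      (measurable_energyShape (measurable_fst.comp measurable_fst)
        (measurable_snd.comp measurable_fst))
      (measurable_fst.comp measurable_snd) (measurable_snd.comp measurable_snd))
  have h3 := Measure.map_prod_map pa ((fadingLaw B N).prod (noiseLaw B N L)) h1 measurable_id
  rw [Measure.map_id] at h3
  rw [energyOutputLaw, Measure.prod_dirac, h3, Measure.map_map h2 (h1.prodMap measurable_id)]
  rfl

/-- On–off energy modulation achieves information proportional to the mean number of active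
subcarriers. -/
lemma le_oedCapacity {B N L : ℕ} {P Δf p : ℝ} (hΔf : 0 < Δf) (h0 : 0 ≤ p) (h1 : p ≤ 1)
    (hNM : 16 * fourthMoment ≤ N) (hL : 0 < L)
    (hpow : B * (p * (4 * √(fourthMoment / N))) ≤ P * L) :
    ENNReal.ofReal (B * (p * (1 - p)) / 16 / Real.log 2 / (L / Δf)) ≤ oedCapacity P Δf B N L := by
  have hM := fourthMoment_pos
  have hN' : (0 : ℝ) < N := by linarith
  have hN : 0 < N := Nat.cast_pos.1 hN'
  have hL' : (0 : ℝ) < L := Nat.cast_pos.2 hL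
  have hbp := isProbabilityMeasure_bitLaw h0 h1
  set A := 4 * √(fourthMoment / N) with hA
  have hA0 : 0 < A := by positivity
  have hA2 : A ^ 2 = 16 * fourthMoment / N := by
    rw [hA, mul_pow, Real.sq_sqrt (by positivity)]; ring
  have hA1 : A ≤ 1 := by
    have : A ^ 2 ≤ 1 := by rw [hA2, div_le_one hN']; exact hNM
    nlinarith
  let l₀ : Fin L := ⟨0, hL⟩
  let u : Input B L := fun _ => EuclideanSpace.single l₀ 1
  have hu : ∀ b, ‖u b‖ = 1 := fun b => by simp [u]
  let enc : (Fin B → Bool) → Fin B → ℝ := fun s b => if s b then A else 0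
  have henc : Measurable enc := measurable_of_countable _
  have hencnn : ∀ s b, 0 ≤ enc s b := fun s b => by
    simp only [enc]; split_ifs <;> linarith
  let pa := (Measure.pi fun _ : Fin B => bitLaw p).map enc
  have hpa : IsProbabilityMeasure pa := Measure.isProbabilityMeasure_map henc.aemeasurable
  have hes : Measurable fun a : Fin B → ℝ => energyShape a u :=
    measurable_energyShape measurable_id measurable_const
  have hin : IsOEDInput P pa (Measure.dirac u) := by
    refine ⟨hpa, inferInstance, ?_, ?_, ?_⟩
    · have hms : MeasurableSet {a : Fin B → ℝ | ∀ b, 0 ≤ a b} := by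
        rw [Set.ofPred_forall]
        exact MeasurableSet.iInter fun b => measurableSet_le measurable_const (measurable_pi_apply b)
      rw [ae_map_iff henc.aemeasurable hms]
      exact ae_of_all _ hencnn
    · rw [ae_dirac_eq]
      exact hu
    · have hes2 : Measurable fun ω : (Fin B → ℝ) × Input B L => energyShape ω.1 ω.2 :=
        measurable_energyShape measurable_fst measurable_snd
      have hpt : ∀ s, (∑ b, ∑ l, ‖energyShape (enc s) u b l‖ₑ ^ 2) =
          ∑ b, ENNReal.ofReal (enc s b) := fun s => by
        refine Finset.sum_congr rfl fun b _ => ?_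
        rw [← energyShape_norm_sq (hencnn s b) (hu b),
          ENNReal.ofReal_sum_of_nonneg fun _ _ => by positivity]
        refine Finset.sum_congr rfl fun l _ => ?_
        rw [ENNReal.ofReal_pow (norm_nonneg _), ofReal_norm]
      have hbit : ∀ b, ∫⁻ s, ENNReal.ofReal (enc s b) ∂(Measure.pi fun _ : Fin B => bitLaw p) =
          ENNReal.ofReal (p * A) := fun b => by
        have hmp := measurePreserving_eval (fun _ : Fin B => bitLaw p) b
        have := hmp.lintegral_comp (f := fun c : Bool => ENNReal.ofReal (if c then A else 0))
          (measurable_of_countable _)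
        refine this.trans ?_
        rw [lintegral_bitLaw, ENNReal.ofReal_mul h0]
        simp
      rw [avgPower, lintegral_map (by fun_prop) hes2, Measure.prod_dirac,
        lintegral_map (by fun_prop) measurable_prodMk_right, lintegral_map (by fun_prop) henc]
      simp only [hpt, div_eq_mul_inv]
      rw [lintegral_mul_const _ (measurable_of_countable _),
        lintegral_finsetSum _ fun b _ => measurable_of_countable _]
      simp only [hbit]
      rw [← div_eq_mul_inv, Finset.sum_const, Finset.card_univ, Fintype.card_fin, nsmul_eq_mul,
        ← ENNReal.ofReal_natCast, ← ENNReal.ofReal_natCast, ← ENNReal.ofReal_mul B.cast_nonneg,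
        ← ENNReal.ofReal_div_of_pos hL']
      refine ENNReal.ofReal_le_ofReal ?_
      rwa [div_le_iff₀ hL']
  refine le_trans ?_ (le_iSup_of_le pa (le_iSup_of_le (Measure.dirac u)
    (le_iSup_of_le hin le_rfl)))
  rw [ENNReal.ofReal_div_of_pos (div_pos hL' hΔf),
    ENNReal.ofReal_div_of_pos (Real.log_pos one_lt_two),
    ENNReal.ofReal_div_of_pos hΔf, ENNReal.ofReal_natCast, mutualInfo]
  gcongr
  rw [energyOutputLaw_dirac]
  have hout : Measurable fun ω : (Fin B → ℝ) × Fading B N × Output B N L =>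
      channelOutput (energyShape ω.1 u) ω.2.1 ω.2.2 :=
    measurable_channelOutput (hes.comp measurable_fst) (measurable_fst.comp measurable_snd)
      (measurable_snd.comp measurable_snd)
  have hrow : ∀ s (k : Fading B N × Output B N L) b n,
      channelOutput (energyShape (enc s) u) k.1 k.2 b n l₀ =
        ((√(enc s b) : ℝ) : ℂ) * k.1 b n + k.2 b n l₀ := by
    intro s k b n
    simp only [channelOutput, energyShape, u, PiLp.smul_apply, PiLp.single_apply, if_true,
      smul_eq_mul, mul_one]
    rw [show star ((√(enc s b) : ℝ) : ℂ) = ((√(enc s b) : ℝ) : ℂ) from Complex.conj_ofReal _,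
      mul_comm]
  have hNd : 4 * fourthMoment ≤ N * (A / 2) ^ 2 := by
    rw [div_pow, hA2]
    apply le_of_eq
    field_simp
    ring
  -- The threshold `1 + A / 2` lies halfway between the mean energies `1` and `1 + A` of an idle and
  -- an active subcarrier.
  have key := le_klDiv_of_bits (ι := Fin B) h0 h1 ((fadingLaw B N).prod (noiseLaw B N L))
    (enc := enc) (dec := fun b a => if 0 < a b then true else false)
    (fun b => Measurable.ite (measurableSet_lt measurable_const (measurable_pi_apply b))
      measurable_const measurable_const)
    (fun b s => by cases hs : s b <;> simp [enc, hs, hA0])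
    (out := fun a k => channelOutput (energyShape a u) k.1 k.2) hout
    (S := fun b => {Y | N * (1 + A / 2) < ∑ n, ‖Y b n l₀‖ ^ 2})
    (fun b => measurableSet_lt measurable_const (by fun_prop)) ?_ ?_
  · rwa [Fintype.card_fin] at key
  · intro b s hs
    have ha : enc s b = A := by simp [enc, hs]
    obtain ⟨m1, m2, m3⟩ := rowLaw_energy_moments l₀ hA0.le hA1
    have := block_detect_ge (B := B) (θ := 1 + A / 2) b (by fun_prop) m1 (half_pos hA0) m2 hN hNd
      (by rw [m3]; linarith)
    simpa only [Set.mem_ofPred_eq, hrow, ha] using this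
  · intro b s hs
    have ha : enc s b = 0 := by simp [enc, hs]
    obtain ⟨m1, m2, m3⟩ := rowLaw_energy_moments l₀ le_rfl zero_le_one
    have := block_detect_le (B := B) (θ := 1 + A / 2) b (by fun_prop) m1 (half_pos hA0) m2 hN hNd
      (by rw [m3]; linarith)
    simpa only [Set.mem_ofPred_eq, hrow, ha] using this

/-! ### Lower bound for the non-coherent capacity: one pilot and antipodal data -/

/-- Polarization, so that the mean of a correlation follows from `integral_rowLaw_norm_sq`. -/
lemma re_star_mul_eq (w v : ℂ) : (star w * v).re = (‖w + v‖ ^ 2 - ‖w - v‖ ^ 2) / 4 := by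
  rw [← Complex.normSq_eq_norm_sq, ← Complex.normSq_eq_norm_sq, Complex.normSq_apply,
    Complex.normSq_apply]
  simp
  ring

/-- The two slots share the fading but have independent noises, so only the fading survives in the
mean of their correlation. Its sign is that of the data symbol relative to the pilot. -/
lemma rowLaw_pilot_moments {L : ℕ} {l m : Fin L} (hlm : l ≠ m) {α β : ℝ} (hα : |α| ≤ 1)
    (hβ : |β| ≤ 1) :
    MemLp (fun r : ℂ × (Fin L → ℂ) =>
      (star ((α : ℂ) * r.1 + r.2 l) * ((β : ℂ) * r.1 + r.2 m)).re) 2 (rowLaw L) ∧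
    ∫ r, (star ((α : ℂ) * r.1 + r.2 l) * ((β : ℂ) * r.1 + r.2 m)).re ^ 2 ∂rowLaw L ≤
      fourthMoment ∧
    ∫ r, (star ((α : ℂ) * r.1 + r.2 l) * ((β : ℂ) * r.1 + r.2 m)).re ∂rowLaw L = α * β := by
  have hα' : ‖(α : ℂ)‖ ≤ 1 := by rwa [Complex.norm_real]
  have hβ' : ‖(β : ℂ)‖ ≤ 1 := by rwa [Complex.norm_real]
  obtain ⟨i1, b1⟩ := rowLaw_fourth_moment hα' l
  obtain ⟨i2, b2⟩ := rowLaw_fourth_moment hβ' m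
  have hi : Integrable (fun r : ℂ × (Fin L → ℂ) =>
      (‖(α : ℂ) * r.1 + r.2 l‖ ^ 4 + ‖(β : ℂ) * r.1 + r.2 m‖ ^ 4) / 2) (rowLaw L) :=
    (i1.add i2).div_const 2
  have hpt : ∀ r : ℂ × (Fin L → ℂ),
      (star ((α : ℂ) * r.1 + r.2 l) * ((β : ℂ) * r.1 + r.2 m)).re ^ 2 ≤
      (‖(α : ℂ) * r.1 + r.2 l‖ ^ 4 + ‖(β : ℂ) * r.1 + r.2 m‖ ^ 4) / 2 := by
    intro r
    have h1 := Complex.abs_re_le_norm (star ((α : ℂ) * r.1 + r.2 l) * ((β : ℂ) * r.1 + r.2 m))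
    rw [norm_mul, norm_star] at h1
    have h2 := pow_le_pow_left₀ (abs_nonneg _) h1 2
    rw [sq_abs] at h2
    nlinarith [sq_nonneg (‖(α : ℂ) * r.1 + r.2 l‖ ^ 2 - ‖(β : ℂ) * r.1 + r.2 m‖ ^ 2)]
  refine ⟨?_, ?_, ?_⟩
  · rw [memLp_two_iff_integrable_sq (by fun_prop)]
    refine hi.mono' (by fun_prop) (ae_of_all _ fun r => ?_)
    rw [Real.norm_eq_abs, abs_of_nonneg (sq_nonneg _)]
    exact hpt r
  · refine (integral_mono_of_nonneg (ae_of_all _ fun r => sq_nonneg _) hi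
      (ae_of_all _ hpt)).trans ?_
    rw [integral_div, integral_add i1 i2]
    linarith
  · have hs : ∀ (ε : ℂ) (z : Fin L → ℂ), ∑ k, (Pi.single l (1 : ℂ) + Pi.single m ε : Fin L → ℂ) k * z k
        = z l + ε * z m := by
      intro ε z
      simp [add_mul, Finset.sum_add_distrib, Pi.single_apply]
    -- The noise contributes the same amount to both squares of the polarization identity and
    -- cancels; this uses `l ≠ m`. What remains is `((α + β) ^ 2 - (α - β) ^ 2) / 4`.
    have hn : ∀ ε : ℂ, ‖ε‖ = 1 →
        ∑ k, ‖(Pi.single l (1 : ℂ) + Pi.single m ε : Fin L → ℂ) k‖ ^ 2 = 2 := by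
      intro ε hε
      have : ∀ k, ‖(Pi.single l (1 : ℂ) + Pi.single m ε : Fin L → ℂ) k‖ ^ 2 =
          (if k = l then 1 else 0) + if k = m then 1 else 0 := by
        intro k
        by_cases hkl : k = l
        · subst hkl
          simp [hlm]
        · by_cases hkm : k = m
          · subst hkm
            simp [hkl, hε]
          · simp [hkl, hkm]
      simp_rw [this]
      rw [Finset.sum_add_distrib]
      simp
      norm_num
    have e1 := integral_rowLaw_norm_sq ((α + β : ℝ) : ℂ) (Pi.single l (1 : ℂ) + Pi.single m 1)
    have e2 := integral_rowLaw_norm_sq ((α - β : ℝ) : ℂ) (Pi.single l (1 : ℂ) + Pi.single m (-1))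
    have j1 := integrable_rowLaw_norm_sq ((α + β : ℝ) : ℂ) (Pi.single l (1 : ℂ) + Pi.single m 1)
    have j2 := integrable_rowLaw_norm_sq ((α - β : ℝ) : ℂ) (Pi.single l (1 : ℂ) + Pi.single m (-1))
    simp only [hs] at e1 e2 j1 j2
    rw [hn _ (by simp)] at e1 e2
    have e : ∀ r : ℂ × (Fin L → ℂ),
        (star ((α : ℂ) * r.1 + r.2 l) * ((β : ℂ) * r.1 + r.2 m)).re =
        (‖((α + β : ℝ) : ℂ) * r.1 + (r.2 l + 1 * r.2 m)‖ ^ 2 -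
          ‖((α - β : ℝ) : ℂ) * r.1 + (r.2 l + -1 * r.2 m)‖ ^ 2) / 4 := by
      intro r
      rw [re_star_mul_eq]
      have w1 : (α : ℂ) * r.1 + r.2 l + ((β : ℂ) * r.1 + r.2 m) =
          ((α + β : ℝ) : ℂ) * r.1 + (r.2 l + 1 * r.2 m) := by push_cast; ring
      have w2 : (α : ℂ) * r.1 + r.2 l - ((β : ℂ) * r.1 + r.2 m) =
          ((α - β : ℝ) : ℂ) * r.1 + (r.2 l + -1 * r.2 m) := by push_cast; ring
      rw [w1, w2]
    simp_rw [e]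
    rw [integral_div, integral_sub j1 j2, e1, e2, Complex.norm_real, Complex.norm_real,
      Real.norm_eq_abs, Real.norm_eq_abs, sq_abs, sq_abs]
    ring

/-- The antipodal symbol of a bit. -/
def antipodal (s : Bool) : ℝ := if s then 1 else -1

/-- On each of the first `S` subcarriers: a pilot of energy `A`, then antipodal symbols of
energy `r`. -/
def pilotCode {B L S : ℕ} (A r : ℝ) (s : Fin S × Fin L → Bool) : Input B (L + 1) :=
  fun b => WithLp.toLp 2 fun l => if h : b.val < S then
    Fin.cases ((√A : ℝ) : ℂ) (fun k => ((√r * antipodal (s (⟨b, h⟩, k)) : ℝ) : ℂ)) l else 0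

lemma sum_sum_pilotCode {B L S : ℕ} (hS : S ≤ B) {A r : ℝ} (hA : 0 ≤ A) (hr : 0 ≤ r)
    (s : Fin S × Fin L → Bool) :
    ∑ b, ∑ l, ‖pilotCode (B := B) A r s b l‖ₑ ^ 2 = ENNReal.ofReal (S * (A + L * r)) := by
  have hb : ∀ b : Fin B, ∑ l, ‖pilotCode (B := B) A r s b l‖ₑ ^ 2 =
      if b.val < S then ENNReal.ofReal (A + L * r) else 0 := by
    intro b
    by_cases h : b.val < S
    · have h0 : ‖pilotCode (B := B) A r s b 0‖ₑ ^ 2 = ENNReal.ofReal A := by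
        simp only [pilotCode, h, dif_pos, Fin.cases_zero]
        rw [← ofReal_norm, ← ENNReal.ofReal_pow (norm_nonneg _), Complex.norm_real,
          Real.norm_eq_abs, sq_abs, Real.sq_sqrt hA]
      have h1 : ∀ k : Fin L, ‖pilotCode (B := B) A r s b k.succ‖ₑ ^ 2 = ENNReal.ofReal r := by
        intro k
        simp only [pilotCode, h, dif_pos, Fin.cases_succ]
        rw [← ofReal_norm, ← ENNReal.ofReal_pow (norm_nonneg _), Complex.norm_real,
          Real.norm_eq_abs, sq_abs, mul_pow, Real.sq_sqrt hr]
        have : antipodal (s (⟨b, h⟩, k)) ^ 2 = 1 := by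
          unfold antipodal; split_ifs <;> norm_num
        rw [this, mul_one]
      rw [Fin.sum_univ_succ, h0]
      simp only [h1, if_pos h]
      rw [Finset.sum_const, Finset.card_univ, Fintype.card_fin, nsmul_eq_mul,
        ← ENNReal.ofReal_natCast, ← ENNReal.ofReal_mul L.cast_nonneg,
        ← ENNReal.ofReal_add hA (by positivity)]
    · simp [pilotCode, h]
  simp_rw [hb]
  rw [← Finset.sum_filter, Finset.sum_const, nsmul_eq_mul]
  have hc : (Finset.univ.filter fun b : Fin B => b.val < S).card = S := by
    have := Fin.card_filter_val_lt (n := B) (m := S)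
    rw [this]; exact min_eq_right hS
  rw [hc, ← ENNReal.ofReal_natCast, ← ENNReal.ofReal_mul S.cast_nonneg]

/-- Pilot-aided antipodal signalling on `S` subcarriers. -/
lemma le_nonCoherentCapacity {B N L S : ℕ} {P Δf A r : ℝ} (hΔf : 0 < Δf) (hS : S ≤ B)
    (hN : 0 < N) (hA : 0 < A) (hA1 : A ≤ 1) (hr : 0 < r) (hr1 : r ≤ 1)
    (hsnr : 4 * fourthMoment ≤ N * (A * r)) (hpow : S * (A + L * r) ≤ P * (L + 1 : ℕ)) :
    ENNReal.ofReal (S * L / 64 / Real.log 2 / ((L + 1 : ℕ) / Δf)) ≤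
      nonCoherentCapacity P Δf B N (L + 1) := by
  have hL' : (0 : ℝ) < (L + 1 : ℕ) := by positivity
  have hbp := isProbabilityMeasure_bitLaw (p := 1 / 2) (by norm_num) (by norm_num)
  let enc : (Fin S × Fin L → Bool) → Input B (L + 1) := pilotCode A r
  have henc : Measurable enc := measurable_of_countable _
  let px := (Measure.pi fun _ : Fin S × Fin L => bitLaw (1 / 2)).map enc
  have hpx : IsProbabilityMeasure px := Measure.isProbabilityMeasure_map henc.aemeasurable
  have hin : IsInput P px := by
    refine ⟨hpx, ?_⟩
    rw [avgPower, lintegral_map (by fun_prop) henc]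
    simp only [enc, sum_sum_pilotCode hS hA.le hr.le]
    rw [lintegral_const, measure_univ, mul_one, ← ENNReal.ofReal_natCast,
      ← ENNReal.ofReal_div_of_pos hL']
    refine ENNReal.ofReal_le_ofReal ?_
    rwa [div_le_iff₀ hL']
  refine le_trans ?_ (le_iSup_of_le px (le_iSup_of_le hin le_rfl))
  rw [ENNReal.ofReal_div_of_pos (div_pos hL' hΔf),
    ENNReal.ofReal_div_of_pos (Real.log_pos one_lt_two),
    ENNReal.ofReal_div_of_pos hΔf, ENNReal.ofReal_natCast, mutualInfo, inputOutputLaw]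
  gcongr
  have hout : Measurable fun ω : Input B (L + 1) × Fading B N × Output B N (L + 1) =>
      channelOutput ω.1 ω.2.1 ω.2.2 :=
    measurable_channelOutput measurable_fst (measurable_fst.comp measurable_snd)
      (measurable_snd.comp measurable_snd)
  let β : Fin S → Fin B := Fin.castLE hS
  have hsqA : |√A| ≤ 1 := by
    rw [abs_of_nonneg (Real.sqrt_nonneg _)]; exact Real.sqrt_le_one.2 hA1
  have hsqr : √r ≤ 1 := Real.sqrt_le_one.2 hr1
  have hsr : ∀ c, |√r * antipodal c| ≤ 1 := by
    intro c
    rw [abs_mul, abs_of_nonneg (Real.sqrt_nonneg _)]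
    cases c <;> simp [antipodal, hsqr]
  have hrow0 : ∀ s (k : Fading B N × Output B N (L + 1)) (b : Fin S) n,
      channelOutput (enc s) k.1 k.2 (β b) n 0 = ((√A : ℝ) : ℂ) * k.1 (β b) n + k.2 (β b) n 0 := by
    intro s k b n
    have hb : (β b).val < S := b.2
    simp only [channelOutput, enc, pilotCode, hb, dif_pos, Fin.cases_zero]
    rw [show star ((√A : ℝ) : ℂ) = ((√A : ℝ) : ℂ) from Complex.conj_ofReal _, mul_comm]
  have hrow1 : ∀ s (k : Fading B N × Output B N (L + 1)) (b : Fin S) (l : Fin L) n,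
      channelOutput (enc s) k.1 k.2 (β b) n l.succ =
        ((√r * antipodal (s (b, l)) : ℝ) : ℂ) * k.1 (β b) n + k.2 (β b) n l.succ := by
    intro s k b l n
    have hb : (β b).val < S := b.2
    have hb' : (⟨(β b).val, hb⟩ : Fin S) = b := rfl
    simp only [channelOutput, enc, pilotCode, hb, dif_pos, Fin.cases_succ, hb']
    rw [show star ((√r * antipodal (s (b, l)) : ℝ) : ℂ) =
      ((√r * antipodal (s (b, l)) : ℝ) : ℂ) from Complex.conj_ofReal _, mul_comm]
  have hd0 : 0 < √A * √r := by positivity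
  have hNd : 4 * fourthMoment ≤ N * (√A * √r) ^ 2 := by
    rwa [mul_pow, Real.sq_sqrt hA.le, Real.sq_sqrt hr.le]
  -- A symbol is decoded from the sign of its correlation with the pilot, whose mean is `±√A √r`.
  -- With threshold zero the margin is `√A √r`, and `hsnr` is then exactly Chebyshev's condition.
  -- For fair bits `p * (1 - p) / 16 = 1 / 64`.
  have key := le_klDiv_of_bits (ι := Fin S × Fin L) (p := 1 / 2) (by norm_num) (by norm_num)
    ((fadingLaw B N).prod (noiseLaw B N (L + 1)))
    (enc := enc) (dec := fun i x => if 0 < (x (β i.1) i.2.succ).re then true else false)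
    (fun i => Measurable.ite (measurableSet_lt measurable_const (by fun_prop))
      measurable_const measurable_const)
    (fun i s => by
      have hb : (β i.1).val < S := i.1.2
      have hb' : (⟨(β i.1).val, hb⟩ : Fin S) = i.1 := rfl
      have hr' : 0 < √r := Real.sqrt_pos.2 hr
      simp only [enc, pilotCode, hb, dif_pos, Fin.cases_succ, hb', Complex.ofReal_re]
      cases hs : s (i.1, i.2) with
      | true => simp [antipodal, hr']
      | false => simp [antipodal, hr'.le])
    (out := fun x k => channelOutput x k.1 k.2) hout
    (S := fun i => {Y | N * (0 : ℝ) < ∑ n, (star (Y (β i.1) n 0) * Y (β i.1) n i.2.succ).re})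
    (fun i => measurableSet_lt measurable_const (by fun_prop)) ?_ ?_
  · refine le_trans (le_of_eq ?_) key
    rw [Fintype.card_prod, Fintype.card_fin, Fintype.card_fin]
    congr 1
    push_cast
    ring
  · rintro ⟨b, l⟩ s hs
    obtain ⟨m1, m2, m3⟩ := rowLaw_pilot_moments (Fin.succ_ne_zero l).symm hsqA
      (hsr (s (b, l)))
    have := block_detect_ge (B := B) (θ := 0) (β b) (by fun_prop) m1 hd0 m2 hN hNd
      (by rw [m3, hs]; simp [antipodal])
    simpa only [Set.mem_ofPred_eq, hrow0, hrow1] using this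
  · rintro ⟨b, l⟩ s hs
    obtain ⟨m1, m2, m3⟩ := rowLaw_pilot_moments (Fin.succ_ne_zero l).symm hsqA
      (hsr (s (b, l)))
    have := block_detect_le (B := B) (θ := 0) (β b) (by fun_prop) m1 hd0 m2 hN hNd
      (by rw [m3, hs]; simp [antipodal])
    simpa only [Set.mem_ofPred_eq, hrow0, hrow1] using this

/-! ### Scaling exponents -/

lemma eventually_const_le_rpow (K : ℝ) {η : ℝ} (hη : 0 < η) :
    ∀ᶠ N : ℕ in atTop, K ≤ (N : ℝ) ^ η :=
  ((tendsto_rpow_atTop hη).comp tendsto_natCast_atTop_atTop).eventually_ge_atTop K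

lemma eventually_const_mul_log_le_rpow (K : ℝ) {η : ℝ} (hη : 0 < η) :
    ∀ᶠ N : ℕ in atTop, K * Real.log N ≤ (N : ℝ) ^ η := by
  have h := (isLittleO_log_rpow_atTop hη).def (c := 1 / (|K| + 1)) (by positivity)
  filter_upwards [tendsto_natCast_atTop_atTop.eventually h, eventually_ge_atTop 1] with N hN h1
  have h1' : (1 : ℝ) ≤ N := Nat.one_le_cast.2 h1
  have hl : 0 ≤ Real.log N := Real.log_nonneg h1'
  have hp : 0 ≤ (N : ℝ) ^ η := by positivity
  rw [Real.norm_eq_abs, Real.norm_eq_abs, abs_of_nonneg hl, abs_of_nonneg hp, one_div,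
    inv_mul_eq_div, le_div_iff₀ (by positivity)] at hN
  have : K * Real.log N ≤ |K| * Real.log N := mul_le_mul_of_nonneg_right (le_abs_self K) hl
  linarith

lemma HasScalingExponent.eventually_bounds {f : ℕ → ℝ≥0∞} {e : ℝ} (h : HasScalingExponent f e)
    {η : ℝ} (hη : 0 < η) :
    ∀ᶠ N : ℕ in atTop, (N : ℝ) ^ (e - η) ≤ (f N).toReal ∧ (f N).toReal ≤ (N : ℝ) ^ (e + η) := by
  have h1 := h.2.eventually (Ioo_mem_nhds (sub_lt_self e hη) (lt_add_of_pos_right e hη))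
  filter_upwards [h.1, h1, eventually_ge_atTop 2] with N hf hN h2
  have h2' : (1 : ℝ) < N := by exact_mod_cast h2
  have hl : 0 < Real.log N := Real.log_pos h2'
  have hpos : 0 < (f N).toReal := ENNReal.toReal_pos hf.1 hf.2
  have hN0 : (0 : ℝ) < N := by linarith
  obtain ⟨ha, hb⟩ := hN
  rw [lt_div_iff₀ hl] at ha
  rw [div_lt_iff₀ hl] at hb
  constructor
  · rw [Real.rpow_def_of_pos hN0, ← Real.le_log_iff_exp_le hpos]
    linarith
  · rw [Real.rpow_def_of_pos hN0, ← Real.log_le_iff_le_exp hpos]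
    linarith

/-- The arbitrary `η` lets capacity bounds lose constants and logarithms. -/
lemma hasScalingExponent_of_bounds {f : ℕ → ℝ≥0∞} {e : ℝ}
    (h : ∀ η : ℝ, 0 < η → ∀ᶠ N : ℕ in atTop, ENNReal.ofReal ((N : ℝ) ^ (e - η)) ≤ f N ∧
      f N ≤ ENNReal.ofReal ((N : ℝ) ^ (e + η))) : HasScalingExponent f e := by
  have hne : ∀ η : ℝ, 0 < η → ∀ᶠ N : ℕ in atTop, (f N ≠ 0 ∧ f N ≠ ∞) ∧
      (N : ℝ) ^ (e - η) ≤ (f N).toReal ∧ (f N).toReal ≤ (N : ℝ) ^ (e + η) := by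
    intro η hη
    filter_upwards [h η hη, eventually_ge_atTop 1] with N hN h1
    have hN0 : (0 : ℝ) < N := Nat.cast_pos.2 h1
    have htop : f N ≠ ∞ := ne_top_of_le_ne_top ENNReal.ofReal_ne_top hN.2
    refine ⟨⟨?_, htop⟩, ?_, ?_⟩
    · exact ((ENNReal.ofReal_pos.2 (Real.rpow_pos_of_pos hN0 _)).trans_le hN.1).ne'
    · exact (ENNReal.ofReal_le_iff_le_toReal htop).1 hN.1
    · exact ENNReal.toReal_le_of_le_ofReal (by positivity) hN.2
  refine ⟨(hne 1 one_pos).mono fun N hN => hN.1, ?_⟩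
  rw [Metric.tendsto_nhds]
  intro r hr
  filter_upwards [hne (r / 2) (half_pos hr), eventually_ge_atTop 2] with N hN h2
  have h2' : (1 : ℝ) < N := by exact_mod_cast h2
  have hl : 0 < Real.log N := Real.log_pos h2'
  have hN0 : (0 : ℝ) < N := by linarith
  obtain ⟨⟨hf0, hft⟩, ha, hb⟩ := hN
  have hpos : 0 < (f N).toReal := ENNReal.toReal_pos hf0 hft
  have ha' := Real.log_le_log (Real.rpow_pos_of_pos hN0 _) ha
  have hb' := Real.log_le_log hpos hb
  rw [Real.log_rpow hN0] at ha' hb'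
  rw [← le_div_iff₀ hl] at ha'
  rw [← div_le_iff₀ hl] at hb'
  rw [Real.dist_eq, abs_lt]
  constructor <;> linarith

lemma HasScalingExponent.eventually_pos {B : ℕ → ℕ} {ε : ℝ}
    (hB : HasScalingExponent (fun N => (B N : ℝ≥0∞)) ε) : ∀ᶠ N in atTop, 0 < B N :=
  hB.1.mono fun N hN => Nat.pos_of_ne_zero fun h => hN.1 (by simp [h])

lemma HasScalingExponent.eventually_natCast_bounds {B : ℕ → ℕ} {ε : ℝ}
    (hB : HasScalingExponent (fun N => (B N : ℝ≥0∞)) ε) {η : ℝ} (hη : 0 < η) :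
    ∀ᶠ N : ℕ in atTop, (N : ℝ) ^ (ε - η) ≤ B N ∧ (B N : ℝ) ≤ (N : ℝ) ^ (ε + η) := by
  simpa using hB.eventually_bounds hη

/-- The logarithmic factors of the upper bounds are negligible on the polynomial scale. -/
lemma eventually_log_factor_le {B L : ℕ → ℕ} {ε τ : ℝ}
    (hB : HasScalingExponent (fun N => (B N : ℝ≥0∞)) ε)
    (hL : HasScalingExponent (fun N => (L N : ℝ≥0∞)) τ) {K η : ℝ} (hK : 0 ≤ K) (hη : 0 < η) :
    ∀ᶠ N : ℕ in atTop, K * (Real.log (B N + 1) + 2 * Real.log (N * L N) + 4) ≤ (N : ℝ) ^ η := by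
  filter_upwards [hB.eventually_pos, hL.eventually_pos, hB.eventually_natCast_bounds one_pos,
    hL.eventually_natCast_bounds one_pos,
    -- With exponents known to within one, the three terms are at most `(ε + 2 * τ + 5) * log N +
    -- 5`; for `N ≥ 3`, where `log N ≥ 1`, this is below `(ε + 2 * τ + 10) * log N`.
    eventually_const_mul_log_le_rpow (K * (ε + 2 * τ + 10)) hη, eventually_ge_atTop 3]
    with N hB0 hL0 hBb hLb hK' h3
  refine le_trans ?_ hK'
  have h3' : (3 : ℝ) ≤ N := by exact_mod_cast h3
  have hN0 : (0 : ℝ) < N := by linarith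
  have hB1 : (1 : ℝ) ≤ B N := Nat.one_le_cast.2 hB0
  have hL1 : (1 : ℝ) ≤ L N := Nat.one_le_cast.2 hL0
  have hlog : 1 ≤ Real.log N := by
    rw [Real.le_log_iff_exp_le hN0]
    linarith [Real.exp_one_lt_d9]
  have e1 : Real.log (B N) ≤ (ε + 1) * Real.log N := by
    rw [← Real.log_rpow hN0]
    exact Real.log_le_log (by linarith) hBb.2
  have e2 : Real.log (L N) ≤ (τ + 1) * Real.log N := by
    rw [← Real.log_rpow hN0]
    exact Real.log_le_log (by linarith) hLb.2
  have e3 : Real.log (B N + 1) ≤ 1 + Real.log (B N) := by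
    have : Real.log (B N + 1) ≤ Real.log (2 * B N) :=
      Real.log_le_log (by linarith) (by linarith)
    rw [Real.log_mul (by norm_num) (by linarith)] at this
    linarith [Real.log_two_lt_d9]
  rw [Real.log_mul hN0.ne' (by linarith), mul_assoc]
  refine mul_le_mul_of_nonneg_left ?_ hK
  nlinarith

/-- The bandwidth bound is the sharp one when `ε - τ ≤ 1/2`, the energy bound otherwise. The loss
`η` is shared between `B`, `L` and the logarithmic factor. -/
lemma eventually_oedCapacity_le {P Δf : ℝ} (hP : 0 < P) (hΔf : 0 < Δf) {B L : ℕ → ℕ} {ε τ : ℝ}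
    (hB : HasScalingExponent (fun N => (B N : ℝ≥0∞)) ε)
    (hL : HasScalingExponent (fun N => (L N : ℝ≥0∞)) τ) {η : ℝ} (hη : 0 < η) :
    ∀ᶠ N : ℕ in atTop, oedCapacity P Δf (B N) N (L N) ≤
      ENNReal.ofReal ((N : ℝ) ^ (min (ε - τ) (1 / 2) + η)) := by
  have hlog2 : 0 < Real.log 2 := Real.log_pos one_lt_two
  set K := Δf / Real.log 2 * (1 + 2 * P) with hK
  have hK0 : 0 ≤ K := by positivity
  have hη3 : 0 < η / 3 := by positivity
  filter_upwards [hB.eventually_pos, hL.eventually_pos, hB.eventually_natCast_bounds hη3,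
    hL.eventually_natCast_bounds hη3, eventually_log_factor_le hB hL hK0 hη3,
    eventually_ge_atTop 1] with N hB0 hL0 hBb hLb hQ hN
  set Q := Real.log (B N + 1) + 2 * Real.log (N * L N) + 4 with hQdef
  have hN1 : (1 : ℝ) ≤ N := Nat.one_le_cast.2 hN
  have hN0 : (0 : ℝ) < N := by linarith
  have hB1 : (1 : ℝ) ≤ B N := Nat.one_le_cast.2 hB0
  have hL1 : (1 : ℝ) ≤ L N := Nat.one_le_cast.2 hL0
  have hl1 : 0 ≤ Real.log (B N + 1) := Real.log_nonneg (by linarith)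
  have hl2 : 0 ≤ Real.log (N * L N) := Real.log_nonneg (by nlinarith)
  have hsN : 1 ≤ √(N : ℝ) := Real.one_le_sqrt.2 hN1
  have hQ4 : 4 ≤ Q := by linarith
  rcases le_total (ε - τ) (1 / 2) with hmin | hmin
  · rw [min_eq_left hmin]
    refine (oedCapacity_le_bandwidth hP.le hΔf hB0 hN hL0).trans (ENNReal.ofReal_le_ofReal ?_)
    have hstep : B N * (Real.log (B N + 1) + 2 * Real.log (N * L N) + 2) + 2 * P ≤
        (1 + 2 * P) * (B N * Q) := by
      have h1 : B N * (Real.log (B N + 1) + 2 * Real.log (N * L N) + 2) ≤ B N * Q :=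
        mul_le_mul_of_nonneg_left (by linarith) (by linarith)
      have h2 : 1 ≤ B N * Q := by nlinarith
      nlinarith
    calc (B N * (Real.log (B N + 1) + 2 * Real.log (N * L N) + 2) + 2 * P) / Real.log 2 /
          (L N / Δf) ≤ (1 + 2 * P) * (B N * Q) / Real.log 2 / (L N / Δf) := by gcongr
      _ = B N * (L N : ℝ)⁻¹ * (K * Q) := by rw [hK]; field_simp
      _ ≤ (N : ℝ) ^ (ε + η / 3) * ((N : ℝ) ^ (τ - η / 3))⁻¹ * (N : ℝ) ^ (η / 3) := by
          gcongr
          · exact hBb.2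
          · exact hLb.1
      _ = (N : ℝ) ^ (ε - τ + η) := by
          rw [← Real.rpow_neg hN0.le, ← Real.rpow_add hN0, ← Real.rpow_add hN0]
          congr 1; ring
  · rw [min_eq_right hmin]
    refine (oedCapacity_le_energy hP.le hΔf hB0 hN hL0).trans (ENNReal.ofReal_le_ofReal ?_)
    have hstep : 1 + (Real.log (B N + 1) + 3) * √N * (P * L N) ≤
        (1 + 2 * P) * (√N * Q) * L N := by
      have h1 : 1 ≤ √N * Q * L N := by
        have : 1 ≤ √N * Q := by nlinarith
        nlinarith
      have h2 : (Real.log (B N + 1) + 3) * √N * (P * L N) ≤ Q * √N * (P * L N) := by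
        gcongr
        linarith
      have h3 : 0 ≤ P * (√N * Q * L N) := by positivity
      linarith
    calc (1 + (Real.log (B N + 1) + 3) * √N * (P * L N)) / Real.log 2 / (L N / Δf)
        ≤ (1 + 2 * P) * (√N * Q) * L N / Real.log 2 / (L N / Δf) := by gcongr
      _ = √N * (K * Q) := by rw [hK]; field_simp
      _ ≤ √N * (N : ℝ) ^ (η / 3) := by gcongr
      _ = (N : ℝ) ^ (1 / 2 + η / 3) := by
          rw [Real.sqrt_eq_rpow, ← Real.rpow_add hN0]
      _ ≤ (N : ℝ) ^ (1 / 2 + η) := Real.rpow_le_rpow_of_exponent_le hN1 (by linarith)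

lemma eventually_le_oedCapacity {P Δf : ℝ} (hP : 0 < P) (hΔf : 0 < Δf) {B L : ℕ → ℕ} {ε τ : ℝ}
    (hB : HasScalingExponent (fun N => (B N : ℝ≥0∞)) ε)
    (hL : HasScalingExponent (fun N => (L N : ℝ≥0∞)) τ) {η : ℝ} (hη : 0 < η) :
    ∀ᶠ N : ℕ in atTop, ENNReal.ofReal ((N : ℝ) ^ (min (ε - τ) (1 / 2) - η)) ≤
      oedCapacity P Δf (B N) N (L N) := by
  have hlog2 : 0 < Real.log 2 := Real.log_pos one_lt_two
  have hM := fourthMoment_pos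
  have hsM : 0 < √fourthMoment := Real.sqrt_pos.2 hM
  set c := min (1 / 2) (P / (4 * √fourthMoment)) with hc
  have hc0 : 0 < c := lt_min (by norm_num) (by positivity)
  set K := c * (Δf / (32 * Real.log 2)) with hK
  have hK0 : 0 < K := by positivity
  have hη3 : 0 < η / 3 := by positivity
  filter_upwards [hB.eventually_pos, hL.eventually_pos, hB.eventually_natCast_bounds hη3,
    hL.eventually_natCast_bounds hη3, eventually_const_le_rpow K⁻¹ hη3,
    eventually_ge_atTop 1, tendsto_natCast_atTop_atTop.eventually_ge_atTop (16 * fourthMoment)]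
    with N hB0 hL0 hBb hLb hKN hN hNM
  have hN1 : (1 : ℝ) ≤ N := Nat.one_le_cast.2 hN
  have hN0 : (0 : ℝ) < N := by linarith
  have hB1 : (1 : ℝ) ≤ B N := Nat.one_le_cast.2 hB0
  have hL1 : (1 : ℝ) ≤ L N := Nat.one_le_cast.2 hL0
  have hsN : 0 < √(N : ℝ) := Real.sqrt_pos.2 hN0
  have hA : 0 < 4 * √(fourthMoment / N) := by positivity
  -- The largest activity the power allows, capped so that `1 - p ≥ 1/2`. The mean number of active
  -- subcarriers is then at least `c * min B (L √N)`, where `c` covers both branches of the minimum.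
  set p := min (1 / 2) (P * L N / (B N * (4 * √(fourthMoment / N)))) with hp
  have hp0 : 0 ≤ p := le_min (by norm_num) (by positivity)
  have hp2 : p ≤ 1 / 2 := min_le_left _ _
  have hpow : B N * (p * (4 * √(fourthMoment / N))) ≤ P * L N := by
    have : p ≤ P * L N / (B N * (4 * √(fourthMoment / N))) := min_le_right _ _
    rw [le_div_iff₀ (by positivity)] at this
    linarith
  refine le_trans (ENNReal.ofReal_le_ofReal ?_)
    (le_oedCapacity hΔf hp0 (by linarith) hNM hL0 hpow)
  have hBp : c * min (B N * (L N : ℝ)⁻¹) √N * L N ≤ B N * p := by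
    rw [hp, mul_min_of_nonneg _ _ (by linarith : (0 : ℝ) ≤ B N)]
    have hmin0 : 0 ≤ min (B N * (L N : ℝ)⁻¹) √N := le_min (by positivity) hsN.le
    refine le_min ?_ ?_
    · calc c * min (B N * (L N : ℝ)⁻¹) √N * L N ≤ 1 / 2 * (B N * (L N : ℝ)⁻¹) * L N := by
            gcongr
            · exact min_le_left _ _
            · exact min_le_left _ _
        _ = B N * (1 / 2) := by field_simp
    · calc c * min (B N * (L N : ℝ)⁻¹) √N * L N ≤ P / (4 * √fourthMoment) * √N * L N := by
            gcongr
            · exact min_le_right _ _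
            · exact min_le_right _ _
        _ = B N * (P * L N / (B N * (4 * √(fourthMoment / N)))) := by
            rw [Real.sqrt_div hM.le]
            field_simp
  have hmin : (N : ℝ) ^ (min (ε - τ) (1 / 2) - 2 * (η / 3)) ≤ min (B N * (L N : ℝ)⁻¹) √N := by
    refine le_min ?_ ?_
    · calc (N : ℝ) ^ (min (ε - τ) (1 / 2) - 2 * (η / 3))
          ≤ (N : ℝ) ^ ((ε - η / 3) + -(τ + η / 3)) := by
            refine Real.rpow_le_rpow_of_exponent_le hN1 ?_
            linarith [min_le_left (ε - τ) (1 / 2)]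
        _ = (N : ℝ) ^ (ε - η / 3) * ((N : ℝ) ^ (τ + η / 3))⁻¹ := by
            rw [Real.rpow_add hN0, Real.rpow_neg hN0.le]
        _ ≤ B N * (L N : ℝ)⁻¹ := by
            gcongr
            · exact hBb.1
            · exact hLb.2
    · rw [Real.sqrt_eq_rpow]
      refine Real.rpow_le_rpow_of_exponent_le hN1 ?_
      linarith [min_le_right (ε - τ) (1 / 2)]
  calc (N : ℝ) ^ (min (ε - τ) (1 / 2) - η)
      = ((N : ℝ) ^ (η / 3))⁻¹ * (N : ℝ) ^ (min (ε - τ) (1 / 2) - 2 * (η / 3)) := by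
        rw [← Real.rpow_neg hN0.le, ← Real.rpow_add hN0]; congr 1; ring
    _ ≤ K * min (B N * (L N : ℝ)⁻¹) √N := by
        gcongr
        rw [inv_le_comm₀ (by positivity) hK0]
        exact hKN
    _ = c * min (B N * (L N : ℝ)⁻¹) √N * L N * (1 / 2) / 16 / Real.log 2 / (L N / Δf) := by
        rw [hK]; field_simp; ring
    _ ≤ B N * p * (1 - p) / 16 / Real.log 2 / (L N / Δf) := by
        have : 1 / 2 ≤ 1 - p := by linarith
        gcongr
    _ = B N * (p * (1 - p)) / 16 / Real.log 2 / (L N / Δf) := by rw [mul_assoc]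

/-- A pilot stronger than the data by a factor of order `N ^ σ` costs no more than the data it
serves when `N ^ σ ≤ L`, and it lowers the energy needed per symbol to order `N ^ (-(1 + σ)/2)`. The
power is then spread over more subcarriers than the `√N` scale of energy detection. -/
lemma eventually_le_nonCoherentCapacity {P Δf : ℝ} (hP : 0 < P) (hΔf : 0 < Δf) {B L : ℕ → ℕ}
    {ε τ : ℝ} (hB : HasScalingExponent (fun N => (B N : ℝ≥0∞)) ε)
    (hL : HasScalingExponent (fun N => (L N : ℝ≥0∞)) τ) {σ : ℝ} (hσ : 0 < σ) (hσ1 : σ ≤ 1)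
    (hστ : σ < τ) {η : ℝ} (hη : 0 < η) :
    ∀ᶠ N : ℕ in atTop, ENNReal.ofReal ((N : ℝ) ^ (min ε ((1 + σ) / 2) - η)) ≤
      nonCoherentCapacity P Δf (B N) N (L N) := by
  have hlog2 : 0 < Real.log 2 := Real.log_pos one_lt_two
  have hM := fourthMoment_pos
  set c := P / (1 + 4 * fourthMoment) with hc
  have hc0 : 0 < c := by positivity
  set K := min 1 (c / 2) * (Δf / (128 * Real.log 2)) with hK
  have hm0 : 0 < min 1 (c / 2) := lt_min one_pos (by positivity)
  have hK0 : 0 < K := by positivity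
  have hη2 : 0 < η / 2 := by positivity
  have hs2 : 0 < (1 + σ) / 2 := by linarith
  filter_upwards [hB.eventually_pos, hB.eventually_natCast_bounds hη2,
    hL.eventually_natCast_bounds (sub_pos.2 hστ), eventually_const_le_rpow K⁻¹ hη2,
    eventually_const_le_rpow 2 hσ, eventually_const_le_rpow (4 * fourthMoment) hs2,
    eventually_const_le_rpow (1 / c) hs2, eventually_ge_atTop 1]
    with N hB0 hBb hLb hKN hσ2 hr hS1 hN
  have hN1 : (1 : ℝ) ≤ N := Nat.one_le_cast.2 hN
  have hN0 : (0 : ℝ) < N := by linarith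
  have hB1 : (1 : ℝ) ≤ B N := Nat.one_le_cast.2 hB0
  -- The slack `τ - σ` serves as the loss in the lower bound on `L`.
  have hLσ : (N : ℝ) ^ σ ≤ L N := by
    have := hLb.1
    rwa [sub_sub_cancel] at this
  have hL2 : (2 : ℝ) ≤ L N := hσ2.trans hLσ
  obtain ⟨l, hl⟩ : ∃ l, L N = l + 1 := Nat.exists_eq_succ_of_ne_zero (by
    rintro h0; rw [h0] at hL2; norm_num at hL2)
  have hlc : (L N : ℝ) = l + 1 := by rw [hl]; push_cast; ring
  set x := (N : ℝ) ^ ((1 + σ) / 2) with hx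
  have hx0 : 0 < x := Real.rpow_pos_of_pos hN0 _
  set S := min (B N) ⌊c * x⌋₊ with hS
  have hSx : (S : ℝ) ≤ c * x :=
    (Nat.cast_le.2 (min_le_right _ _)).trans (Nat.floor_le (by positivity))
  -- The exponents satisfy `N * A = x`, so `r` of order `x⁻¹` keeps `N * A * r` constant, and `A = N
  -- ^ σ * x⁻¹ ≤ L * x⁻¹` makes the block energy of order `L * x⁻¹`. The condition `σ ≤ 1` gives `A
  -- ≤ 1`.
  set A := (N : ℝ) ^ (-((1 - σ) / 2)) with hA
  have hA0 : 0 < A := Real.rpow_pos_of_pos hN0 _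
  have hA1 : A ≤ 1 := Real.rpow_le_one_of_one_le_of_nonpos hN1 (by linarith)
  have hAx : A = (N : ℝ) ^ σ * x⁻¹ := by
    rw [hx, ← Real.rpow_neg hN0.le, ← Real.rpow_add hN0, hA]; congr 1; ring
  have hNAx : N * (A * x⁻¹) = 1 := by
    rw [hA, hx, ← Real.rpow_neg hN0.le, ← Real.rpow_add hN0]
    nth_rewrite 1 [← Real.rpow_one (N : ℝ)]
    rw [← Real.rpow_add hN0, ← Real.rpow_zero (N : ℝ)]
    congr 1; ring
  set r := 4 * fourthMoment * x⁻¹ with hrdef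
  have hr0 : 0 < r := by positivity
  have hr1 : r ≤ 1 := by
    rw [hrdef, ← div_eq_mul_inv, div_le_one hx0]; exact hr
  have hsnr : 4 * fourthMoment ≤ N * (A * r) := by
    apply le_of_eq
    rw [hrdef]
    linear_combination (-(4 * fourthMoment)) * hNAx
  have hl0 : (0 : ℝ) ≤ l := l.cast_nonneg
  have hpow : S * (A + l * r) ≤ P * (l + 1 : ℕ) := by
    have h1 : A + l * r ≤ (1 + 4 * fourthMoment) * (L N * x⁻¹) := by
      have e1 : A ≤ L N * x⁻¹ := by rw [hAx]; gcongr
      have e2 : l * r ≤ 4 * fourthMoment * (L N * x⁻¹) := by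
        rw [hrdef, hlc]
        have : 0 ≤ 4 * fourthMoment * x⁻¹ := by positivity
        nlinarith
      linarith
    calc S * (A + l * r) ≤ (c * x) * ((1 + 4 * fourthMoment) * (L N * x⁻¹)) := by
          gcongr
      _ = P * L N := by rw [hc]; field_simp
      _ = P * (l + 1 : ℕ) := by rw [hl]
  rw [hl]
  refine le_trans (ENNReal.ofReal_le_ofReal ?_)
    (le_nonCoherentCapacity (S := S) hΔf (min_le_left _ _) hN hA0 hA1 hr0 hr1 hsnr hpow)
  have hSlow : min 1 (c / 2) * min (B N : ℝ) x ≤ S := by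
    have hmx0 : 0 ≤ min (B N : ℝ) x := le_min (by linarith) hx0.le
    rw [hS, Nat.cast_min]
    refine le_min ?_ ?_
    · calc min 1 (c / 2) * min (B N : ℝ) x ≤ 1 * B N := by
            gcongr
            · exact min_le_left _ _
            · exact min_le_left _ _
        _ = B N := one_mul _
    · have hcx : 1 ≤ c * x := by
        rw [div_le_iff₀ hc0] at hS1
        linarith
      have hfl : c * x / 2 ≤ ⌊c * x⌋₊ := by
        have h1 : (1 : ℝ) ≤ ⌊c * x⌋₊ := by
          exact_mod_cast (Nat.one_le_floor_iff _).2 hcx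
        have h2 := Nat.lt_floor_add_one (c * x)
        linarith
      refine le_trans ?_ hfl
      calc min 1 (c / 2) * min (B N : ℝ) x ≤ c / 2 * x := by
            gcongr
            · exact min_le_right _ _
            · exact min_le_right _ _
        _ = c * x / 2 := by ring
  have hmin : (N : ℝ) ^ (min ε ((1 + σ) / 2) - η / 2) ≤ min (B N : ℝ) x := by
    refine le_min ?_ ?_
    · refine le_trans (Real.rpow_le_rpow_of_exponent_le hN1 ?_) hBb.1
      linarith [min_le_left ε ((1 + σ) / 2)]
    · refine Real.rpow_le_rpow_of_exponent_le hN1 ?_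
      linarith [min_le_right ε ((1 + σ) / 2)]
  have hlhalf : ((l + 1 : ℕ) : ℝ) / 2 ≤ l := by
    push_cast
    linarith
  have hl1 : (0 : ℝ) < (l + 1 : ℕ) := by positivity
  calc (N : ℝ) ^ (min ε ((1 + σ) / 2) - η)
      = ((N : ℝ) ^ (η / 2))⁻¹ * (N : ℝ) ^ (min ε ((1 + σ) / 2) - η / 2) := by
        rw [← Real.rpow_neg hN0.le, ← Real.rpow_add hN0]; congr 1; ring
    _ ≤ K * min (B N : ℝ) x := by
        gcongr
        rw [inv_le_comm₀ (by positivity) hK0]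
        exact hKN
    _ = min 1 (c / 2) * min (B N : ℝ) x * (((l + 1 : ℕ) : ℝ) / 2) / 64 / Real.log 2 /
          ((l + 1 : ℕ) / Δf) := by
        rw [hK]; field_simp; ring
    _ ≤ S * l / 64 / Real.log 2 / ((l + 1 : ℕ) / Δf) := by
        gcongr

end WidebandSIMO

end

/-! ### The exponent of the OED capacity and the gap -/

open WidebandSIMO in
theorem theorem2 (P Δf : ℝ) (hP : 0 < P) (hΔf : 0 < Δf) (ε τ : ℝ) (hε : 0 ≤ ε) (hτ : 0 ≤ τ)
    (B L : ℕ → ℕ) (hB : HasScalingExponent (fun N => (B N : ℝ≥0∞)) ε)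
    (hL : HasScalingExponent (fun N => (L N : ℝ≥0∞)) τ) :
    HasScalingExponent (fun N => oedCapacity P Δf (B N) N (L N)) (min (ε - τ) (1 / 2)) ∧
    (0 < τ → ∃ δ : ℝ, 0 < δ ∧ ∀ᶠ N : ℕ in atTop,
      (N : ℝ≥0∞) ^ δ * oedCapacity P Δf (B N) N (L N)
        ≤ nonCoherentCapacity P Δf (B N) N (L N)) := by
  refine ⟨hasScalingExponent_of_bounds fun η hη =>
    (eventually_le_oedCapacity hP hΔf hB hL hη).and
      (eventually_oedCapacity_le hP hΔf hB hL hη), fun hτ0 => ?_⟩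
  obtain ⟨σ, hσ, hσ1, hστ⟩ : ∃ σ : ℝ, 0 < σ ∧ σ ≤ 1 ∧ σ < τ :=
    ⟨min τ 1 / 2, by positivity, by linarith [min_le_right τ 1], by linarith [min_le_left τ 1]⟩
  -- Strict in both arguments: `τ > 0` in the first, `σ > 0` in the second.
  have hlt : min (ε - τ) (1 / 2) < min ε ((1 + σ) / 2) :=
    lt_min ((min_le_left _ _).trans_lt (by linarith)) ((min_le_right _ _).trans_lt (by linarith))
  set e := min (ε - τ) (1 / 2)
  set e' := min ε ((1 + σ) / 2)
  -- A quarter of the gap pays for the loss in each of the two capacity bounds and a quarter is the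
  -- gain `δ`; the last quarter is spare.
  have hδ : 0 < (e' - e) / 4 := by linarith
  refine ⟨(e' - e) / 4, hδ, ?_⟩
  filter_upwards [eventually_oedCapacity_le hP hΔf hB hL hδ,
    eventually_le_nonCoherentCapacity hP hΔf hB hL hσ hσ1 hστ hδ, eventually_ge_atTop 1]
    with N hE hn hN
  have hN1 : (1 : ℝ) ≤ N := by exact_mod_cast hN
  have hN0 : (0 : ℝ) < N := by linarith
  have hcast : (N : ℝ≥0∞) ^ ((e' - e) / 4) = ENNReal.ofReal ((N : ℝ) ^ ((e' - e) / 4)) := by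
    rw [← ENNReal.ofReal_rpow_of_pos hN0, ENNReal.ofReal_natCast]
  calc (N : ℝ≥0∞) ^ ((e' - e) / 4) * oedCapacity P Δf (B N) N (L N)
      ≤ ENNReal.ofReal ((N : ℝ) ^ ((e' - e) / 4))
          * ENNReal.ofReal ((N : ℝ) ^ (e + (e' - e) / 4)) := by
        rw [hcast]
        gcongr
    _ = ENNReal.ofReal ((N : ℝ) ^ ((e' - e) / 4 + (e + (e' - e) / 4))) := by
        rw [← ENNReal.ofReal_mul (by positivity), ← Real.rpow_add hN0]
    _ ≤ ENNReal.ofReal ((N : ℝ) ^ (e' - (e' - e) / 4)) :=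
        ENNReal.ofReal_le_ofReal (Real.rpow_le_rpow_of_exponent_le hN1 (by linarith))
    _ ≤ nonCoherentCapacity P Δf (B N) N (L N) := hn
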